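/- Let $d\ge 1$ be an integer and $\alpha>1$. Write $\Omega_\alpha=\{a+ib:\ a,b\in\mathbb R^d,\ |a|+\alpha|b|<1\}\subset\mathbb C^d$. Let $X_\alpha$ be the space of bounded uniformly continuous functions $f:\mathbb R^d\to\mathbb C$ whose restriction to the open unit ball of $\mathbb R^d$ has a continuous extension $f_e$ to $\overline{\Omega}_\alpha$ that is holomorphic in $\Omega_\alpha$, with the norm $\|f\|_{X_\alpha}=\sup_{\mathbb R^d}|f|+\sup_{\Omega_\alpha}|f_e|$. Let $X_\alpha^1$ be the space of those $f\in X_\alpha\cap C^1(\mathbb R^d)$ for which $\partial_j f\in X_\alpha$ for $j=1,\dots,d$ (derivatives with respect to the real variables), with the norm $\|f\|_{X_\alpha^1}=\|f\|_{X_\alpha}+\sum_{j=1}^d\|\partial_j f\|_{X_\alpha}$. For $t>0$ let $$(\mathbb T_t f)(x)=\int_{\mathbb R^d}(4\pi t)^{-d/2}e^{-|x-y|^2/(4t)}f(y)\,dy,\qquad x\in\mathbb R^d,$$ and let $\mathbb T_0=\mathrm{Id}$. Then $(\mathbb T_t)_{t\ge 0}$ is an analytic semigroup on $X_\alpha^1$: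 there are $\delta\in(0,\pi/2]$ and bounded linear operators $S(z)$ on $X_\alpha^1$, for $z\in\Sigma_\delta\cup\{0\}$ with $\Sigma_\delta=\{z\in\mathbb C\setminus\{0\}:|\arg z|<\delta\}$, such that $S(t)=\mathbb T_t$ for all $t>0$, $S(0)=\mathrm{Id}$, $S(z+w)=S(z)S(w)$ for all $z,w\in\Sigma_\delta$, the map $z\mapsto S(z)$ is analytic on $\Sigma_\delta$ for the operator norm, and $S(z)f\to f$ in $X_\alpha^1$ as $z\to0$ in $\Sigma_{\delta'}$, for every $0<\delta'<\delta$ and every $f\in X_\alpha^1$. Moreover, there is a constant $C>0$ such that for all $t>0$ and all $y_0\in X_\alpha^1$, the functions $\mathbb T_t y_0$ and $\partial_j(\mathbb T_t y_0)$, $j=1,\dots,d$, belong to $X_\alpha^1$ and $$\|\mathbb T_t y_0\|_{X_\alpha^1}+\sqrt t\,\|\nabla(\mathbb T_t y_0)\|_{X_\alpha^1}\le C\|y_0\|_{X_\alpha^1},$$ where $\|\nabla g\|_{X_\alpha^1}=\sum_{j=1}^d\|\partial_j g\|_{X_\alpha^1}$. -/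

import Mathlib

open Set Filter Topology MeasureTheory

namespace HeatHol

noncomputable section

/-- `ℝ^d` with its Euclidean norm. -/
abbrev RSpace (d : ℕ) : Type := EuclideanSpace ℝ (Fin d)

/-- `ℂ^d` with its Hermitian norm. -/
abbrev CSpace (d : ℕ) : Type := EuclideanSpace ℂ (Fin d)

/-- The real part of a vector of `ℂ^d`, taken coordinate by coordinate. -/
def rePart {d : ℕ} (z : CSpace d) : RSpace d := WithLp.toLp 2 fun j => (z j).re

/-- The imaginary part of a vector of `ℂ^d`, taken coordinate by coordinate. -/
def imPart {d : ℕ} (z : CSpace d) : RSpace d := WithLp.toLp 2 fun j => (z j).im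

/-- The inclusion of `ℝ^d` in `ℂ^d`. -/
def ofRealVec {d : ℕ} (x : RSpace d) : CSpace d := WithLp.toLp 2 fun j => (x j : ℂ)

/-- The domain `Ω_α = {a + i b : |a| + α |b| < 1}` of `ℂ^d`. -/
def Omega (d : ℕ) (α : ℝ) : Set (CSpace d) := {z | ‖rePart z‖ + α * ‖imPart z‖ < 1}

/-- `F` (whose values off `closure Ω_α` play no role) is a continuous extension to the closure of
`Ω_α` of the restriction of `f` to the open unit ball of `ℝ^d`, and is holomorphic in `Ω_α`. -/
structure IsHolExt {d : ℕ} (α : ℝ) (f : RSpace d → ℂ) (F : CSpace d → ℂ) : Prop where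
  continuousOn : ContinuousOn F (closure (Omega d α))
  differentiableOn : DifferentiableOn ℂ F (Omega d α)
  eq_on_ball : ∀ x ∈ Metric.ball (0 : RSpace d) 1, F (ofRealVec x) = f x

/-- Bounded uniformly continuous functions `ℝ^d → ℂ`. -/
def IsBUC {d : ℕ} (f : RSpace d → ℂ) : Prop :=
  UniformContinuous f ∧ ∃ M : ℝ, ∀ x, ‖f x‖ ≤ M

/-- The supremum of the modulus of a function. -/
def supNorm {ι : Type*} (g : ι → ℂ) : ℝ := ⨆ i, ‖g i‖

/-- `f` belongs to `X_α`: it is in `BUC(ℝ^d)` and its restriction to the unit ball has a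
continuous extension to the closure of `Ω_α` that is holomorphic in `Ω_α`. -/
def MemX {d : ℕ} (α : ℝ) (f : RSpace d → ℂ) : Prop :=
  IsBUC f ∧ ∃ F : CSpace d → ℂ, IsHolExt α f F

/-- The partial derivative `∂_j f` with respect to the real variable `x_j`. -/
def partialDeriv {d : ℕ} (j : Fin d) (f : RSpace d → ℂ) : RSpace d → ℂ :=
  fun x => fderiv ℝ f x (EuclideanSpace.single j 1)

/-- `f` belongs to `X_α^1`: it is in `X_α`, of class `C^1` on `ℝ^d`, and all its first partial
derivatives are in `X_α`. -/
def MemXOne {d : ℕ} (α : ℝ) (f : RSpace d → ℂ) : Prop :=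
  MemX α f ∧ ContDiff ℝ 1 f ∧ ∀ j, MemX α (partialDeriv j f)

/-! ### Elementary facts on real and imaginary parts and on the domain -/

lemma rePart_add_smul {d : ℕ} (r s : ℝ) (z w : CSpace d) :
    rePart (r • z + s • w) = r • rePart z + s • rePart w := by
  ext j; simp [rePart]

lemma imPart_add_smul {d : ℕ} (r s : ℝ) (z w : CSpace d) :
    imPart (r • z + s • w) = r • imPart z + s • imPart w := by
  ext j; simp [imPart]

lemma rePart_ofRealVec {d : ℕ} (x : RSpace d) : rePart (ofRealVec x) = x := by
  ext j; simp [rePart, ofRealVec]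

lemma imPart_ofRealVec {d : ℕ} (x : RSpace d) : imPart (ofRealVec x) = 0 := by
  ext j; simp [imPart, ofRealVec]

lemma continuous_rePart {d : ℕ} : Continuous (rePart : CSpace d → RSpace d) := by
  unfold rePart; fun_prop

lemma continuous_imPart {d : ℕ} : Continuous (imPart : CSpace d → RSpace d) := by
  unfold imPart; fun_prop

lemma norm_le_rePart_imPart {d : ℕ} (z : CSpace d) : ‖z‖ ≤ ‖rePart z‖ + ‖imPart z‖ := by
  have h : ‖z‖ ^ 2 = ‖rePart z‖ ^ 2 + ‖imPart z‖ ^ 2 := by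
    rw [EuclideanSpace.norm_sq_eq, EuclideanSpace.norm_sq_eq, EuclideanSpace.norm_sq_eq,
      ← Finset.sum_add_distrib]
    refine Finset.sum_congr rfl fun j _ => ?_
    rw [Complex.sq_norm, Complex.normSq_apply]
    simp [rePart, imPart, sq]
  have h1 := norm_nonneg (rePart z)
  have h2 := norm_nonneg (imPart z)
  nlinarith [norm_nonneg z, mul_nonneg h1 h2]

lemma isOpen_Omega (d : ℕ) (α : ℝ) : IsOpen (Omega d α) :=
  isOpen_lt (continuous_rePart.norm.add (continuous_const.mul continuous_imPart.norm))
    continuous_const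

lemma convex_Omega (d : ℕ) {α : ℝ} (hα : 0 < α) : Convex ℝ (Omega d α) := by
  intro z hz w hw a b ha hb hab
  change ‖rePart z‖ + α * ‖imPart z‖ < 1 at hz
  change ‖rePart w‖ + α * ‖imPart w‖ < 1 at hw
  change ‖rePart (a • z + b • w)‖ + α * ‖imPart (a • z + b • w)‖ < 1
  rw [rePart_add_smul, imPart_add_smul]
  have h1 := norm_add_le (a • rePart z) (b • rePart w)
  have h2 := norm_add_le (a • imPart z) (b • imPart w)
  rw [norm_smul, norm_smul, Real.norm_of_nonneg ha, Real.norm_of_nonneg hb] at h1 h2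
  have h3 := mul_le_mul_of_nonneg_left h2 hα.le
  rcases ha.eq_or_lt with rfl | ha'
  · have hb1 : b = 1 := by linarith
    subst hb1
    linarith
  · nlinarith [mul_lt_mul_of_pos_left hz ha', mul_le_mul_of_nonneg_left hw.le hb]

lemma isBounded_Omega (d : ℕ) {α : ℝ} (hα : 0 < α) : Bornology.IsBounded (Omega d α) := by
  refine (Metric.isBounded_iff_subset_closedBall (0 : CSpace d)).2 ⟨1 + 1 / α, fun z hz => ?_⟩
  have hz' : ‖rePart z‖ + α * ‖imPart z‖ < 1 := hz
  have h1 := norm_le_rePart_imPart z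
  have h2 : ‖imPart z‖ ≤ 1 / α := by
    rw [le_div_iff₀ hα]
    linarith [norm_nonneg (rePart z), mul_comm α ‖imPart z‖]
  have h3 := mul_nonneg hα.le (norm_nonneg (imPart z))
  rw [mem_closedBall_zero_iff]
  linarith

lemma isCompact_closure_Omega (d : ℕ) {α : ℝ} (hα : 0 < α) :
    IsCompact (closure (Omega d α)) :=
  (isBounded_Omega d hα).isCompact_closure

lemma ofRealVec_mem_Omega {d : ℕ} {α : ℝ} {x : RSpace d} (hx : x ∈ Metric.ball 0 1) :
    ofRealVec x ∈ Omega d α := by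
  simpa [Omega, rePart_ofRealVec, imPart_ofRealVec] using hx

/-! ### Uniqueness of the extension -/

lemma eqOn_zero_of_ball {d : ℕ} {α : ℝ} (hα : 0 < α) {F : CSpace d → ℂ}
    (hc : ContinuousOn F (closure (Omega d α))) (hd : DifferentiableOn ℂ F (Omega d α))
    (h0 : ∀ x ∈ Metric.ball (0 : RSpace d) 1, F (ofRealVec x) = 0) :
    ∀ z ∈ closure (Omega d α), F z = 0 := by
  have key : ∀ z ∈ Omega d α, F z = 0 := by
    intro z hz
    set γ : ℂ → CSpace d := fun w => ofRealVec (rePart z) + w • ofRealVec (imPart z) with hγ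
    have hγd : Differentiable ℂ γ := by
      intro w
      exact (differentiableAt_const _).add (differentiableAt_id.smul_const _)
    have hγr : ∀ r : ℝ, γ r = ofRealVec (rePart z + r • imPart z) := by
      intro r; ext j; simp [hγ, ofRealVec]
    have hγi : γ Complex.I = z := by
      ext j
      simp only [hγ, ofRealVec, rePart, imPart, PiLp.add_apply, PiLp.smul_apply, smul_eq_mul]
      rw [mul_comm]
      exact Complex.re_add_im (z j)
    have hre : ‖rePart z‖ < 1 := by
      have h1 : ‖rePart z‖ + α * ‖imPart z‖ < 1 := hz
      have h2 := mul_nonneg hα.le (norm_nonneg (imPart z))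
      linarith
    set U : Set ℂ := γ ⁻¹' Omega d α with hU
    have hUo : IsOpen U := (isOpen_Omega d α).preimage hγd.continuous
    have hUc : Convex ℝ U := by
      intro w hw w' hw' a b ha hb hab
      have h := convex_Omega d hα hw hw' ha hb hab
      have e : γ (a • w + b • w') = a • γ w + b • γ w' := by
        ext j
        simp only [hγ, PiLp.add_apply, PiLp.smul_apply, smul_eq_mul, Complex.real_smul]
        have hb' : (b : ℂ) = 1 - a := by
          rw [eq_sub_of_add_eq' hab]; push_cast; ring
        rw [hb']; ring
      change γ (a • w + b • w') ∈ Omega d α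
      rw [e]; exact h
    have hI : Complex.I ∈ U := by
      change γ Complex.I ∈ Omega d α
      rw [hγi]; exact hz
    have h0U : (0 : ℂ) ∈ U := by
      change γ 0 ∈ Omega d α
      have := hγr 0
      simp only [Complex.ofReal_zero, zero_smul, add_zero] at this
      rw [this]
      exact ofRealVec_mem_Omega (by simpa using hre)
    have han : AnalyticOnNhd ℂ (F ∘ γ) U := by
      refine DifferentiableOn.analyticOnNhd ?_ hUo
      exact hd.comp hγd.differentiableOn fun w hw => hw
    have hfreq : ∃ᶠ w in 𝓝[≠] (0 : ℂ), (F ∘ γ) w = 0 := by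
      have hev : ∀ᶠ r : ℝ in 𝓝[≠] 0, (F ∘ γ) (r : ℂ) = 0 := by
        have hcont : Continuous fun r : ℝ => ‖rePart z + r • imPart z‖ := by fun_prop
        have : ∀ᶠ r : ℝ in 𝓝 0, ‖rePart z + r • imPart z‖ < 1 :=
          hcont.continuousAt.eventually_lt continuousAt_const (by simpa using hre)
        filter_upwards [nhdsWithin_le_nhds this] with r hr
        rw [Function.comp_apply, hγr]
        exact h0 _ (by simpa using hr)
      have htend : Tendsto (fun r : ℝ => (r : ℂ)) (𝓝[≠] 0) (𝓝[≠] 0) := by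
        refine tendsto_nhdsWithin_iff.2 ⟨?_, ?_⟩
        · exact (Complex.continuous_ofReal.tendsto' 0 0 (by simp)).mono_left nhdsWithin_le_nhds
        · filter_upwards [self_mem_nhdsWithin] with r hr
          simpa using hr
      exact htend.frequently hev.frequently
    have := han.eqOn_zero_of_preconnected_of_frequently_eq_zero hUc.isPreconnected h0U hfreq hI
    simpa [hγi] using this
  intro z hz
  have hcl : z ∈ closure (Omega d α) := hz
  have hmem : (𝓝[Omega d α] z).NeBot := mem_closure_iff_nhdsWithin_neBot.1 hz
  have h1 : Tendsto F (𝓝[Omega d α] z) (𝓝 (F z)) :=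
    (hc z hz).mono_left (nhdsWithin_mono _ subset_closure)
  have h2 : Tendsto F (𝓝[Omega d α] z) (𝓝 0) := by
    refine tendsto_const_nhds.congr' ?_
    filter_upwards [self_mem_nhdsWithin] with w hw
    exact (key w hw).symm
  exact tendsto_nhds_unique h1 h2

lemma IsHolExt.add {d : ℕ} {α : ℝ} {f g : RSpace d → ℂ} {F G : CSpace d → ℂ}
    (hF : IsHolExt α f F) (hG : IsHolExt α g G) : IsHolExt α (f + g) (F + G) :=
  ⟨hF.1.add hG.1, hF.2.add hG.2, fun x hx => by simp [hF.3 x hx, hG.3 x hx]⟩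

lemma IsHolExt.smul {d : ℕ} {α : ℝ} {f : RSpace d → ℂ} {F : CSpace d → ℂ} (c : ℂ)
    (hF : IsHolExt α f F) : IsHolExt α (c • f) (c • F) :=
  ⟨hF.1.const_smul c, hF.2.const_smul c, fun x hx => by simp [hF.3 x hx]⟩

/-- The extension is unique on the closure of `Ω_α`. -/
lemma IsHolExt.unique {d : ℕ} {α : ℝ} (hα : 0 < α) {f : RSpace d → ℂ} {F G : CSpace d → ℂ}
    (hF : IsHolExt α f F) (hG : IsHolExt α f G) : EqOn F G (closure (Omega d α)) := by
  intro z hz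
  have h := hF.add (hG.smul (-1))
  have := eqOn_zero_of_ball hα h.1 h.2 (fun x hx => by simp [hF.3 x hx, hG.3 x hx]) z hz
  simpa [add_neg_eq_zero] using this

/-! ### The space `X_α` -/

/-- `X_α` as a vector subspace of the space of all functions `ℝ^d → ℂ`. -/
def XSubmodule (d : ℕ) (α : ℝ) : Submodule ℂ (RSpace d → ℂ) where
  carrier := {f | MemX α f}
  add_mem' := by
    rintro f g ⟨⟨hf, M, hM⟩, F, hF⟩ ⟨⟨hg, N, hN⟩, G, hG⟩
    exact ⟨⟨hf.add hg, M + N, fun x => (norm_add_le _ _).trans (add_le_add (hM x) (hN x))⟩,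
      _, hF.add hG⟩
  zero_mem' := ⟨⟨uniformContinuous_const, 0, fun x => by simp⟩, 0,
    ⟨continuousOn_const, differentiableOn_const _, fun x _ => rfl⟩⟩
  smul_mem' := by
    rintro c f ⟨⟨hf, M, hM⟩, F, hF⟩
    refine ⟨⟨hf.const_smul c, ‖c‖ * M, fun x => ?_⟩, _, hF.smul c⟩
    rw [Pi.smul_apply, norm_smul]
    exact mul_le_mul_of_nonneg_left (hM x) (norm_nonneg c)

/-- The space `X_α` (for `α > 0`), with the pointwise operations. -/
def XSpace (d : ℕ) (α : ℝ) (_hα : 0 < α) : Type := XSubmodule d α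

instance (d : ℕ) (α : ℝ) (hα : 0 < α) : AddCommGroup (XSpace d α hα) :=
  inferInstanceAs (AddCommGroup (XSubmodule d α))

instance (d : ℕ) (α : ℝ) (hα : 0 < α) : Module ℂ (XSpace d α hα) :=
  inferInstanceAs (Module ℂ (XSubmodule d α))

instance (d : ℕ) (α : ℝ) (hα : 0 < α) : CoeFun (XSpace d α hα) fun _ => RSpace d → ℂ :=
  ⟨fun f => f.1⟩

/-- The holomorphic extension `f_e` of an element `f` of `X_α`. -/
def XSpace.ext {d : ℕ} {α : ℝ} {hα : 0 < α} (f : XSpace d α hα) : CSpace d → ℂ :=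
  Classical.choose f.2.2

/-- The norm of `X_α`: the sup norm of `f` on `ℝ^d` plus the sup norm of `f_e` on `Ω_α`. -/
instance (d : ℕ) (α : ℝ) (hα : 0 < α) : Norm (XSpace d α hα) :=
  ⟨fun f => supNorm f + supNorm fun z : Omega d α => f.ext z⟩

section XFacts

variable {d : ℕ} {α : ℝ} {hα : 0 < α}

lemma supNorm_nonneg {ι : Type*} (g : ι → ℂ) : 0 ≤ supNorm g :=
  Real.iSup_nonneg fun _ => norm_nonneg _

lemma supNorm_smul {ι : Type*} (c : ℂ) (g : ι → ℂ) : supNorm (c • g) = ‖c‖ * supNorm g := by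
  simp only [supNorm, Pi.smul_apply, norm_smul]
  exact (Real.mul_iSup_of_nonneg (norm_nonneg c) _).symm

lemma supNorm_le {ι : Type*} {g : ι → ℂ} {M : ℝ} (hM : 0 ≤ M) (h : ∀ i, ‖g i‖ ≤ M) :
    supNorm g ≤ M :=
  Real.iSup_le h hM

lemma XSpace.holExt (f : XSpace d α hα) : IsHolExt α (f : RSpace d → ℂ) f.ext :=
  Classical.choose_spec f.2.2

lemma XSpace.ext_eq (f : XSpace d α hα) {F : CSpace d → ℂ}
    (hF : IsHolExt α (f : RSpace d → ℂ) F) : EqOn f.ext F (closure (Omega d α)) :=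
  f.holExt.unique hα hF

lemma XSpace.norm_def (f : XSpace d α hα) :
    ‖f‖ = supNorm f + supNorm fun z : Omega d α => f.ext z := rfl

lemma XSpace.coe_add (f g : XSpace d α hα) :
    ((f + g : XSpace d α hα) : RSpace d → ℂ) = f + g := rfl

lemma XSpace.coe_smul (c : ℂ) (f : XSpace d α hα) :
    ((c • f : XSpace d α hα) : RSpace d → ℂ) = c • (f : RSpace d → ℂ) := rfl

lemma XSpace.ext_add (f g : XSpace d α hα) :
    EqOn (f + g).ext (f.ext + g.ext) (closure (Omega d α)) :=
  (f + g).ext_eq (f.holExt.add g.holExt)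

lemma XSpace.ext_smul (c : ℂ) (f : XSpace d α hα) :
    EqOn (c • f).ext (c • f.ext) (closure (Omega d α)) :=
  (c • f).ext_eq (f.holExt.smul c)

lemma XSpace.norm_coe_le (f : XSpace d α hα) (x : RSpace d) :
    ‖f x‖ ≤ supNorm (f : RSpace d → ℂ) := by
  obtain ⟨M, hM⟩ := f.2.1.2
  exact le_ciSup (f := fun x => ‖f x‖) ⟨M, by rintro _ ⟨y, rfl⟩; exact hM y⟩ x

lemma XSpace.norm_ext_le (f : XSpace d α hα) (z : Omega d α) :
    ‖f.ext z‖ ≤ supNorm fun z : Omega d α => f.ext z := by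
  obtain ⟨M, hM⟩ := (isCompact_closure_Omega d hα).exists_bound_of_continuousOn f.holExt.1
  exact le_ciSup (f := fun z : Omega d α => ‖f.ext z‖)
    ⟨M, by rintro _ ⟨y, rfl⟩; exact hM y (subset_closure y.2)⟩ z

lemma XSpace.core (d : ℕ) (α : ℝ) (hα : 0 < α) : NormedSpace.Core ℂ (XSpace d α hα) where
  norm_nonneg f := add_nonneg (supNorm_nonneg _) (supNorm_nonneg _)
  norm_smul c f := by
    have : (fun z : Omega d α => (c • f).ext z) = c • fun z : Omega d α => f.ext z := by
      funext z; exact XSpace.ext_smul c f (subset_closure z.2)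
    rw [XSpace.norm_def, XSpace.norm_def, this, XSpace.coe_smul, supNorm_smul, supNorm_smul,
      mul_add]
  norm_triangle f g := by
    have h1 : supNorm ((f + g : XSpace d α hα) : RSpace d → ℂ) ≤
        supNorm (f : RSpace d → ℂ) + supNorm (g : RSpace d → ℂ) :=
      supNorm_le (add_nonneg (supNorm_nonneg _) (supNorm_nonneg _)) fun x =>
        (norm_add_le _ _).trans (add_le_add (f.norm_coe_le x) (g.norm_coe_le x))
    have h2 : (supNorm fun z : Omega d α => (f + g).ext z) ≤
        (supNorm fun z : Omega d α => f.ext z) + supNorm fun z : Omega d α => g.ext z := by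
      refine supNorm_le (add_nonneg (supNorm_nonneg _) (supNorm_nonneg _)) fun z => ?_
      rw [XSpace.ext_add f g (subset_closure z.2)]
      exact (norm_add_le _ _).trans (add_le_add (f.norm_ext_le z) (g.norm_ext_le z))
    rw [XSpace.norm_def, XSpace.norm_def, XSpace.norm_def]
    linarith
  norm_eq_zero_iff f := by
    constructor
    · intro h
      rw [XSpace.norm_def] at h
      have h1 := supNorm_nonneg (f : RSpace d → ℂ)
      have h2 := supNorm_nonneg fun z : Omega d α => f.ext z
      have h3 : supNorm (f : RSpace d → ℂ) = 0 := by linarith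
      apply Subtype.ext
      funext x
      have := f.norm_coe_le x
      rw [h3] at this
      exact norm_le_zero_iff.1 this
    · rintro rfl
      have := supNorm_smul (0 : ℂ) (0 : RSpace d → ℂ)
      have e : (0 : XSpace d α hα) = (0 : ℂ) • (0 : XSpace d α hα) := by simp
      have h1 : supNorm ((0 : XSpace d α hα) : RSpace d → ℂ) = 0 := by
        rw [zero_smul, norm_zero, zero_mul] at this
        exact this
      have h2 : (fun z : Omega d α => (0 : XSpace d α hα).ext z) =
          (0 : ℂ) • fun z : Omega d α => (0 : XSpace d α hα).ext z := by
        funext z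
        have := XSpace.ext_smul (0 : ℂ) (0 : XSpace d α hα) (subset_closure z.2)
        rwa [← e] at this
      rw [XSpace.norm_def, h1, h2, supNorm_smul]
      simp

end XFacts

instance (d : ℕ) (α : ℝ) (hα : 0 < α) : NormedAddCommGroup (XSpace d α hα) :=
  NormedAddCommGroup.ofCore (XSpace.core d α hα)

instance (d : ℕ) (α : ℝ) (hα : 0 < α) : NormedSpace ℂ (XSpace d α hα) :=
  NormedSpace.ofCore (XSpace.core d α hα)

/-! ### Completeness of `X_α` -/

lemma differentiableOn_of_uniform_limit {d : ℕ} {U : Set (CSpace d)} (hU : IsOpen U)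
    {F : ℕ → CSpace d → ℂ} {G : CSpace d → ℂ} (hF : ∀ n, DifferentiableOn ℂ (F n) U)
    (hFG : TendstoUniformlyOn F G atTop U) : DifferentiableOn ℂ G U := by
  intro c hc
  obtain ⟨r, hr, hrU⟩ : ∃ r > 0, Metric.ball c (r + r) ⊆ U := by
    obtain ⟨e, he, heU⟩ := Metric.isOpen_iff.1 hU c hc
    exact ⟨e / 2, by positivity, by simpa using heU⟩
  have hsub : ∀ x ∈ Metric.ball c r, Metric.ball x r ⊆ U := fun x hx =>
    (Metric.ball_subset_ball' (by
      have := Metric.mem_ball.1 hx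
      linarith)).trans hrU
  have hmem : Metric.ball c r ⊆ U := fun x hx => hsub x hx (Metric.mem_ball_self hr)
  have hcau : UniformCauchySeqOn (fun n x => fderiv ℂ (F n) x) atTop (Metric.ball c r) := by
    rw [Metric.uniformCauchySeqOn_iff]
    intro ε hε
    have h1 := Metric.uniformCauchySeqOn_iff.1 hFG.uniformCauchySeqOn (ε * r / 4) (by positivity)
    obtain ⟨N, hN⟩ := h1
    refine ⟨N, fun m hm n hn x hx => ?_⟩
    have hdm := (hF m x (hmem hx)).differentiableAt (hU.mem_nhds (hmem hx))
    have hdn := (hF n x (hmem hx)).differentiableAt (hU.mem_nhds (hmem hx))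
    rw [dist_eq_norm, ← fderiv_sub hdm hdn]
    have hb := Complex.norm_fderiv_le_div_of_mapsTo_ball (f := F m - F n) (c := x) (R₁ := r)
      (R₂ := ε * r / 2) (((hF m).sub (hF n)).mono (hsub x hx)) (fun y hy => by
        have e1 := hN m hm n hn y (hsub x hx hy)
        have e2 := hN m hm n hn x (hmem hx)
        rw [dist_eq_norm] at e1 e2
        rw [mem_closedBall_iff_norm, Pi.sub_apply, Pi.sub_apply]
        have := norm_sub_le (F m y - F n y) (F m x - F n x)
        linarith) hr
    refine hb.trans_lt ?_
    rw [div_lt_iff₀ hr]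
    nlinarith [mul_pos hε hr]
  have hlim : ∀ x ∈ Metric.ball c r, ∃ L, Tendsto (fun n => fderiv ℂ (F n) x) atTop (𝓝 L) :=
    fun x hx => cauchySeq_tendsto_of_complete (hcau.cauchySeq hx)
  choose! L hL using hlim
  have hunif := hcau.tendstoUniformlyOn_of_tendsto hL
  have hder := hasFDerivAt_of_tendstoUniformlyOn Metric.isOpen_ball hunif
    (fun n x hx => ((hF n x (hmem hx)).differentiableAt (hU.mem_nhds (hmem hx))).hasFDerivAt)
    (fun x hx => hFG.tendsto_at (hmem hx)) (Metric.mem_ball_self hr)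
  exact hder.differentiableAt.differentiableWithinAt

section XComplete

variable {d : ℕ} {α : ℝ} {hα : 0 < α}

lemma XSpace.coe_sub (f g : XSpace d α hα) :
    ((f - g : XSpace d α hα) : RSpace d → ℂ) = f - g := rfl

lemma XSpace.ext_sub (f g : XSpace d α hα) :
    EqOn (f - g).ext (f.ext - g.ext) (closure (Omega d α)) := by
  have h := f.holExt.add (g.holExt.smul (-1))
  intro z hz
  rw [XSpace.ext_eq (F := f.ext + (-1 : ℂ) • g.ext) (f - g)
    (by rw [XSpace.coe_sub, sub_eq_add_neg, ← neg_one_smul ℂ (g : RSpace d → ℂ)]; exact h) hz]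
  simp [sub_eq_add_neg]

lemma XSpace.norm_coe_le_norm (f : XSpace d α hα) (x : RSpace d) : ‖f x‖ ≤ ‖f‖ := by
  have h1 := f.norm_coe_le x
  have h2 := supNorm_nonneg fun z : Omega d α => f.ext z
  rw [XSpace.norm_def]; linarith

lemma XSpace.norm_ext_le_norm (f : XSpace d α hα) {z : CSpace d}
    (hz : z ∈ closure (Omega d α)) : ‖f.ext z‖ ≤ ‖f‖ := by
  have hc : ContinuousOn (fun z => ‖f.ext z‖) (closure (Omega d α)) := f.holExt.1.norm
  refine le_on_closure (f := fun z => ‖f.ext z‖) (g := fun _ => ‖f‖) (fun w hw => ?_) hc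
    continuousOn_const hz
  have h1 := f.norm_ext_le ⟨w, hw⟩
  have h2 := supNorm_nonneg (f : RSpace d → ℂ)
  rw [XSpace.norm_def]; linarith

lemma tendstoUniformlyOn_of_cauchy {ι : Type*} {s : Set ι} {u : ℕ → ι → ℂ}
    (h : ∀ ε > 0, ∃ N, ∀ m ≥ N, ∀ n ≥ N, ∀ x ∈ s, dist (u m x) (u n x) < ε) :
    ∃ v : ι → ℂ, TendstoUniformlyOn u v atTop s := by
  have hcau : UniformCauchySeqOn u atTop s := Metric.uniformCauchySeqOn_iff.2 h
  have hlim : ∀ x ∈ s, ∃ L, Tendsto (fun n => u n x) atTop (𝓝 L) :=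
    fun x hx => cauchySeq_tendsto_of_complete (hcau.cauchySeq hx)
  choose! v hv using hlim
  exact ⟨v, hcau.tendstoUniformlyOn_of_tendsto hv⟩

instance : CompleteSpace (XSpace d α hα) := by
  refine UniformSpace.complete_of_cauchySeq_tendsto fun u hu => ?_
  rw [Metric.cauchySeq_iff] at hu
  obtain ⟨f, hf⟩ := tendstoUniformlyOn_of_cauchy (s := univ) (u := fun n => (u n : RSpace d → ℂ))
    (fun ε hε => by
      obtain ⟨N, hN⟩ := hu ε hε
      refine ⟨N, fun m hm n hn x _ => ?_⟩
      have := (XSpace.norm_coe_le_norm (u m - u n) x).trans_lt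
        (by simpa [dist_eq_norm] using hN m hm n hn)
      rwa [dist_eq_norm])
  obtain ⟨F, hF⟩ := tendstoUniformlyOn_of_cauchy (s := closure (Omega d α))
    (u := fun n => (u n).ext)
    (fun ε hε => by
      obtain ⟨N, hN⟩ := hu ε hε
      refine ⟨N, fun m hm n hn x hx => ?_⟩
      have := (XSpace.norm_ext_le_norm (u m - u n) hx).trans_lt
        (by simpa [dist_eq_norm] using hN m hm n hn)
      rw [XSpace.ext_sub _ _ hx] at this
      rwa [dist_eq_norm])
  have hfu : TendstoUniformly (fun n => (u n : RSpace d → ℂ)) f atTop :=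
    tendstoUniformlyOn_univ.1 hf
  have hext : IsHolExt α f F := by
    refine ⟨hF.continuousOn (Frequently.of_forall fun n => (u n).holExt.1),
      differentiableOn_of_uniform_limit (isOpen_Omega d α) (fun n => (u n).holExt.2)
        (hF.mono subset_closure), fun x hx => ?_⟩
    have h1 := hF.tendsto_at (subset_closure (ofRealVec_mem_Omega (α := α) hx))
    have h2 := hfu.tendsto_at x
    refine tendsto_nhds_unique (h1.congr fun n => ?_) h2
    exact (u n).holExt.3 x hx
  have hmem : MemX α f := by
    refine ⟨⟨hfu.uniformContinuous (Frequently.of_forall fun n => (u n).2.1.1), ?_⟩, F, hext⟩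
    obtain ⟨n, hn⟩ := (Metric.tendstoUniformly_iff.1 hfu 1 one_pos).exists
    refine ⟨‖u n‖ + 1, fun x => ?_⟩
    have h1 := hn x
    rw [dist_eq_norm] at h1
    have h2 := XSpace.norm_coe_le_norm (u n) x
    have h3 := norm_le_norm_add_norm_sub (u n x) (f x)
    rw [norm_sub_rev] at h3
    linarith [norm_sub_rev (f x) (u n x)]
  refine ⟨(⟨f, hmem⟩ : XSpace d α hα), ?_⟩
  set v : XSpace d α hα := ⟨f, hmem⟩ with hv
  rw [Metric.tendsto_nhds]
  intro ε hε
  filter_upwards [Metric.tendstoUniformly_iff.1 hfu (ε / 3) (by positivity),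
    Metric.tendstoUniformlyOn_iff.1 hF (ε / 3) (by positivity)] with n h1 h2
  rw [dist_eq_norm, XSpace.norm_def]
  have e1 : supNorm ((u n - v : XSpace d α hα) : RSpace d → ℂ) ≤ ε / 3 := by
    refine supNorm_le (by positivity) fun x => ?_
    have := (h1 x).le
    rwa [dist_comm, dist_eq_norm] at this
  have e2 : (supNorm fun z : Omega d α => (u n - v).ext z) ≤ ε / 3 := by
    refine supNorm_le (by positivity) fun z => ?_
    have hz := subset_closure z.2
    have := (h2 z hz).le
    rw [dist_comm, dist_eq_norm] at this
    rw [XSpace.ext_sub _ _ hz, Pi.sub_apply, v.ext_eq hext hz]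
    exact this
  linarith

end XComplete

/-! ### The space `X_α^1` -/

section PartialDeriv

variable {d : ℕ}

lemma partialDeriv_add (j : Fin d) {f g : RSpace d → ℂ} (hf : ContDiff ℝ 1 f)
    (hg : ContDiff ℝ 1 g) : partialDeriv j (f + g) = partialDeriv j f + partialDeriv j g := by
  funext x
  simp only [partialDeriv, Pi.add_apply]
  rw [fderiv_add (hf.differentiable one_ne_zero x) (hg.differentiable one_ne_zero x)]
  rfl

lemma partialDeriv_smul (j : Fin d) (c : ℂ) {f : RSpace d → ℂ} (hf : ContDiff ℝ 1 f) :
    partialDeriv j (c • f) = c • partialDeriv j f := by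
  funext x
  simp only [partialDeriv, Pi.smul_apply]
  rw [fderiv_const_smul (hf.differentiable one_ne_zero x)]
  rfl

end PartialDeriv

/-- `X_α^1` as a vector subspace of the space of all functions `ℝ^d → ℂ`. -/
def XOneSubmodule (d : ℕ) (α : ℝ) : Submodule ℂ (RSpace d → ℂ) where
  carrier := {f | MemXOne α f}
  add_mem' := by
    rintro f g ⟨hf, hf1, hf2⟩ ⟨hg, hg1, hg2⟩
    refine ⟨(XSubmodule d α).add_mem hf hg, hf1.add hg1, fun j => ?_⟩
    rw [partialDeriv_add j hf1 hg1]
    exact (XSubmodule d α).add_mem (hf2 j) (hg2 j)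
  zero_mem' := by
    refine ⟨(XSubmodule d α).zero_mem, contDiff_const, fun j => ?_⟩
    have : partialDeriv j (0 : RSpace d → ℂ) = 0 := by
      funext x; simp [partialDeriv]
    rw [this]
    exact (XSubmodule d α).zero_mem
  smul_mem' := by
    rintro c f ⟨hf, hf1, hf2⟩
    refine ⟨(XSubmodule d α).smul_mem c hf, hf1.const_smul c, fun j => ?_⟩
    rw [partialDeriv_smul j c hf1]
    exact (XSubmodule d α).smul_mem c (hf2 j)

/-- The space `X_α^1` (for `α > 0`), with the pointwise operations. -/
def XOneSpace (d : ℕ) (α : ℝ) (_hα : 0 < α) : Type := XOneSubmodule d α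

instance (d : ℕ) (α : ℝ) (hα : 0 < α) : AddCommGroup (XOneSpace d α hα) :=
  inferInstanceAs (AddCommGroup (XOneSubmodule d α))

instance (d : ℕ) (α : ℝ) (hα : 0 < α) : Module ℂ (XOneSpace d α hα) :=
  inferInstanceAs (Module ℂ (XOneSubmodule d α))

instance (d : ℕ) (α : ℝ) (hα : 0 < α) : CoeFun (XOneSpace d α hα) fun _ => RSpace d → ℂ :=
  ⟨fun f => f.1⟩

/-- The inclusion of `X_α^1` in `X_α`. -/
def XOneSpace.toX {d : ℕ} {α : ℝ} {hα : 0 < α} (f : XOneSpace d α hα) : XSpace d α hα :=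
  ⟨f.1, f.2.1⟩

/-- The partial derivative `∂_j f`, in `X_α`, of an element `f` of `X_α^1`. -/
def XOneSpace.partial {d : ℕ} {α : ℝ} {hα : 0 < α} (j : Fin d) (f : XOneSpace d α hα) :
    XSpace d α hα :=
  ⟨partialDeriv j f.1, f.2.2.2 j⟩

/-- The norm of `X_α^1`: `‖f‖ = ‖f‖_{X_α} + ∑ j, ‖∂_j f‖_{X_α}`. -/
instance (d : ℕ) (α : ℝ) (hα : 0 < α) : Norm (XOneSpace d α hα) :=
  ⟨fun f => ‖f.toX‖ + ∑ j, ‖f.partial j‖⟩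

section XOneFacts

variable {d : ℕ} {α : ℝ} {hα : 0 < α}

lemma XOneSpace.norm_def (f : XOneSpace d α hα) : ‖f‖ = ‖f.toX‖ + ∑ j, ‖f.partial j‖ := rfl

lemma XOneSpace.toX_add (f g : XOneSpace d α hα) : (f + g).toX = f.toX + g.toX := rfl

lemma XOneSpace.toX_smul (c : ℂ) (f : XOneSpace d α hα) : (c • f).toX = c • f.toX := rfl

lemma XOneSpace.partial_add (j : Fin d) (f g : XOneSpace d α hα) :
    (f + g).partial j = f.partial j + g.partial j :=
  Subtype.ext (partialDeriv_add j f.2.2.1 g.2.2.1)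

lemma XOneSpace.partial_smul (j : Fin d) (c : ℂ) (f : XOneSpace d α hα) :
    (c • f).partial j = c • f.partial j :=
  Subtype.ext (partialDeriv_smul j c f.2.2.1)

lemma XOneSpace.toX_injective :
    Function.Injective (XOneSpace.toX : XOneSpace d α hα → XSpace d α hα) := fun _ _ h =>
  Subtype.ext (congrArg (fun u : XSpace d α hα => u.1) h)

lemma XOneSpace.core (d : ℕ) (α : ℝ) (hα : 0 < α) : NormedSpace.Core ℂ (XOneSpace d α hα) where
  norm_nonneg f := add_nonneg (norm_nonneg _) (Finset.sum_nonneg fun _ _ => norm_nonneg _)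
  norm_smul c f := by
    simp only [XOneSpace.norm_def, XOneSpace.toX_smul, XOneSpace.partial_smul, norm_smul,
      mul_add, Finset.mul_sum]
  norm_triangle f g := by
    simp only [XOneSpace.norm_def, XOneSpace.toX_add, XOneSpace.partial_add]
    have h1 := norm_add_le f.toX g.toX
    have h2 : ∑ j, ‖f.partial j + g.partial j‖ ≤ ∑ j, ‖f.partial j‖ + ∑ j, ‖g.partial j‖ := by
      rw [← Finset.sum_add_distrib]
      exact Finset.sum_le_sum fun j _ => norm_add_le _ _
    linarith
  norm_eq_zero_iff f := by
    constructor
    · intro h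
      rw [XOneSpace.norm_def] at h
      have h1 := norm_nonneg f.toX
      have h2 : 0 ≤ ∑ j, ‖f.partial j‖ := Finset.sum_nonneg fun _ _ => norm_nonneg _
      have h3 : f.toX = 0 := norm_eq_zero.1 (by linarith)
      exact XOneSpace.toX_injective h3
    · rintro rfl
      have h1 : (0 : XOneSpace d α hα).toX = 0 := rfl
      have h2 : ∀ j, (0 : XOneSpace d α hα).partial j = 0 := fun j => by
        simpa using XOneSpace.partial_smul j 0 (0 : XOneSpace d α hα)
      simp [XOneSpace.norm_def, h1, h2]

end XOneFacts

instance (d : ℕ) (α : ℝ) (hα : 0 < α) : NormedAddCommGroup (XOneSpace d α hα) :=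
  NormedAddCommGroup.ofCore (XOneSpace.core d α hα)

instance (d : ℕ) (α : ℝ) (hα : 0 < α) : NormedSpace ℂ (XOneSpace d α hα) :=
  NormedSpace.ofCore (XOneSpace.core d α hα)

section XOneComplete

variable {d : ℕ} {α : ℝ} {hα : 0 < α}

/-- The differential recovered from the partial derivatives. -/
def gradForm (w : Fin d → ℂ) : RSpace d →L[ℝ] ℂ :=
  ∑ j, (EuclideanSpace.proj j : RSpace d →L[ℝ] ℝ).smulRight (w j)

lemma fderiv_eq_gradForm (f : RSpace d → ℂ) (x : RSpace d) :
    fderiv ℝ f x = gradForm fun j => partialDeriv j f x := by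
  refine ContinuousLinearMap.coe_injective ?_
  refine (EuclideanSpace.basisFun (Fin d) ℝ).toBasis.ext fun i => ?_
  simp only [gradForm, partialDeriv, ContinuousLinearMap.coe_coe, _root_.sum_apply,
    OrthonormalBasis.coe_toBasis, EuclideanSpace.basisFun_apply,
    ContinuousLinearMap.smulRight_apply]
  rw [Finset.sum_eq_single i]
  · simp
  · intro j _ hj
    simp [hj]
  · simp

lemma continuous_gradForm : Continuous (gradForm : (Fin d → ℂ) → RSpace d →L[ℝ] ℂ) := by
  unfold gradForm
  refine continuous_finsetSum _ fun j _ => ?_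
  exact ((ContinuousLinearMap.smulRightL ℝ (RSpace d) ℂ
    (EuclideanSpace.proj j : RSpace d →L[ℝ] ℝ)).continuous).comp (continuous_apply j)

lemma norm_gradForm_le (w : Fin d → ℂ) : ‖gradForm w‖ ≤ ∑ j, ‖w j‖ := by
  refine ContinuousLinearMap.opNorm_le_bound _ (Finset.sum_nonneg fun _ _ => norm_nonneg _)
    fun x => ?_
  simp only [gradForm, _root_.sum_apply, Finset.sum_mul]
  refine (norm_sum_le _ _).trans (Finset.sum_le_sum fun j _ => ?_)
  simp only [ContinuousLinearMap.smulRight_apply, norm_smul]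
  rw [mul_comm]
  exact mul_le_mul_of_nonneg_left (PiLp.norm_apply_le x j) (norm_nonneg _)

lemma XOneSpace.toX_sub (f g : XOneSpace d α hα) : (f - g).toX = f.toX - g.toX := rfl

lemma XOneSpace.partial_sub (j : Fin d) (f g : XOneSpace d α hα) :
    (f - g).partial j = f.partial j - g.partial j := by
  rw [sub_eq_add_neg, sub_eq_add_neg, ← neg_one_smul ℂ g, XOneSpace.partial_add,
    XOneSpace.partial_smul, neg_one_smul]

lemma XOneSpace.norm_toX_le (f : XOneSpace d α hα) : ‖f.toX‖ ≤ ‖f‖ := by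
  rw [XOneSpace.norm_def]
  linarith [Finset.sum_nonneg fun (j : Fin d) (_ : j ∈ Finset.univ) => norm_nonneg (f.partial j)]

lemma XOneSpace.norm_partial_le (j : Fin d) (f : XOneSpace d α hα) : ‖f.partial j‖ ≤ ‖f‖ := by
  rw [XOneSpace.norm_def]
  have := Finset.single_le_sum (f := fun j => ‖f.partial j‖) (fun j _ => norm_nonneg _)
    (Finset.mem_univ j)
  linarith [norm_nonneg f.toX]

instance : CompleteSpace (XOneSpace d α hα) := by
  refine UniformSpace.complete_of_cauchySeq_tendsto fun u hu => ?_
  rw [Metric.cauchySeq_iff] at hu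
  have hX : CauchySeq fun n => (u n).toX := by
    rw [Metric.cauchySeq_iff]
    intro ε hε
    obtain ⟨N, hN⟩ := hu ε hε
    refine ⟨N, fun m hm n hn => ?_⟩
    have := hN m hm n hn
    rw [dist_eq_norm] at this ⊢
    rw [← XOneSpace.toX_sub]
    exact (XOneSpace.norm_toX_le _).trans_lt this
  have hD : ∀ j, CauchySeq fun n => (u n).partial j := by
    intro j
    rw [Metric.cauchySeq_iff]
    intro ε hε
    obtain ⟨N, hN⟩ := hu ε hε
    refine ⟨N, fun m hm n hn => ?_⟩
    have := hN m hm n hn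
    rw [dist_eq_norm] at this ⊢
    rw [← XOneSpace.partial_sub]
    exact (XOneSpace.norm_partial_le j _).trans_lt this
  obtain ⟨f, hf⟩ := cauchySeq_tendsto_of_complete hX
  choose g hg using fun j => cauchySeq_tendsto_of_complete (hD j)
  have hder : ∀ x, HasFDerivAt (f : RSpace d → ℂ) (gradForm fun j => g j x) x := by
    refine hasFDerivAt_of_tendstoUniformly (l := atTop)
      (f := fun n => (u n : RSpace d → ℂ))
      (f' := fun n x => gradForm fun j => partialDeriv j (u n) x)
      (g' := fun x => gradForm fun j => g j x) ?_ ?_ ?_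
    · rw [Metric.tendstoUniformly_iff]
      intro ε hε
      have hsum : Tendsto (fun n => ∑ j, ‖(u n).partial j - g j‖) atTop (𝓝 0) := by
        have := tendsto_finsetSum Finset.univ fun (j : Fin d) _ =>
          (tendsto_iff_norm_sub_tendsto_zero.1 (hg j))
        simpa using this
      filter_upwards [hsum.eventually_lt_const hε] with n hn x
      rw [dist_comm, dist_eq_norm]
      have e : (gradForm fun j => partialDeriv j (u n) x) - (gradForm fun j => g j x) =
          gradForm fun j => ((u n).partial j - g j : XSpace d α hα) x := by
        have h0 : ∀ j, ((u n).partial j - g j : XSpace d α hα) x =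
          partialDeriv j (u n) x - g j x := fun j => rfl
        ext y
        simp [gradForm, h0, mul_sub, Finset.sum_sub_distrib]
      rw [e]
      refine (norm_gradForm_le _).trans_lt (lt_of_le_of_lt ?_ hn)
      exact Finset.sum_le_sum fun j _ => XSpace.norm_coe_le_norm _ x
    · intro n x
      rw [← fderiv_eq_gradForm]
      exact ((u n).2.2.1.differentiable one_ne_zero x).hasFDerivAt
    · intro x
      rw [tendsto_iff_norm_sub_tendsto_zero]
      refine squeeze_zero (fun _ => norm_nonneg _) (fun n => ?_)
        (tendsto_iff_norm_sub_tendsto_zero.1 hf)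
      exact XSpace.norm_coe_le_norm ((u n).toX - f) x
  have hpd : ∀ j, partialDeriv j (f : RSpace d → ℂ) = g j := by
    intro j
    funext x
    simp [partialDeriv, (hder x).fderiv, gradForm,
      PiLp.single_apply]
  have hC1 : ContDiff ℝ 1 (f : RSpace d → ℂ) := by
    rw [contDiff_one_iff_fderiv]
    refine ⟨fun x => (hder x).differentiableAt, ?_⟩
    have : fderiv ℝ (f : RSpace d → ℂ) = fun x => gradForm fun j => g j x :=
      funext fun x => (hder x).fderiv
    rw [this]
    exact continuous_gradForm.comp (continuous_pi fun j => (g j).2.1.1.continuous)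
  have hmem : MemXOne α (f : RSpace d → ℂ) :=
    ⟨f.2, hC1, fun j => by rw [hpd j]; exact (g j).2⟩
  refine ⟨(⟨f.1, hmem⟩ : XOneSpace d α hα), ?_⟩
  set v : XOneSpace d α hα := ⟨f.1, hmem⟩ with hv
  have hvX : v.toX = f := rfl
  have hvD : ∀ j, v.partial j = g j := fun j => Subtype.ext (hpd j)
  rw [tendsto_iff_norm_sub_tendsto_zero]
  have hlim := (tendsto_iff_norm_sub_tendsto_zero.1 hf).add
    (tendsto_finsetSum Finset.univ fun (j : Fin d) _ =>
      (tendsto_iff_norm_sub_tendsto_zero.1 (hg j)))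
  simp only [Finset.sum_const_zero, add_zero] at hlim
  refine hlim.congr fun n => ?_
  rw [XOneSpace.norm_def, XOneSpace.toX_sub, hvX]
  simp only [XOneSpace.partial_sub, hvD]

end XOneComplete

/-! ### The heat semigroup and analytic semigroups -/

/-- The heat kernel `G_d(t, x) = (4πt)^{-d/2} exp(-|x|²/(4t))` on `ℝ^d`. -/
def heatKernel (d : ℕ) (t : ℝ) (x : RSpace d) : ℝ :=
  (4 * Real.pi * t) ^ (-(d : ℝ) / 2) * Real.exp (-‖x‖ ^ 2 / (4 * t))

/-- The heat operator `(T_t f)(x) = ∫ G_d(t, x - y) f(y) dy`, for `t > 0`. -/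
def heatOp {d : ℕ} (t : ℝ) (f : RSpace d → ℂ) : RSpace d → ℂ :=
  fun x => ∫ y, (heatKernel d t (x - y) : ℂ) * f y

/-- The open sector `Σ_δ` of half-angle `δ` about the positive half-line. -/
def sector (δ : ℝ) : Set ℂ := {z | z ≠ 0 ∧ |z.arg| < δ}

/-- A family `S` of bounded operators on a complex Banach space `X`, of which only the values on
`Σ_δ ∪ {0}` matter, is an analytic semigroup of angle `δ ∈ (0, π/2]`. Analyticity is meant for the
operator norm. -/
structure IsAnalyticSemigroup {X : Type*} [NormedAddCommGroup X] [NormedSpace ℂ X]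
    [CompleteSpace X] (δ : ℝ) (S : ℂ → X →L[ℂ] X) : Prop where
  angle_pos : 0 < δ
  angle_le : δ ≤ Real.pi / 2
  map_zero : S 0 = ContinuousLinearMap.id ℂ X
  map_add : ∀ z ∈ sector δ, ∀ w ∈ sector δ, S (z + w) = (S z).comp (S w)
  analytic : AnalyticOnNhd ℂ S (sector δ)
  strongly_continuous : ∀ δ' : ℝ, 0 < δ' → δ' < δ → ∀ x : X,
    Tendsto (fun z => S z x) (𝓝[sector δ'] 0) (𝓝 x)

end

end HeatHol

/-!
The heat kernel extends to an entire function of the space variable, `exp (-(w · w) / (4 t))` up to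
a constant, which decays only where the real part of `w` dominates its imaginary part. At a point
`z = a + i b` of `Ω_α` the integral `∫ G_t(z - y) f(y) dy` is therefore an entire extension of
`T_t f` without a bound that is uniform in `t`. The bound comes from deforming `ℝ^d` to the surface
of the points `y + i ψ(y) b`, where `ψ` is a cut-off of the form `1 - |y - a| / R`, truncated at `0`
and smoothed, with `R` slightly below `1 - |a|`. The surface stays in `Ω_α` as long as `ψ > 0`,
since `|y| + α ψ(y) |b| < 1`, and on it `z - (y + i ψ(y) b)` has the real part `a - y` and an
imaginary part of length `(1 - ψ(y)) |b| ≤ c |a - y|`. The constant `c < 1` exists because `α > 1`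
(`exists_profile`). In such a cone the heat kernel is bounded by a real Gaussian, also for complex
times in a small sector. The deformation leaves the integral unchanged (`integral_shift_sub`)
because the derivative of the integrand with respect to the deformation parameter is a directional
derivative of a compactly supported function.

Everything else is phrased for the class `GaussKernel` of entire kernels with Gaussian bounds. The
convolution with a kernel of this class is a bounded operator on `X_α` and on `X_α^1`, with a norm
controlled by the constants of the kernel (`XSpace.norm_conv_sub_le`, `GaussKernel.convX`,
`GaussKernel.convXOne`). Hence

* the gradient estimate follows because `√t ∂_j G_t` is in the class with the same constants as
  `G_t`, up to a factor (`gaussKernel_fderiv_heatC`);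
* analyticity in the operator norm follows because the first order Taylor remainder
  of `z ↦ G_z(w)` is in the class with a constant of order `|ζ - z|²` (`exists_gaussKernel_taylor`);
* the semigroup law is the Chapman–Kolmogorov identity for Gaussians (`integral_heatC_mul`);
* strong continuity follows from the concentration of the kernels, since `f` and its extension
  together form a uniformly continuous function on `Ω_α ∪ ℝ^d` (`XSpace.exists_norm_glue_sub_le`).
-/

namespace HeatHol

/-! ### Real and imaginary parts -/

lemma rePart_sub {d : ℕ} (z w : CSpace d) : rePart (z - w) = rePart z - rePart w := by
  ext j; simp [rePart]

lemma imPart_sub {d : ℕ} (z w : CSpace d) : imPart (z - w) = imPart z - imPart w := by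
  ext j; simp [imPart]

lemma ofRealVec_sub {d : ℕ} (x y : RSpace d) :
    ofRealVec (x - y) = ofRealVec x - ofRealVec y := by
  ext j; simp [ofRealVec]

lemma norm_sq_eq_rePart_imPart {d : ℕ} (z : CSpace d) :
    ‖z‖ ^ 2 = ‖rePart z‖ ^ 2 + ‖imPart z‖ ^ 2 := by
  rw [EuclideanSpace.norm_sq_eq, EuclideanSpace.norm_sq_eq, EuclideanSpace.norm_sq_eq,
    ← Finset.sum_add_distrib]
  refine Finset.sum_congr rfl fun j _ => ?_
  rw [Complex.sq_norm, Complex.normSq_apply]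
  simp [rePart, imPart, sq]

lemma norm_rePart_le {d : ℕ} (z : CSpace d) : ‖rePart z‖ ≤ ‖z‖ := by
  have := norm_sq_eq_rePart_imPart z
  exact abs_le_of_sq_le_sq' (by nlinarith [sq_nonneg ‖imPart z‖]) (norm_nonneg _) |>.2

lemma norm_imPart_le {d : ℕ} (z : CSpace d) : ‖imPart z‖ ≤ ‖z‖ := by
  have := norm_sq_eq_rePart_imPart z
  exact abs_le_of_sq_le_sq' (by nlinarith [sq_nonneg ‖rePart z‖]) (norm_nonneg _) |>.2

/-- The inclusion of `ℝ^d` in `ℂ^d` as a continuous `ℝ`-linear map. -/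
noncomputable def ofRealVecL (d : ℕ) : RSpace d →L[ℝ] CSpace d :=
  LinearMap.toContinuousLinearMap
    { toFun := ofRealVec
      map_add' := fun x y => by ext j; simp [ofRealVec]
      map_smul' := fun r x => by ext j; simp [ofRealVec] }

lemma ofRealVecL_apply {d : ℕ} (x : RSpace d) : ofRealVecL d x = ofRealVec x := rfl

lemma continuous_ofRealVec {d : ℕ} : Continuous (ofRealVec : RSpace d → CSpace d) :=
  (ofRealVecL d).continuous

lemma norm_ofRealVec {d : ℕ} (x : RSpace d) : ‖ofRealVec x‖ = ‖x‖ := by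
  have := norm_sq_eq_rePart_imPart (ofRealVec x)
  rw [rePart_ofRealVec, imPart_ofRealVec, norm_zero] at this
  exact (sq_eq_sq₀ (norm_nonneg _) (norm_nonneg _)).1 (by simpa using this)

/-! ### Gaussian integrals -/

lemma integrable_gaussian {d : ℕ} {b : ℝ} (hb : 0 < b) (a : RSpace d) :
    Integrable fun y : RSpace d => Real.exp (-b * ‖a - y‖ ^ 2) := by
  have h := (GaussianFourier.integrable_cexp_neg_mul_sq_norm_add (V := RSpace d) (b := (b : ℂ))
    (by simpa using hb) 0 0).norm
  simp only [zero_mul, add_zero, Complex.norm_exp] at h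
  have h2 := Integrable.comp_sub_left h a
  refine h2.congr (ae_of_all _ fun y => ?_)
  simp only
  congr 1
  norm_cast

lemma integral_gaussian {d : ℕ} {b : ℝ} (hb : 0 < b) (a : RSpace d) :
    ∫ y : RSpace d, Real.exp (-b * ‖a - y‖ ^ 2) = (Real.pi / b) ^ ((d : ℝ) / 2) := by
  rw [integral_sub_left_eq_self (fun y : RSpace d => Real.exp (-b * ‖y‖ ^ 2)),
    GaussianFourier.integral_rexp_neg_mul_sq_norm hb]
  simp

/-! ### Convolution with an entire kernel of Gaussian type -/

/-- An entire kernel on `ℂ^d` of Gaussian type: it decays like a Gaussian of rate `m (1 - τ)` in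
the real directions and grows at most like the inverse of a Gaussian of rate `m (1 + τ)` in the
imaginary ones. For small `τ` it thus decays in cones `|im w| ≤ c |re w|` with `c < 1`. -/
structure GaussKernel {d : ℕ} (τ M m : ℝ) (K : CSpace d → ℂ) : Prop where
  pos : 0 < m
  contDiff : ContDiff ℂ 1 K
  bound : ∀ w, ‖K w‖ ≤
    M * Real.exp (-m * ((1 - τ) * ‖rePart w‖ ^ 2 - (1 + τ) * ‖imPart w‖ ^ 2))

/-- The convolution `∫ K(w - y) f(y) dy` over `ℝ^d`, as a function of the complex vector `w`. -/
noncomputable def conv {d : ℕ} (K : CSpace d → ℂ) (f : RSpace d → ℂ) (w : CSpace d) : ℂ :=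
  ∫ y, K (w - ofRealVec y) * f y

section Conv

variable {d : ℕ} {τ M m : ℝ} {K : CSpace d → ℂ} {f : RSpace d → ℂ} {B : ℝ}

lemma GaussKernel.nonneg (hK : GaussKernel τ M m K) : 0 ≤ M := by
  by_contra! h
  have := hK.bound 0
  have h2 := mul_neg_of_neg_of_pos h (Real.exp_pos
    (-m * ((1 - τ) * ‖rePart (0 : CSpace d)‖ ^ 2 - (1 + τ) * ‖imPart (0 : CSpace d)‖ ^ 2)))
  linarith [norm_nonneg (K 0)]

/-- Locally uniform domination of the translates of a kernel of Gaussian type. -/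
lemma GaussKernel.bound_translate (hK : GaussKernel τ M m K) (hτ0 : 0 ≤ τ) (hτ1 : τ < 1)
    {r : ℝ} {w w₀ : CSpace d} (hw : ‖w - w₀‖ ≤ r) (y : RSpace d) :
    ‖K (w - ofRealVec y)‖ ≤
      M * Real.exp (m * ((1 - τ) * r ^ 2 + (1 + τ) * (‖imPart w₀‖ + r) ^ 2)) *
        Real.exp (-(m * (1 - τ) / 2) * ‖rePart w₀ - y‖ ^ 2) := by
  refine (hK.bound _).trans ?_
  rw [mul_assoc, ← Real.exp_add]
  refine mul_le_mul_of_nonneg_left (Real.exp_le_exp.2 ?_) hK.nonneg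
  rw [rePart_sub, imPart_sub, rePart_ofRealVec, imPart_ofRealVec, sub_zero]
  have h1 : ‖rePart w - rePart w₀‖ ≤ r := by
    rw [← rePart_sub]; exact (norm_rePart_le _).trans hw
  have h2 : ‖imPart w - imPart w₀‖ ≤ r := by
    rw [← imPart_sub]; exact (norm_imPart_le _).trans hw
  have h3 : ‖imPart w‖ ≤ ‖imPart w₀‖ + r := by
    have := norm_le_norm_add_norm_sub (imPart w₀) (imPart w)
    rw [norm_sub_rev] at this
    linarith
  have h4 : ‖rePart w₀ - y‖ ≤ ‖rePart w - y‖ + r := by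
    have := norm_sub_le_norm_sub_add_norm_sub (rePart w₀) (rePart w) y
    rw [norm_sub_rev (rePart w₀) (rePart w)] at this
    linarith
  have hr : 0 ≤ r := (norm_nonneg _).trans h1
  have h5 : ‖imPart w‖ ^ 2 ≤ (‖imPart w₀‖ + r) ^ 2 := pow_le_pow_left₀ (norm_nonneg _) h3 2
  have h6 : ‖rePart w₀ - y‖ ^ 2 ≤ 2 * ‖rePart w - y‖ ^ 2 + 2 * r ^ 2 := by
    have := pow_le_pow_left₀ (norm_nonneg _) h4 2
    nlinarith [sq_nonneg (‖rePart w - y‖ - r)]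
  have h7 := mul_le_mul_of_nonneg_left h5 (mul_nonneg hK.pos.le (by linarith : 0 ≤ 1 + τ))
  have h8 := mul_le_mul_of_nonneg_left h6
    (mul_nonneg hK.pos.le (by linarith : 0 ≤ 1 - τ))
  linarith

lemma GaussKernel.bound_real (hK : GaussKernel τ M m K) (w : CSpace d) (y : RSpace d)
    (hw : imPart w = 0) :
    ‖K (w - ofRealVec y)‖ ≤ M * Real.exp (-(m * (1 - τ)) * ‖rePart w - y‖ ^ 2) := by
  refine (hK.bound _).trans (le_of_eq ?_)
  rw [rePart_sub, imPart_sub, rePart_ofRealVec, imPart_ofRealVec, sub_zero, hw, norm_zero]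
  congr 2
  ring

lemma GaussKernel.integrable_mul (hK : GaussKernel τ M m K) (hτ0 : 0 ≤ τ) (hτ1 : τ < 1)
    (hf : Continuous f) (hB : ∀ y, ‖f y‖ ≤ B) (w : CSpace d) :
    Integrable fun y => K (w - ofRealVec y) * f y := by
  have hc : Continuous fun y => K (w - ofRealVec y) :=
    hK.contDiff.continuous.comp (continuous_const.sub continuous_ofRealVec)
  refine Integrable.mono' (((integrable_gaussian (b := m * (1 - τ) / 2)
    (by have := hK.pos; have : 0 < 1 - τ := by linarith
        positivity) (rePart w)).const_mul
      (M * Real.exp (m * ((1 - τ) * 0 ^ 2 + (1 + τ) * (‖imPart w‖ + 0) ^ 2)))).mul_const B)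
    (hc.mul hf).aestronglyMeasurable (ae_of_all _ fun y => ?_)
  rw [norm_mul]
  refine mul_le_mul (hK.bound_translate hτ0 hτ1 (by simp) y) (hB y) (norm_nonneg _) ?_
  have := hK.nonneg
  positivity

lemma GaussKernel.integrable_mul_real (hK : GaussKernel τ M m K) (hτ0 : 0 ≤ τ) (hτ1 : τ < 1)
    (hf : Continuous f) (hB : ∀ y, ‖f y‖ ≤ B) (x : RSpace d) :
    Integrable fun y => K (ofRealVec (x - y)) * f y := by
  simpa [ofRealVec_sub] using hK.integrable_mul hτ0 hτ1 hf hB (ofRealVec x)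

lemma GaussKernel.integrable_sub_real (hK : GaussKernel τ M m K) (hτ0 : 0 ≤ τ) (hτ1 : τ < 1)
    (x : RSpace d) : Integrable fun y => K (ofRealVec (x - y)) := by
  simpa using hK.integrable_mul_real (f := fun _ => 1) (B := 1) hτ0 hτ1 continuous_const
    (by simp) x

lemma GaussKernel.integrable_real (hK : GaussKernel τ M m K) (hτ0 : 0 ≤ τ) (hτ1 : τ < 1) :
    Integrable fun y => K (ofRealVec y) := by
  simpa using (hK.integrable_sub_real hτ0 hτ1 0).comp_sub_left 0

lemma GaussKernel.norm_fderiv_le (hK : GaussKernel τ M m K) (hτ0 : 0 ≤ τ) (hτ1 : τ < 1)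
    {w w₀ : CSpace d} (hw : ‖w - w₀‖ ≤ 1) (y : RSpace d) :
    ‖fderiv ℂ K (w - ofRealVec y)‖ ≤
      2 * (M * Real.exp (m * ((1 - τ) * 2 ^ 2 + (1 + τ) * (‖imPart w₀‖ + 2) ^ 2)) *
        Real.exp (-(m * (1 - τ) / 2) * ‖rePart w₀ - y‖ ^ 2)) := by
  have h := Complex.norm_fderiv_le_div_of_mapsTo_ball (f := K) (c := w - ofRealVec y) (R₁ := 1)
    (R₂ := 2 * (M * Real.exp (m * ((1 - τ) * 2 ^ 2 + (1 + τ) * (‖imPart w₀‖ + 2) ^ 2)) *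
        Real.exp (-(m * (1 - τ) / 2) * ‖rePart w₀ - y‖ ^ 2)))
    ((hK.contDiff.differentiable one_ne_zero).differentiableOn) (fun u hu => ?_) one_pos
  · simpa using h
  · rw [mem_closedBall_iff_norm]
    have h1 := hK.bound_translate hτ0 hτ1 (r := 2) (w := w) (w₀ := w₀) (by linarith) y
    have h2 := hK.bound_translate hτ0 hτ1 (r := 2) (w := u + ofRealVec y) (w₀ := w₀) (by
      have e : u + ofRealVec y - w₀ = (u - (w - ofRealVec y)) + (w - w₀) := by abel
      rw [e]
      refine (norm_add_le _ _).trans ?_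
      have := mem_ball_iff_norm.1 hu
      linarith) y
    rw [add_sub_cancel_right] at h2
    have := norm_sub_le (K u) (K (w - ofRealVec y))
    linarith

/-- The convolution with a kernel of Gaussian type is entire. -/
lemma GaussKernel.hasFDerivAt_conv (hK : GaussKernel τ M m K) (hτ0 : 0 ≤ τ) (hτ1 : τ < 1)
    (hf : Continuous f) (hB : ∀ y, ‖f y‖ ≤ B) (w : CSpace d) :
    HasFDerivAt (𝕜 := ℂ) (conv K f) (∫ y, f y • fderiv ℂ K (w - ofRealVec y)) w ∧
      Integrable (fun y => f y • fderiv ℂ K (w - ofRealVec y)) := by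
  have hm : 0 < m * (1 - τ) / 2 := by
    have := hK.pos; have : 0 < 1 - τ := by linarith
    positivity
  have hsub : Continuous fun y : RSpace d => w - ofRealVec y :=
    continuous_const.sub continuous_ofRealVec
  have hmeas : AEStronglyMeasurable (fun y => f y • fderiv ℂ K (w - ofRealVec y)) volume :=
    (hf.smul ((hK.contDiff.continuous_fderiv one_ne_zero).comp hsub)).aestronglyMeasurable
  have hbd : Integrable fun y => B * (2 * (M * Real.exp (m * ((1 - τ) * 2 ^ 2 + (1 + τ) *
      (‖imPart w‖ + 2) ^ 2)) * Real.exp (-(m * (1 - τ) / 2) * ‖rePart w - y‖ ^ 2))) :=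
    (((integrable_gaussian hm (rePart w)).const_mul _).const_mul 2).const_mul B
  have hle : ∀ y, ∀ u ∈ Metric.closedBall w 1, ‖f y • fderiv ℂ K (u - ofRealVec y)‖ ≤
      B * (2 * (M * Real.exp (m * ((1 - τ) * 2 ^ 2 + (1 + τ) *
      (‖imPart w‖ + 2) ^ 2)) * Real.exp (-(m * (1 - τ) / 2) * ‖rePart w - y‖ ^ 2))) := by
    intro y u hu
    rw [norm_smul]
    exact mul_le_mul (hB y) (hK.norm_fderiv_le hτ0 hτ1 (mem_closedBall_iff_norm.1 hu) y)
      (norm_nonneg _) ((norm_nonneg _).trans (hB y))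
  refine ⟨?_, hbd.mono' hmeas (ae_of_all _ fun y => hle y w (by simp))⟩
  refine hasFDerivAt_integral_of_dominated_of_fderiv_le
    (F := fun w y => K (w - ofRealVec y) * f y)
    (F' := fun w y => f y • fderiv ℂ K (w - ofRealVec y))
    (Metric.closedBall_mem_nhds w one_pos)
    (Eventually.of_forall fun u => (hK.integrable_mul hτ0 hτ1 hf hB u).aestronglyMeasurable)
    (hK.integrable_mul hτ0 hτ1 hf hB w) hmeas (ae_of_all _ hle) hbd (ae_of_all _ fun y u _ => ?_)
  have h1 : HasFDerivAt (𝕜 := ℂ) (fun u : CSpace d => K (u - ofRealVec y))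
      (fderiv ℂ K (u - ofRealVec y)) u :=
    (hasFDerivAt_comp_sub (ofRealVec y)).2
      (hK.contDiff.differentiable one_ne_zero _).hasFDerivAt
  exact h1.mul_const (f y)

lemma GaussKernel.norm_conv_le (hK : GaussKernel τ M m K) (hτ1 : τ < 1)
    (hB : ∀ y, ‖f y‖ ≤ B) (w : CSpace d) (hw : imPart w = 0) :
    ‖conv K f w‖ ≤ M * B * (Real.pi / (m * (1 - τ))) ^ ((d : ℝ) / 2) := by
  have hm : 0 < m * (1 - τ) := by
    have := hK.pos; have : 0 < 1 - τ := by linarith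
    positivity
  rw [← integral_gaussian hm (rePart w), ← integral_const_mul]
  refine norm_integral_le_of_norm_le ((integrable_gaussian hm _).const_mul _)
    (ae_of_all _ fun y => ?_)
  rw [norm_mul]
  calc _ ≤ M * Real.exp (-(m * (1 - τ)) * ‖rePart w - y‖ ^ 2) * B :=
        mul_le_mul (hK.bound_real w y hw) (hB y) (norm_nonneg _)
          (mul_nonneg hK.nonneg (Real.exp_pos _).le)
    _ = _ := by ring

lemma conv_ofRealVec (K : CSpace d → ℂ) (f : RSpace d → ℂ) (x : RSpace d) :
    conv K f (ofRealVec x) = ∫ u, K (ofRealVec u) * f (x - u) := by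
  rw [← integral_sub_left_eq_self _ _ x]
  simp [conv, ofRealVec_sub]

lemma GaussKernel.isBUC_conv (hK : GaussKernel τ M m K) (hτ0 : 0 ≤ τ) (hτ1 : τ < 1)
    (hf : IsBUC f) : IsBUC fun x => conv K f (ofRealVec x) := by
  obtain ⟨hu, B, hB⟩ := hf
  refine ⟨?_, _, fun x => hK.norm_conv_le hτ1 hB _ (imPart_ofRealVec x)⟩
  have hC : 0 ≤ M * (Real.pi / (m * (1 - τ))) ^ ((d : ℝ) / 2) := by
    have := hK.pos; have : 0 < 1 - τ := by linarith
    have := Real.pi_pos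
    have := hK.nonneg
    positivity
  have hfc := hu.continuous
  rw [Metric.uniformContinuous_iff] at hu ⊢
  intro ε hε
  set C := M * (Real.pi / (m * (1 - τ))) ^ ((d : ℝ) / 2) with hCdef
  obtain ⟨δ, hδ, h⟩ := hu (ε / (C + 1)) (by positivity)
  refine ⟨δ, hδ, fun x x' hx => ?_⟩
  -- The difference is the convolution at `0` with the difference of two translates of `f`.
  have e : conv K f (ofRealVec x) - conv K f (ofRealVec x') =
      conv K (fun u => f (x + u) - f (x' + u)) (ofRealVec 0) := by
    have hint : ∀ x, Integrable fun u => K (ofRealVec u) * f (x - u) := by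
      intro x
      have := (hK.integrable_mul hτ0 hτ1 hfc hB (ofRealVec x)).comp_sub_left x
      simpa [ofRealVec_sub] using this
    rw [conv_ofRealVec, conv_ofRealVec, conv_ofRealVec, ← integral_sub (hint x) (hint x')]
    refine integral_congr_ae (ae_of_all _ fun u => ?_)
    simp only [sub_eq_add_neg, zero_add]
    ring
  rw [dist_eq_norm, e]
  refine (hK.norm_conv_le (B := ε / (C + 1)) hτ1 (fun y => ?_) _ (imPart_ofRealVec _)).trans_lt ?_
  · rw [← dist_eq_norm]
    exact (h (by simpa using hx)).le
  · have : M * (ε / (C + 1)) * (Real.pi / (m * (1 - τ))) ^ ((d : ℝ) / 2) = C * (ε / (C + 1)) := by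
      rw [hCdef]; ring
    rw [this, ← mul_div_assoc, div_lt_iff₀ (by positivity)]
    nlinarith

end Conv

/-! ### Shifting the domain of integration into the complex space -/

lemma exists_norm_fderiv_le_of_isCompact {d : ℕ} {O C : Set (CSpace d)} (hO : IsOpen O)
    {Φ : CSpace d → ℂ} (hΦ : DifferentiableOn ℂ Φ O) (hC : IsCompact C) (hCO : C ⊆ O) :
    ∃ A, ∀ w ∈ C, ‖fderiv ℂ Φ w‖ ≤ A := by
  obtain ⟨r, hr, hrO⟩ := hC.exists_cthickening_subset_open hO hCO
  obtain ⟨A, hA⟩ := hC.cthickening (r := r) |>.exists_bound_of_continuousOn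
    (hΦ.continuousOn.mono hrO)
  have hball : ∀ w ∈ C, Metric.ball w r ⊆ Metric.cthickening r C := fun w hw =>
    Metric.ball_subset_closedBall.trans (Metric.closedBall_subset_cthickening hw r)
  refine ⟨(A + A) / r, fun w hw => ?_⟩
  refine Complex.norm_fderiv_le_div_of_mapsTo_ball (hΦ.mono ((hball w hw).trans hrO))
    (fun u hu => ?_) hr
  rw [mem_closedBall_iff_norm]
  exact (norm_sub_le _ _).trans
    (add_le_add (hA u (hball w hw hu)) (hA w (hball w hw (Metric.mem_ball_self hr))))

/-- The point `y + i θ ψ(y) b` of `ℂ^d`. For fixed `θ` these points form a deformation of `ℝ^d`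
in the imaginary direction `b`. -/
noncomputable def shift {d : ℕ} (b : RSpace d) (ψ : RSpace d → ℝ) (θ : ℝ) (y : RSpace d) :
    CSpace d :=
  ofRealVec y + ((θ * ψ y : ℝ) * Complex.I) • ofRealVec b

section Shift

variable {d : ℕ} {b : RSpace d} {ψ χ : RSpace d → ℝ}

lemma rePart_shift (θ : ℝ) (y : RSpace d) : rePart (shift b ψ θ y) = y := by
  ext j; simp [rePart, shift, ofRealVec]

lemma imPart_shift (θ : ℝ) (y : RSpace d) : imPart (shift b ψ θ y) = (θ * ψ y) • b := by
  ext j; simp [imPart, shift, ofRealVec]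

lemma shift_eq_ofRealVec {θ : ℝ} {y : RSpace d} (h : θ * ψ y = 0) :
    shift b ψ θ y = ofRealVec y := by
  simp [shift, h]

lemma continuous_shift (hψ : Continuous ψ) :
    Continuous fun p : ℝ × RSpace d => shift b ψ p.1 p.2 := by
  unfold shift
  have h1 : Continuous fun p : ℝ × RSpace d => ((p.1 * ψ p.2 : ℝ) : ℂ) * Complex.I := by fun_prop
  exact (continuous_ofRealVec.comp continuous_snd).add (h1.smul continuous_const)

lemma hasDerivAt_shift (θ : ℝ) (y : RSpace d) :
    HasDerivAt (fun θ => shift b ψ θ y) (((ψ y : ℝ) * Complex.I) • ofRealVec b) θ := by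
  unfold shift
  refine HasDerivAt.const_add _ (HasDerivAt.smul_const ?_ _)
  have h1 : HasDerivAt (fun θ : ℝ => θ * ψ y) (ψ y) θ := by
    simpa using (hasDerivAt_id θ).mul_const (ψ y)
  exact h1.ofReal_comp.mul_const _

lemma hasLineDerivAt_shift {y : RSpace d} (hψ : HasLineDerivAt ℝ ψ (χ y) y b) (θ : ℝ) :
    HasLineDerivAt ℝ (shift b ψ θ) ((1 + (θ * χ y : ℝ) * Complex.I) • ofRealVec b) y b := by
  have h1 : HasDerivAt (fun t : ℝ => θ * ψ (y + t • b)) (θ * χ y) 0 :=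
    HasDerivAt.const_mul θ hψ
  have h2 : HasDerivAt (fun t : ℝ => ofRealVecL d (y + t • b)) (ofRealVecL d b) 0 := by
    refine (ofRealVecL d).hasFDerivAt.comp_hasDerivAt (0 : ℝ) ?_
    simpa using ((hasDerivAt_id (0 : ℝ)).smul_const b).const_add y
  have h3 := h2.add ((h1.ofReal_comp.mul_const Complex.I).smul_const (ofRealVec b))
  unfold HasLineDerivAt shift
  rw [add_smul, one_smul]
  exact h3

/-- **Invariance of the integral under deformation.** If `Φ` is holomorphic near the points
`y + i θ ψ(y) b` for `y` in a ball outside of which `ψ` vanishes, then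
`∫ Φ(y + i ψ(y) b) (1 + i ∂_b ψ(y)) dy = ∫ Φ(y) dy`; here `χ = ∂_b ψ`, and the statement concerns
the difference of the integrands, which vanishes outside the ball. The integrand is the pullback of
`Φ dz₁ ∧ ⋯ ∧ dz_d`, and its derivative in `θ` is the derivative of `i ψ Φ(y + i θ ψ(y) b)` in the
direction `b`, so that its integral vanishes. -/
lemma integral_shift_sub {O : Set (CSpace d)} (hO : IsOpen O) {Φ : CSpace d → ℂ}
    (hΦ : DifferentiableOn ℂ Φ O) {a : RSpace d} {ρ θ₀ : ℝ} (hθ₀ : 1 < θ₀)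
    (hψ : Continuous ψ) (hχ : Continuous χ) (hd : ∀ y, HasLineDerivAt ℝ ψ (χ y) y b)
    (h0 : ∀ y ∉ Metric.closedBall a ρ, ψ y = 0 ∧ χ y = 0)
    (hO' : ∀ y ∈ Metric.closedBall a ρ, ∀ θ : ℝ, |θ| < θ₀ → shift b ψ θ y ∈ O) :
    Integrable (fun y => Φ (shift b ψ 1 y) * (1 + χ y * Complex.I) - Φ (ofRealVec y)) ∧
      ∫ y, (Φ (shift b ψ 1 y) * (1 + χ y * Complex.I) - Φ (ofRealVec y)) = 0 := by
  set S : Set (RSpace d) := Metric.closedBall a ρ with hS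
  have hSc : IsCompact S := isCompact_closedBall a ρ
  have hSm : MeasurableSet S := Metric.isClosed_closedBall.measurableSet
  have hcs : ∀ θ, Continuous (shift b ψ θ) := fun θ =>
    (continuous_shift hψ).comp (Continuous.prodMk_right θ)
  -- A function that is continuous on the ball and zero outside is integrable.
  have hint : ∀ g : RSpace d → ℂ, ContinuousOn g S → (∀ y ∉ S, g y = 0) → Integrable g := by
    intro g hg hg0
    have : IntegrableOn g S := hg.integrableOn_compact hSc
    exact (integrableOn_iff_integrable_of_support_subset fun y hy => by
      by_contra h; exact hy (hg0 y h)).1 this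
  set J : ℝ → RSpace d → ℂ := fun θ y =>
    Φ (shift b ψ θ y) * (1 + (θ * χ y : ℝ) * Complex.I) - Φ (ofRealVec y) with hJ
  set J' : ℝ → RSpace d → ℂ := fun θ y =>
    fderiv ℂ Φ (shift b ψ θ y) (ofRealVec b) * (ψ y * Complex.I) *
      (1 + (θ * χ y : ℝ) * Complex.I) + Φ (shift b ψ θ y) * (χ y * Complex.I) with hJ'
  set h : ℝ → RSpace d → ℂ := fun θ y => Φ (shift b ψ θ y) * (ψ y * Complex.I) with hh
  have hJ0 : ∀ θ, ∀ y ∉ S, J θ y = 0 := fun θ y hy => by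
    simp [hJ, (h0 y hy).1, (h0 y hy).2, shift_eq_ofRealVec]
  have hJ'0 : ∀ θ, ∀ y ∉ S, J' θ y = 0 := fun θ y hy => by
    simp [hJ', (h0 y hy).1, (h0 y hy).2]
  have hh0 : ∀ θ, ∀ y ∉ S, h θ y = 0 := fun θ y hy => by
    simp [hh, (h0 y hy).1]
  have hreal : ∀ y ∈ S, ofRealVec y ∈ O := fun y hy => by
    have := hO' y hy 0 (by simp; linarith)
    rwa [shift_eq_ofRealVec (zero_mul _)] at this
  have hΦd : ∀ θ, |θ| < θ₀ → ∀ y ∈ S, HasFDerivAt Φ (fderiv ℂ Φ (shift b ψ θ y))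
      (shift b ψ θ y) := fun θ hθ y hy =>
    (hΦ.differentiableAt (hO.mem_nhds (hO' y hy θ hθ))).hasFDerivAt
  have hΦc : ∀ θ, |θ| < θ₀ → ContinuousOn (fun y => Φ (shift b ψ θ y)) S := fun θ hθ =>
    hΦ.continuousOn.comp (hcs θ).continuousOn fun y hy => hO' y hy θ hθ
  have hJi : ∀ θ, |θ| < θ₀ → Integrable (J θ) := fun θ hθ => by
    refine hint _ (((hΦc θ hθ).mul ?_).sub ?_) (hJ0 θ)
    · exact Continuous.continuousOn (by fun_prop)
    · exact hΦ.continuousOn.comp continuous_ofRealVec.continuousOn hreal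
  have hhi : ∀ θ, |θ| < θ₀ → Integrable (h θ) := fun θ hθ =>
    hint _ ((hΦc θ hθ).mul (Continuous.continuousOn (by fun_prop))) (hh0 θ)
  have hJd : ∀ θ, |θ| < θ₀ → ∀ y, HasDerivAt (fun θ => J θ y) (J' θ y) θ := by
    intro θ hθ y
    by_cases hy : y ∈ S
    · have h1 : HasDerivAt (fun θ => Φ (shift b ψ θ y))
          (fderiv ℂ Φ (shift b ψ θ y) (((ψ y : ℝ) * Complex.I) • ofRealVec b)) θ :=
        ((hΦd θ hθ y hy).restrictScalars ℝ).comp_hasDerivAt (f := fun θ => shift b ψ θ y) θ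
          (hasDerivAt_shift θ y)
      have h2 : HasDerivAt (fun θ : ℝ => θ * χ y) (χ y) θ := by
        simpa using (hasDerivAt_id θ).mul_const (χ y)
      have h3 := (h1.mul ((h2.ofReal_comp.mul_const Complex.I).const_add 1)).sub_const
        (Φ (ofRealVec y))
      refine h3.congr_deriv ?_
      simp only [hJ', map_smul, smul_eq_mul]
      ring
    · rw [hJ'0 θ y hy]
      have : (fun θ => J θ y) = fun _ => 0 := funext fun θ => hJ0 θ y hy
      rw [this]
      exact hasDerivAt_const _ _
  have hhd : ∀ θ, |θ| < θ₀ → ∀ y, HasLineDerivAt ℝ (h θ) (J' θ y) y b := by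
    intro θ hθ y
    by_cases hy : y ∈ S
    · have h1 : HasLineDerivAt ℝ (fun y => Φ (shift b ψ θ y))
          (fderiv ℂ Φ (shift b ψ θ y) ((1 + (θ * χ y : ℝ) * Complex.I) • ofRealVec b)) y b := by
        have hl := hasLineDerivAt_shift (hd y) θ
        have hf := (hΦd θ hθ y hy).restrictScalars ℝ
        have e : shift b ψ θ y = shift b ψ θ (y + (0 : ℝ) • b) := by simp
        rw [e] at hf
        have := hf.comp_hasDerivAt (0 : ℝ) hl
        rw [← e] at this
        exact this
      have h2 : HasLineDerivAt ℝ (fun y => (ψ y : ℂ) * Complex.I) (χ y * Complex.I) y b :=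
        (HasDerivAt.ofReal_comp (hd y)).mul_const Complex.I
      have h3 := HasDerivAt.mul h1 h2
      refine HasDerivAt.congr_deriv h3 ?_
      simp only [hJ', map_smul, smul_eq_mul, zero_smul, add_zero]
      ring
    · rw [hJ'0 θ y hy]
      have hev : h θ =ᶠ[𝓝 y] fun _ => 0 := by
        filter_upwards [Metric.isClosed_closedBall.isOpen_compl.mem_nhds hy] with u hu
        exact hh0 θ u hu
      have : HasFDerivAt (h θ) (0 : RSpace d →L[ℝ] ℂ) y :=
        (hasFDerivAt_const (0 : ℂ) y).congr_of_eventuallyEq hev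
      simpa using this.hasLineDerivAt b
  have hJ'meas : ∀ θ, |θ| < θ₀ → AEStronglyMeasurable (J' θ) volume := by
    intro θ hθ
    have : J' θ = S.indicator (J' θ) := by
      rw [eq_comm, Set.indicator_eq_self]
      intro y hy; by_contra h; exact hy (hJ'0 θ y h)
    rw [this]
    refine (aestronglyMeasurable_indicator_iff hSm).2 ?_
    have h1 : Measurable fun y => fderiv ℂ Φ (shift b ψ θ y) (ofRealVec b) :=
      (measurable_fderiv_apply_const ℂ Φ (ofRealVec b)).comp (hcs θ).measurable
    have h2 : AEStronglyMeasurable (fun y => Φ (shift b ψ θ y)) (volume.restrict S) :=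
      (hΦc θ hθ).aestronglyMeasurable hSm
    refine ((h1.aestronglyMeasurable.mul ?_).mul ?_).add (h2.mul ?_)
    all_goals exact Continuous.aestronglyMeasurable (by fun_prop)
  have hbound : ∀ θ₁, θ₁ < θ₀ → ∃ A, ∀ θ, |θ| ≤ θ₁ → ∀ y ∈ S, ‖J' θ y‖ ≤ A := by
    intro θ₁ hθ₁
    set T : Set (ℝ × RSpace d) := Icc (-θ₁) θ₁ ×ˢ S with hT
    have hTc : IsCompact T := isCompact_Icc.prod hSc
    have hCc := hTc.image (continuous_shift (b := b) hψ)
    have hCO : (fun p : ℝ × RSpace d => shift b ψ p.1 p.2) '' T ⊆ O := by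
      rintro _ ⟨p, hp, rfl⟩
      exact hO' p.2 hp.2 p.1 ((abs_le.2 hp.1).trans_lt hθ₁)
    obtain ⟨A₁, hA₁⟩ := exists_norm_fderiv_le_of_isCompact hO hΦ hCc hCO
    obtain ⟨A₂, hA₂⟩ := hCc.exists_bound_of_continuousOn (hΦ.continuousOn.mono hCO)
    obtain ⟨A₃, hA₃⟩ := hTc.exists_bound_of_continuousOn
      (f := fun p => (ψ p.2 * Complex.I) * (1 + (p.1 * χ p.2 : ℝ) * Complex.I))
      (Continuous.continuousOn (by fun_prop))
    obtain ⟨A₄, hA₄⟩ := hTc.exists_bound_of_continuousOn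
      (f := fun p => (χ p.2 * Complex.I)) (Continuous.continuousOn (by fun_prop))
    refine ⟨A₁ * ‖ofRealVec b‖ * A₃ + A₂ * A₄, fun θ hθ y hy => ?_⟩
    have hp : (θ, y) ∈ T := ⟨abs_le.1 hθ, hy⟩
    have b1 := hA₁ _ ⟨_, hp, rfl⟩
    have b2 := hA₂ _ ⟨_, hp, rfl⟩
    have b3 := hA₃ _ hp
    have b4 := hA₄ _ hp
    refine (norm_add_le _ _).trans (add_le_add ?_ ?_)
    · rw [mul_assoc, norm_mul]
      refine mul_le_mul ?_ b3 (norm_nonneg _)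
        (mul_nonneg ((norm_nonneg _).trans b1) (norm_nonneg _))
      exact (ContinuousLinearMap.le_opNorm _ _).trans
        (mul_le_mul_of_nonneg_right b1 (norm_nonneg _))
    · rw [norm_mul]
      exact mul_le_mul b2 b4 (norm_nonneg _) ((norm_nonneg _).trans b2)
  have hzero : ∀ θ, |θ| < θ₀ → HasDerivAt (fun θ => ∫ y, J θ y) 0 θ := by
    intro θ hθ
    obtain ⟨θ₁, hθ1, hθ1'⟩ := exists_between hθ
    obtain ⟨A, hA⟩ := hbound θ₁ hθ1'
    have hs : {t : ℝ | |t| < θ₁} ∈ 𝓝 θ := (isOpen_lt continuous_abs continuous_const).mem_nhds hθ1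
    obtain ⟨hi, hder⟩ := hasDerivAt_integral_of_dominated_loc_of_deriv_le (F := J) (F' := J')
      (bound := S.indicator fun _ => A) hs
      (by filter_upwards [hs] with t ht using (hJi t (ht.trans hθ1')).aestronglyMeasurable)
      (hJi θ hθ) (hJ'meas θ hθ)
      (ae_of_all _ fun y t ht => by
        by_cases hy : y ∈ S
        · rw [Set.indicator_of_mem hy]; exact hA t (le_of_lt ht) y hy
        · rw [Set.indicator_of_notMem hy, hJ'0 t y hy, norm_zero])
      ((integrable_indicator_iff hSm).2 (integrableOn_const hSc.measure_lt_top.ne))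
      (ae_of_all _ fun y t ht => hJd t (lt_trans ht hθ1') y)
    have hz := integral_bilinear_hasLineDerivAt_right_eq_neg_left_of_integrable
      (B := ContinuousLinearMap.mul ℝ ℂ) (f := fun _ => (1 : ℂ)) (f' := fun _ => 0) (g := h θ)
      (g' := J' θ) (v := b) (μ := volume) (by simp) (by simpa using hi)
      (by simpa using hhi θ hθ) (fun x _ => by
        simpa using (hasFDerivAt_const (1 : ℂ) x).hasLineDerivAt b)
      (fun x _ => hhd θ hθ x)
    simp only [ContinuousLinearMap.mul_apply', one_mul, zero_mul, integral_zero, neg_zero] at hz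
    rwa [hz] at hder
  have hconst := IsOpen.is_const_of_deriv_eq_zero (f := fun θ => ∫ y, J θ y) (s := Ioo (-θ₀) θ₀)
    isOpen_Ioo isPreconnected_Ioo
    (fun t ht => (hzero t (abs_lt.2 ht)).differentiableAt.differentiableWithinAt)
    (fun t ht => (hzero t (abs_lt.2 ht)).deriv) (x := 1) (y := 0)
    ⟨by linarith, hθ₀⟩ ⟨by linarith, by linarith⟩
  have e0 : ∀ y, J 0 y = 0 := fun y => by simp [hJ, shift_eq_ofRealVec]
  have e1 : ∀ y, J 1 y = Φ (shift b ψ 1 y) * (1 + χ y * Complex.I) - Φ (ofRealVec y) :=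
    fun y => by simp [hJ]
  simp only [e0, e1, integral_zero] at hconst
  refine ⟨?_, hconst⟩
  have := hJi 1 (by simpa using hθ₀)
  exact this.congr (ae_of_all _ e1)

end Shift

/-! ### The profile of the deformation -/

/-- A `C^1` minorant of the positive part on `(-∞, 1]`, zero on `(-∞, 0]` and equal to `1` at `1`,
with slope at most `1 + η`. -/
noncomputable def softPos (η v : ℝ) : ℝ := (1 + η) * max v 0 ^ 2 / (max v 0 + η)

/-- The derivative of `softPos η`. -/
noncomputable def softPosDeriv (η v : ℝ) : ℝ :=
  (1 + η) * (max v 0 ^ 2 + 2 * η * max v 0) / (max v 0 + η) ^ 2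

section SoftPos

variable {η : ℝ}

lemma softPos_of_nonpos {v : ℝ} (hv : v ≤ 0) : softPos η v = 0 := by
  simp [softPos, max_eq_right hv]

lemma softPosDeriv_of_nonpos {v : ℝ} (hv : v ≤ 0) : softPosDeriv η v = 0 := by
  simp [softPosDeriv, max_eq_right hv]

lemma softPos_nonneg (hη : 0 < η) (v : ℝ) : 0 ≤ softPos η v := by
  have := le_max_right v 0
  unfold softPos; positivity

lemma softPos_le (hη : 0 < η) {v : ℝ} (hv : v ≤ 1) : softPos η v ≤ max v 0 := by
  have h0 := le_max_right v 0
  have h1 : max v 0 ≤ 1 := max_le hv zero_le_one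
  rw [softPos, div_le_iff₀ (by positivity)]
  nlinarith [mul_nonneg (mul_nonneg hη.le h0) (sub_nonneg.2 h1)]

lemma one_sub_softPos_le (hη : 0 < η) {v : ℝ} (hv : v ≤ 1) :
    1 - softPos η v ≤ (1 + η) * (1 - v) := by
  rcases le_or_gt v 0 with h | h
  · rw [softPos_of_nonpos h]; nlinarith
  · rw [softPos, max_eq_left h.le, sub_le_iff_le_add, ← sub_le_iff_le_add',
      le_div_iff₀ (by positivity)]
    nlinarith [mul_nonneg hη.le (sub_nonneg.2 hv), mul_nonneg h.le (sub_nonneg.2 hv)]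

lemma softPosDeriv_nonneg (hη : 0 < η) (v : ℝ) : 0 ≤ softPosDeriv η v := by
  have := le_max_right v 0
  unfold softPosDeriv; positivity

lemma softPosDeriv_le (hη : 0 < η) (v : ℝ) : softPosDeriv η v ≤ 1 + η := by
  have := le_max_right v 0
  rw [softPosDeriv, div_le_iff₀ (by positivity)]
  nlinarith [mul_pos (by linarith : 0 < 1 + η) (pow_pos hη 2)]

lemma continuous_softPosDeriv (hη : 0 < η) : Continuous (softPosDeriv η) := by
  unfold softPosDeriv
  refine Continuous.div (by fun_prop) (by fun_prop) fun v => ?_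
  have := le_max_right v 0
  positivity

lemma hasDerivAt_softPos (hη : 0 < η) (v : ℝ) :
    HasDerivAt (softPos η) (softPosDeriv η v) v := by
  rcases lt_trichotomy v 0 with h | rfl | h
  · rw [softPosDeriv_of_nonpos h.le]
    refine (hasDerivAt_const v (0 : ℝ)).congr_of_eventuallyEq ?_
    filter_upwards [Iio_mem_nhds h] with u hu using softPos_of_nonpos (le_of_lt hu)
  · rw [softPosDeriv_of_nonpos le_rfl]
    have hO : softPos η =O[𝓝 0] fun u : ℝ => ‖u - 0‖ ^ 2 := by
      refine Asymptotics.IsBigO.of_bound ((1 + η) / η) (Eventually.of_forall fun u => ?_)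
      have h0 := le_max_right u 0
      have h1 : max u 0 ^ 2 ≤ u ^ 2 := by
        rcases le_total u 0 with h | h
        · rw [max_eq_right h]; nlinarith [sq_nonneg u]
        · rw [max_eq_left h]
      rw [Real.norm_of_nonneg (softPos_nonneg hη u), sub_zero, norm_pow, norm_norm,
        Real.norm_eq_abs, sq_abs, softPos, div_mul_eq_mul_div]
      gcongr
      linarith
    simpa using (hO.hasFDerivAt one_lt_two).hasDerivAt
  · have h1 : HasDerivAt (fun u : ℝ => (1 + η) * u ^ 2 / (u + η))
        (((1 + η) * (2 * v) * (v + η) - (1 + η) * v ^ 2 * 1) / (v + η) ^ 2) v := by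
      refine HasDerivAt.div ?_ ((hasDerivAt_id v).add_const η) (by positivity)
      simpa using (hasDerivAt_pow 2 v).const_mul (1 + η)
    refine (h1.congr_of_eventuallyEq ?_).congr_deriv ?_
    · filter_upwards [Ioi_mem_nhds h] with u hu
      rw [softPos, max_eq_left (le_of_lt hu)]
    · rw [softPosDeriv, max_eq_left h.le]
      ring

end SoftPos

/-- The slope `(1 + α) / (2 α) < 1` of the cones in which the deformed domain stays. -/
noncomputable def coneSlope (α : ℝ) : ℝ := (1 + α) / (2 * α)

lemma coneSlope_pos {α : ℝ} (hα : 1 < α) : 0 < coneSlope α := by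
  have : 0 < α := by linarith
  unfold coneSlope; positivity

lemma coneSlope_lt_one {α : ℝ} (hα : 1 < α) : coneSlope α < 1 := by
  rw [coneSlope, div_lt_one (by linarith)]; linarith

/-- The profile `ψ` of the deformation that serves the point `a + i b` of `Ω_α`: the points
`y + i θ ψ(y) b` with `y` near `a` and `|θ| < θ₀` stay in `Ω_α`, and the imaginary part
`(1 - ψ(y)) b` of `a + i b - (y + i ψ(y) b)` is at most `c |a - y|` with `c < 1`. -/
lemma exists_profile {d : ℕ} {α : ℝ} (hα : 1 < α) {a b : RSpace d} (hab : ‖a‖ + α * ‖b‖ < 1) :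
    ∃ (ρ θ₀ : ℝ) (ψ χ : RSpace d → ℝ), 1 < θ₀ ∧ Continuous ψ ∧ Continuous χ ∧
      (∀ y, HasLineDerivAt ℝ ψ (χ y) y b) ∧
      (∀ y ∉ Metric.closedBall a ρ, ψ y = 0 ∧ χ y = 0) ∧
      (∀ y ∈ Metric.closedBall a ρ, ∀ θ : ℝ, |θ| < θ₀ → ‖y‖ + α * ‖(θ * ψ y) • b‖ < 1) ∧
      (∀ y, ‖(1 - ψ y) • b‖ ≤ coneSlope α * ‖a - y‖) ∧ ∀ y, |χ y| ≤ 1 := by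
  obtain ⟨N, hN, hN'⟩ := exists_between (by linarith : α * ‖b‖ < 1 - ‖a‖)
  obtain ⟨R, hNR, hR⟩ := exists_between hN'
  have hα0 : 0 < α := by linarith
  have hb0 : 0 ≤ α * ‖b‖ := by positivity
  have hN0 : 0 < N := by linarith
  have hR0 : 0 < R := by linarith
  obtain ⟨ε, hε0, hε⟩ := exists_between (by linarith : 0 < 1 - ‖a‖ - R)
  set η : ℝ := (α - 1) / 2 with hη
  have hη0 : 0 < η := by rw [hη]; linarith
  have hc : (1 + η) / α = coneSlope α := by
    rw [hη, coneSlope]; field_simp; ring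
  -- `s` is a smooth substitute for `|y - a|`, smaller by at most `ε`; the profile is
  -- `softPos η (1 - s / R)`. The gap between `α |b|` and `1 - |a|` pays for `ε`, and the gap between
  -- `1` and `α` for the slope `1 + η`.
  set s : RSpace d → ℝ := fun y => √(‖y - a‖ ^ 2 + ε ^ 2) - ε with hs
  have hpos : ∀ y, 0 < ‖y - a‖ ^ 2 + ε ^ 2 := fun y => by positivity
  have hs0 : ∀ y, 0 ≤ s y := fun y => by
    have : ε ≤ √(‖y - a‖ ^ 2 + ε ^ 2) := Real.le_sqrt_of_sq_le (by nlinarith [sq_nonneg ‖y - a‖])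
    simp only [hs]; linarith
  have hs1 : ∀ y, ‖y - a‖ ≤ s y + ε := fun y => by
    have : ‖y - a‖ ≤ √(‖y - a‖ ^ 2 + ε ^ 2) := Real.le_sqrt_of_sq_le (by nlinarith)
    simp only [hs]; linarith
  have hs2 : ∀ y, s y ≤ ‖y - a‖ := fun y => by
    have : √(‖y - a‖ ^ 2 + ε ^ 2) ≤ ‖y - a‖ + ε := by
      rw [Real.sqrt_le_left (by positivity)]
      nlinarith [mul_nonneg (norm_nonneg (y - a)) hε0.le]
    simp only [hs]; linarith
  set s' : RSpace d → ℝ := fun y => inner ℝ (y - a) b / √(‖y - a‖ ^ 2 + ε ^ 2) with hs'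
  have hsd : ∀ y, HasLineDerivAt ℝ s (s' y) y b := by
    intro y
    have h1 : HasDerivAt (fun t : ℝ => y + t • b - a) b 0 := by
      simpa using (((hasDerivAt_id (0 : ℝ)).smul_const b).const_add y).sub_const a
    have h2 := ((h1.norm_sq.add_const (ε ^ 2)).sqrt (by simpa using (hpos y).ne')).sub_const ε
    refine HasDerivAt.congr_deriv h2 ?_
    simp only [hs', zero_smul, add_zero]
    ring
  have hs'b : ∀ y, |s' y| ≤ ‖b‖ := fun y => by
    rw [hs', abs_div, abs_of_pos (Real.sqrt_pos.2 (hpos y)), div_le_iff₀ (Real.sqrt_pos.2 (hpos y))]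
    have h1 : ‖y - a‖ ≤ √(‖y - a‖ ^ 2 + ε ^ 2) := Real.le_sqrt_of_sq_le (by nlinarith)
    refine (abs_real_inner_le_norm _ _).trans ?_
    rw [mul_comm]
    exact mul_le_mul_of_nonneg_left h1 (norm_nonneg _)
  have hsc : Continuous s := by fun_prop
  have hs'c : Continuous s' := by
    refine Continuous.div (by fun_prop) (by fun_prop) fun y => (Real.sqrt_pos.2 (hpos y)).ne'
  have hv1 : ∀ y, 1 - s y / R ≤ 1 := fun y => by
    have := div_nonneg (hs0 y) hR0.le
    linarith
  have hgc : Continuous (softPos η) :=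
    continuous_iff_continuousAt.2 fun v => (hasDerivAt_softPos hη0 v).continuousAt
  have hbR : ‖b‖ ≤ R / α := by
    rw [le_div_iff₀ hα0]; linarith
  refine ⟨R + ε, R / N, fun y => softPos η (1 - s y / R),
    fun y => softPosDeriv η (1 - s y / R) * (-(s' y / R)), (one_lt_div hN0).2 hNR,
    hgc.comp (by fun_prop), ((continuous_softPosDeriv hη0).comp (by fun_prop)).mul (by fun_prop),
    fun y => ?_, fun y hy => ?_, fun y hy θ hθ => ?_, fun y => ?_, fun y => ?_⟩
  · have h1 : HasDerivAt (fun t : ℝ => 1 - s (y + t • b) / R) (-(s' y / R)) 0 :=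
      (HasDerivAt.div_const (hsd y) R).const_sub 1
    refine HasDerivAt.comp (0 : ℝ) (h₂ := softPos η) ?_ h1
    simpa using hasDerivAt_softPos hη0 (1 - s y / R)
  · have h1 : R + ε < ‖y - a‖ := by
      rw [Metric.mem_closedBall, not_le, dist_eq_norm] at hy; exact hy
    have h2 : 1 - s y / R ≤ 0 := by
      rw [sub_nonpos, le_div_iff₀ hR0]
      linarith [hs1 y]
    simp [softPos_of_nonpos h2, softPosDeriv_of_nonpos h2]
  · have h1 : ‖y - a‖ ≤ R + ε := mem_closedBall_iff_norm.1 hy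
    have h2 : ‖y‖ ≤ ‖a‖ + ‖y - a‖ := norm_le_norm_add_norm_sub' y a
    have h3 := softPos_le hη0 (hv1 y)
    have h4 := softPos_nonneg hη0 (1 - s y / R)
    have h5 : α * ‖(θ * softPos η (1 - s y / R)) • b‖ ≤ R * softPos η (1 - s y / R) := by
      rw [norm_smul, norm_mul, Real.norm_eq_abs, Real.norm_of_nonneg h4]
      have h6 : α * ‖b‖ * |θ| ≤ R := by
        calc α * ‖b‖ * |θ| ≤ N * (R / N) :=
              mul_le_mul hN.le hθ.le (abs_nonneg _) hN0.le
          _ = R := by field_simp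
      nlinarith [mul_le_mul_of_nonneg_right h6 h4]
    have h7 : R * softPos η (1 - s y / R) ≤ max (R - s y) 0 := by
      refine (mul_le_mul_of_nonneg_left h3 hR0.le).trans (le_of_eq ?_)
      rw [mul_max_of_nonneg _ _ hR0.le, mul_zero, mul_sub, mul_one, mul_div_cancel₀ _ hR0.ne']
    rcases max_cases (R - s y) 0 with ⟨h8, _⟩ | ⟨h8, _⟩
    · rw [h8] at h7; linarith [hs1 y]
    · rw [h8] at h7; linarith [hs1 y]
  · have h1 : 0 ≤ 1 - softPos η (1 - s y / R) := by
      have := softPos_le hη0 (hv1 y)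
      have h2 := max_le (hv1 y) zero_le_one
      linarith
    rw [norm_smul, Real.norm_of_nonneg h1, ← hc]
    calc (1 - softPos η (1 - s y / R)) * ‖b‖ ≤ (1 + η) * (s y / R) * (R / α) := by
          refine mul_le_mul ?_ hbR (norm_nonneg _) ?_
          · simpa using one_sub_softPos_le hη0 (hv1 y)
          · have := div_nonneg (hs0 y) hR0.le
            positivity
      _ = (1 + η) / α * s y := by field_simp
      _ ≤ (1 + η) / α * ‖a - y‖ := by
          rw [norm_sub_rev]
          exact mul_le_mul_of_nonneg_left (hs2 y) (by positivity)
  · rw [abs_mul, abs_neg, abs_div, abs_of_pos hR0, abs_of_nonneg (softPosDeriv_nonneg hη0 _)]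
    calc softPosDeriv η (1 - s y / R) * (|s' y| / R) ≤ (1 + η) * (R / α / R) := by
          refine mul_le_mul (softPosDeriv_le hη0 _) ?_ (by positivity) (by positivity)
          gcongr
          exact (hs'b y).trans hbR
      _ = coneSlope α := by rw [← hc]; field_simp
      _ ≤ 1 := (coneSlope_lt_one hα).le

/-! ### Estimates of convolutions on the deformed domain -/

/-- Every point `z` of `Ω_α ∪ ℝ^d` has a deformation `γ` of `ℝ^d` inside `Ω_α ∪ ℝ^d` such that
`z - γ(y)` stays in a cone `|im w| ≤ c |re w|` with `c < 1`, and along which functions that are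
holomorphic in `Ω_α` have the same integral as on `ℝ^d`. -/
lemma exists_deformation {d : ℕ} {α : ℝ} (hα : 1 < α) {z : CSpace d}
    (hz : z ∈ Omega d α ∪ range ofRealVec) :
    ∃ (γ : RSpace d → CSpace d) (jac : RSpace d → ℂ),
      (∀ y, γ y ∈ Omega d α ∪ range ofRealVec) ∧ (∀ y, rePart (γ y) = y) ∧
      (∀ y, ‖imPart (z - γ y)‖ ≤ coneSlope α * ‖rePart z - y‖) ∧ (∀ y, ‖jac y‖ ≤ 2) ∧
      ∀ Φ : CSpace d → ℂ, DifferentiableOn ℂ Φ (Omega d α) →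
        Integrable (fun y => Φ (ofRealVec y)) →
        Integrable (fun y => Φ (γ y) * jac y) ∧ ∫ y, Φ (γ y) * jac y = ∫ y, Φ (ofRealVec y) := by
  rcases hz with hz | ⟨x, rfl⟩
  · obtain ⟨ρ, θ₀, ψ, χ, hθ₀, hψ, hχ, hd, h0, hO, hcone, hχ1⟩ := exists_profile hα hz
    refine ⟨shift (imPart z) ψ 1, fun y => 1 + χ y * Complex.I, fun y => ?_,
      fun y => rePart_shift _ _, fun y => ?_, fun y => ?_, fun Φ hΦ hi => ?_⟩
    · by_cases hy : y ∈ Metric.closedBall (rePart z) ρ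
      · refine Or.inl ?_
        change ‖rePart _‖ + α * ‖imPart _‖ < 1
        rw [rePart_shift, imPart_shift]
        exact hO y hy 1 (by simpa using hθ₀)
      · exact Or.inr ⟨y, (shift_eq_ofRealVec (by simp [(h0 y hy).1])).symm⟩
    · have e : imPart (z - shift (imPart z) ψ 1 y) = (1 - ψ y) • imPart z := by
        rw [imPart_sub, imPart_shift, one_mul, sub_smul, one_smul]
      rw [e]; exact hcone y
    · refine (norm_add_le _ _).trans ?_
      have := hχ1 y
      simp only [norm_one, norm_mul, Complex.norm_real, Complex.norm_I, mul_one, Real.norm_eq_abs]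
      linarith
    · obtain ⟨h1, h2⟩ := integral_shift_sub (isOpen_Omega d α) hΦ hθ₀ hψ hχ hd h0
        (fun y hy θ hθ => by
          change ‖rePart _‖ + α * ‖imPart _‖ < 1
          rw [rePart_shift, imPart_shift]
          exact hO y hy θ hθ)
      have h3 : Integrable fun y => Φ (shift (imPart z) ψ 1 y) * (1 + χ y * Complex.I) :=
        (h1.add hi).congr (ae_of_all _ fun y => by simp)
      rw [integral_sub h3 hi, sub_eq_zero] at h2
      exact ⟨h3, h2⟩
  · refine ⟨ofRealVec, fun _ => 1, fun y => Or.inr ⟨y, rfl⟩, rePart_ofRealVec, fun y => ?_,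
      by simp, fun Φ _ hi => by simpa using hi⟩
    rw [imPart_sub, imPart_ofRealVec, imPart_ofRealVec, sub_zero, norm_zero]
    exact mul_nonneg (coneSlope_pos hα).le (norm_nonneg _)

/-- The parameter `τ` of the kernels of Gaussian type that act on `X_α`. -/
noncomputable def kernelTau (α : ℝ) : ℝ := (1 - coneSlope α ^ 2) / (2 * (1 + coneSlope α ^ 2))

/-- The rate at which the kernels of Gaussian type with parameter `kernelTau α` decay in the cone
of slope `coneSlope α`. -/
noncomputable def coneRate (α : ℝ) : ℝ := (1 - coneSlope α ^ 2) / 2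

section ConeConstants

variable {α : ℝ}

lemma coneSlope_sq_lt_one (hα : 1 < α) : coneSlope α ^ 2 < 1 := by
  have h1 := coneSlope_pos hα
  have h2 := coneSlope_lt_one hα
  nlinarith

lemma coneRate_pos (hα : 1 < α) : 0 < coneRate α := by
  have := coneSlope_sq_lt_one hα
  unfold coneRate; linarith

lemma kernelTau_pos (hα : 1 < α) : 0 < kernelTau α := by
  have : 0 < 1 - coneSlope α ^ 2 := sub_pos.2 (coneSlope_sq_lt_one hα)
  unfold kernelTau; positivity

lemma kernelTau_lt_half (hα : 1 < α) : kernelTau α < 1 / 2 := by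
  have := coneSlope_pos hα
  rw [kernelTau, div_lt_div_iff₀ (by positivity) two_pos]
  nlinarith [pow_pos this 2]

lemma coneRate_eq (α : ℝ) :
    (1 - kernelTau α) - (1 + kernelTau α) * coneSlope α ^ 2 = coneRate α := by
  unfold kernelTau coneRate
  field_simp
  ring

end ConeConstants

section Glue

variable {d : ℕ} {α : ℝ} {hα : 0 < α}

open Classical in
/-- The function on `Ω_α ∪ ℝ^d` that an element `f` of `X_α` defines: the extension `f_e` on `Ω_α`
and `f` on `ℝ^d`. Its values elsewhere play no role. -/
noncomputable def XSpace.glue (f : XSpace d α hα) (w : CSpace d) : ℂ :=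
  if w ∈ Omega d α then f.ext w else f (rePart w)

lemma XSpace.glue_of_mem (f : XSpace d α hα) {w : CSpace d} (hw : w ∈ Omega d α) :
    f.glue w = f.ext w := if_pos hw

lemma XSpace.glue_ofRealVec (f : XSpace d α hα) (y : RSpace d) : f.glue (ofRealVec y) = f y := by
  by_cases h : ofRealVec y ∈ Omega d α
  · rw [f.glue_of_mem h]
    refine f.holExt.eq_on_ball y ?_
    simpa [Omega, rePart_ofRealVec, imPart_ofRealVec] using h
  · rw [XSpace.glue, if_neg h, rePart_ofRealVec]

lemma XSpace.norm_glue_le (f : XSpace d α hα) (w : CSpace d) : ‖f.glue w‖ ≤ ‖f‖ := by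
  by_cases h : w ∈ Omega d α
  · rw [f.glue_of_mem h]; exact f.norm_ext_le_norm (subset_closure h)
  · rw [XSpace.glue, if_neg h]; exact f.norm_coe_le_norm _

lemma XSpace.differentiableOn_glue (f : XSpace d α hα) :
    DifferentiableOn ℂ f.glue (Omega d α) :=
  f.holExt.differentiableOn.congr fun _ hw => f.glue_of_mem hw

/-- The basic estimate: the convolution of `f` with a kernel of Gaussian type is close to
`c₀ ∫ K` at a point `z` of `Ω_α ∪ ℝ^d` if `f` is close to `c₀` near `z`. -/
lemma XSpace.norm_conv_sub_le (hα1 : 1 < α) (f : XSpace d α hα) {M m : ℝ} {K : CSpace d → ℂ}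
    (hK : GaussKernel (kernelTau α) M m K) {z : CSpace d} (hz : z ∈ Omega d α ∪ range ofRealVec)
    {c₀ : ℂ} {A D : ℝ} (hA : 0 ≤ A) (hD : 0 ≤ D)
    (h : ∀ w ∈ Omega d α ∪ range ofRealVec, ‖f.glue w - c₀‖ ≤ A + D * ‖z - w‖ ^ 2) :
    ‖conv K f z - c₀ * conv K (fun _ => 1) z‖ ≤
      2 * M * (A + 4 * D / (m * coneRate α)) *
        (2 * Real.pi / (m * coneRate α)) ^ ((d : ℝ) / 2) := by
  obtain ⟨γ, jac, hγ, hre, him, hjac, hint⟩ := exists_deformation hα1 hz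
  have hτ0 := (kernelTau_pos hα1).le
  have hτ1 : kernelTau α < 1 := (kernelTau_lt_half hα1).trans (by norm_num)
  have hκ := coneRate_pos hα1
  have hm := hK.pos
  have hM := hK.nonneg
  have hKd : Differentiable ℂ fun w => K (z - w) :=
    (hK.contDiff.differentiable one_ne_zero).comp (differentiable_const z |>.sub differentiable_id)
  set b : ℝ := m * coneRate α with hb
  have hb0 : 0 < b := by positivity
  -- Both convolutions are combined before the domain is deformed.
  have hi1 := hK.integrable_mul hτ0 hτ1 f.2.1.1.continuous f.norm_coe_le_norm z
  have hi2 := hK.integrable_mul (f := fun _ => 1) (B := 1) hτ0 hτ1 continuous_const (by simp) z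
  have e : conv K f z - c₀ * conv K (fun _ => 1) z =
      ∫ y, (fun w => K (z - w) * (f.glue w - c₀)) (ofRealVec y) := by
    rw [conv, conv, ← integral_const_mul, ← integral_sub hi1 (hi2.const_mul c₀)]
    refine integral_congr_ae (ae_of_all _ fun y => ?_)
    simp only [f.glue_ofRealVec]
    ring
  have hi3 : Integrable fun y => (fun w => K (z - w) * (f.glue w - c₀)) (ofRealVec y) := by
    refine (hi1.sub (hi2.const_mul c₀)).congr (ae_of_all _ fun y => ?_)
    simp only [f.glue_ofRealVec, Pi.sub_apply]
    ring
  rw [e, ← (hint (fun w => K (z - w) * (f.glue w - c₀))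
    (hKd.differentiableOn.mul (f.differentiableOn_glue.sub_const c₀)) hi3).2]
  have hg : Integrable fun y : RSpace d => 2 * M * (A + 4 * D / b) *
      Real.exp (-(b / 2) * ‖rePart z - y‖ ^ 2) :=
    (integrable_gaussian (half_pos hb0) _).const_mul _
  refine (norm_integral_le_of_norm_le hg (ae_of_all _ fun y => ?_)).trans (le_of_eq ?_)
  · set u := ‖rePart z - y‖ with hu
    have hu0 : 0 ≤ u := norm_nonneg _
    have hre' : rePart (z - γ y) = rePart z - y := by rw [rePart_sub, hre]
    have hq : ‖imPart (z - γ y)‖ ^ 2 ≤ coneSlope α ^ 2 * u ^ 2 := by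
      rw [← mul_pow]; exact pow_le_pow_left₀ (norm_nonneg _) (him y) 2
    have h1 : ‖K (z - γ y)‖ ≤ M * Real.exp (-b * u ^ 2) := by
      refine (hK.bound _).trans (mul_le_mul_of_nonneg_left (Real.exp_le_exp.2 ?_) hM)
      rw [hre', ← hu, hb, ← coneRate_eq]
      have := mul_le_mul_of_nonneg_left hq
        (mul_nonneg hm.le (by linarith : 0 ≤ 1 + kernelTau α))
      linarith
    have h2 : ‖f.glue (γ y) - c₀‖ ≤ A + 2 * D * u ^ 2 := by
      refine (h _ (hγ y)).trans ?_
      have h3 : ‖z - γ y‖ ^ 2 ≤ 2 * u ^ 2 := by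
        rw [norm_sq_eq_rePart_imPart, hre', ← hu]
        nlinarith [coneSlope_sq_lt_one hα1, sq_nonneg u]
      nlinarith [mul_le_mul_of_nonneg_left h3 hD]
    -- Half of the Gaussian absorbs the quadratic factor, by `x * exp (-x) ≤ 1`.
    have h4 : (A + 2 * D * u ^ 2) * Real.exp (-b * u ^ 2) ≤
        (A + 4 * D / b) * Real.exp (-(b / 2) * u ^ 2) := by
      have h5 : Real.exp (-b * u ^ 2) =
          Real.exp (-(b / 2) * u ^ 2) * Real.exp (-(b / 2) * u ^ 2) := by
        rw [← Real.exp_add]; congr 1; ring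
      have h6 : Real.exp (-(b / 2) * u ^ 2) ≤ 1 :=
        Real.exp_le_one_iff.2 (by have := mul_nonneg hb0.le (sq_nonneg u); linarith)
      have h7 : (b / 2 * u ^ 2) * Real.exp (-(b / 2) * u ^ 2) ≤ 1 := by
        rw [show -(b / 2) * u ^ 2 = -(b / 2 * u ^ 2) by ring, Real.exp_neg, ← div_eq_mul_inv,
          div_le_one (Real.exp_pos _)]
        linarith [Real.add_one_le_exp (b / 2 * u ^ 2)]
      have h8 : 2 * D * u ^ 2 = 4 * D / b * (b / 2 * u ^ 2) := by field_simp; ring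
      rw [h5, ← mul_assoc]
      refine mul_le_mul_of_nonneg_right ?_ (Real.exp_pos _).le
      rw [add_mul, h8, mul_assoc]
      have h9 : 0 ≤ 4 * D / b := by positivity
      have := mul_le_mul_of_nonneg_left h7 h9
      have := mul_le_mul_of_nonneg_left h6 hA
      linarith
    rw [norm_mul, norm_mul]
    calc ‖K (z - γ y)‖ * ‖f.glue (γ y) - c₀‖ * ‖jac y‖
        ≤ (M * Real.exp (-b * u ^ 2)) * (A + 2 * D * u ^ 2) * 2 := by
          gcongr
          exact hjac y
      _ = 2 * M * ((A + 2 * D * u ^ 2) * Real.exp (-b * u ^ 2)) := by ring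
      _ ≤ 2 * M * ((A + 4 * D / b) * Real.exp (-(b / 2) * u ^ 2)) := by gcongr
      _ = _ := by ring
  · rw [integral_const_mul, integral_gaussian (half_pos hb0)]
    congr 2
    field_simp

lemma XSpace.norm_conv_le (hα1 : 1 < α) (f : XSpace d α hα) {M m : ℝ} {K : CSpace d → ℂ}
    (hK : GaussKernel (kernelTau α) M m K) {z : CSpace d}
    (hz : z ∈ Omega d α ∪ range ofRealVec) :
    ‖conv K f z‖ ≤ 2 * M * (2 * Real.pi / (m * coneRate α)) ^ ((d : ℝ) / 2) * ‖f‖ := by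
  have := f.norm_conv_sub_le hα1 hK hz (c₀ := 0) (norm_nonneg f) le_rfl
    fun w _ => by simpa using f.norm_glue_le w
  simp only [zero_mul, sub_zero, mul_zero, zero_div, add_zero] at this
  linarith

end Glue

/-! ### Convolution operators on `X_α` and `X_α^1` -/

lemma contDiff_one_of_continuous_partialDeriv {d : ℕ} {f : RSpace d → ℂ}
    (hf : Differentiable ℝ f) (hc : ∀ j, Continuous (partialDeriv j f)) : ContDiff ℝ 1 f := by
  rw [contDiff_one_iff_fderiv]
  refine ⟨hf, ?_⟩
  rw [funext (fderiv_eq_gradForm f)]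
  exact continuous_gradForm.comp (continuous_pi hc)

section ConvOperators

variable {d : ℕ} {α : ℝ} {hα : 0 < α} {M m : ℝ} {K : CSpace d → ℂ}

lemma GaussKernel.integrable_X (hα1 : 1 < α) (hK : GaussKernel (kernelTau α) M m K)
    (f : XSpace d α hα) (w : CSpace d) : Integrable fun y => K (w - ofRealVec y) * f y :=
  hK.integrable_mul (kernelTau_pos hα1).le ((kernelTau_lt_half hα1).trans (by norm_num))
    f.2.1.1.continuous f.norm_coe_le_norm w

lemma GaussKernel.hasFDerivAt_conv_X (hα1 : 1 < α) (hK : GaussKernel (kernelTau α) M m K)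
    (f : XSpace d α hα) (w : CSpace d) :
    HasFDerivAt (𝕜 := ℂ) (conv K f) (∫ y, f y • fderiv ℂ K (w - ofRealVec y)) w ∧
      Integrable (fun y => f y • fderiv ℂ K (w - ofRealVec y)) :=
  hK.hasFDerivAt_conv (kernelTau_pos hα1).le ((kernelTau_lt_half hα1).trans (by norm_num))
    f.2.1.1.continuous f.norm_coe_le_norm w

lemma GaussKernel.differentiable_conv_X (hα1 : 1 < α) (hK : GaussKernel (kernelTau α) M m K)
    (f : XSpace d α hα) : Differentiable ℂ (conv K f) := fun w =>
  (hK.hasFDerivAt_conv_X hα1 f w).1.differentiableAt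

lemma GaussKernel.isHolExt_conv (hα1 : 1 < α) (hK : GaussKernel (kernelTau α) M m K)
    (f : XSpace d α hα) : IsHolExt α (fun x => conv K f (ofRealVec x)) (conv K f) :=
  ⟨(hK.differentiable_conv_X hα1 f).continuous.continuousOn,
    (hK.differentiable_conv_X hα1 f).differentiableOn, fun _ _ => rfl⟩

lemma GaussKernel.memX_conv (hα1 : 1 < α) (hK : GaussKernel (kernelTau α) M m K)
    (f : XSpace d α hα) : MemX α fun x => conv K f (ofRealVec x) :=
  ⟨hK.isBUC_conv (kernelTau_pos hα1).le ((kernelTau_lt_half hα1).trans (by norm_num)) f.2.1,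
    _, hK.isHolExt_conv hα1 f⟩

/-- The bound for the norm of the convolution with a kernel of Gaussian type. -/
noncomputable def convBound (d : ℕ) (α M m : ℝ) : ℝ :=
  4 * M * (2 * Real.pi / (m * coneRate α)) ^ ((d : ℝ) / 2)

lemma GaussKernel.convBound_nonneg (hα1 : 1 < α) (hK : GaussKernel (kernelTau α) M m K) :
    0 ≤ convBound d α M m := by
  have := hK.nonneg
  have := hK.pos
  have := coneRate_pos hα1
  have := Real.pi_pos
  unfold convBound
  positivity

lemma XSpace.norm_le_of_forall (f : XSpace d α hα) {F : CSpace d → ℂ}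
    (hF : IsHolExt α (f : RSpace d → ℂ) F) {A : ℝ} (hA : 0 ≤ A)
    (hreal : ∀ x, ‖f x‖ ≤ A) (hext : ∀ z ∈ Omega d α, ‖F z‖ ≤ A) : ‖f‖ ≤ A + A := by
  rw [XSpace.norm_def]
  refine add_le_add (supNorm_le hA hreal) (supNorm_le hA fun z => ?_)
  rw [f.ext_eq hF (subset_closure z.2)]
  exact hext z z.2

/-- The convolution with a kernel of Gaussian type, as an operator on `X_α`. -/
noncomputable def GaussKernel.convX (hα1 : 1 < α) (hK : GaussKernel (kernelTau α) M m K) :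
    XSpace d α hα →L[ℂ] XSpace d α hα :=
  LinearMap.mkContinuous
    { toFun := fun f => ⟨fun x => conv K f (ofRealVec x), hK.memX_conv hα1 f⟩
      map_add' := fun f g => by
        refine Subtype.ext (funext fun x => ?_)
        change conv K (f + g : XSpace d α hα) (ofRealVec x) =
          conv K f (ofRealVec x) + conv K g (ofRealVec x)
        rw [conv, conv, conv, ← integral_add (hK.integrable_X hα1 f _) (hK.integrable_X hα1 g _)]
        simp only [XSpace.coe_add, Pi.add_apply, mul_add]
      map_smul' := fun c f => by
        refine Subtype.ext (funext fun x => ?_)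
        change conv K (c • f : XSpace d α hα) (ofRealVec x) = c • conv K f (ofRealVec x)
        rw [conv, conv, ← integral_smul]
        simp only [XSpace.coe_smul, Pi.smul_apply, smul_eq_mul, mul_left_comm] }
    (convBound d α M m) (fun f => by
      have hA : 0 ≤ convBound d α M m / 2 * ‖f‖ :=
        mul_nonneg (div_nonneg (hK.convBound_nonneg hα1) zero_le_two) (norm_nonneg f)
      have hle : ∀ z ∈ Omega d α ∪ range ofRealVec,
          ‖conv K f z‖ ≤ convBound d α M m / 2 * ‖f‖ := fun z hz =>
        (f.norm_conv_le hα1 hK hz).trans (le_of_eq (by rw [convBound]; ring))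
      refine (XSpace.norm_le_of_forall _ (hK.isHolExt_conv hα1 f) hA
        (fun x => hle _ (Or.inr ⟨x, rfl⟩)) fun z hz => hle z (Or.inl hz)).trans (le_of_eq ?_)
      ring)

lemma GaussKernel.norm_convX_le (hα1 : 1 < α) (hK : GaussKernel (kernelTau α) M m K)
    (f : XSpace d α hα) : ‖hK.convX hα1 f‖ ≤ convBound d α M m * ‖f‖ :=
  (ContinuousLinearMap.le_opNorm _ _).trans (mul_le_mul_of_nonneg_right
    (LinearMap.mkContinuous_norm_le _ (hK.convBound_nonneg hα1) _) (norm_nonneg f))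

/-- The derivatives of a convolution fall on the kernel. -/
lemma GaussKernel.hasFDerivAt_conv_real (hα1 : 1 < α) (hK : GaussKernel (kernelTau α) M m K)
    (f : XSpace d α hα) (x : RSpace d) :
    HasFDerivAt (fun x => conv K f (ofRealVec x))
      (((∫ y, f y • fderiv ℂ K (ofRealVec x - ofRealVec y)).restrictScalars ℝ).comp
        (ofRealVecL d)) x :=
  HasFDerivAt.comp x (((hK.hasFDerivAt_conv_X hα1 f (ofRealVec x)).1).restrictScalars ℝ)
    (ofRealVecL d).hasFDerivAt

lemma ofRealVec_single {d : ℕ} (j : Fin d) :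
    ofRealVec (EuclideanSpace.single j (1 : ℝ)) = EuclideanSpace.single j (1 : ℂ) := by
  ext i
  by_cases h : i = j <;> simp [ofRealVec, h]

lemma GaussKernel.partialDeriv_conv_kernel (hα1 : 1 < α) (hK : GaussKernel (kernelTau α) M m K)
    (f : XSpace d α hα) (j : Fin d) :
    partialDeriv j (fun x => conv K f (ofRealVec x)) = fun x =>
      conv (fun w => fderiv ℂ K w (EuclideanSpace.single j 1)) f (ofRealVec x) := by
  funext x
  rw [partialDeriv, (hK.hasFDerivAt_conv_real hα1 f x).fderiv, ContinuousLinearMap.comp_apply,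
    ContinuousLinearMap.coe_restrictScalars', ofRealVecL_apply, ofRealVec_single,
    ContinuousLinearMap.integral_apply (hK.hasFDerivAt_conv_X hα1 f (ofRealVec x)).2, conv]
  refine integral_congr_ae (ae_of_all _ fun y => ?_)
  simp [mul_comm]

/-- For `f` in `X_α^1`, the derivatives of a convolution fall on `f`. -/
lemma GaussKernel.partialDeriv_conv_fun (hα1 : 1 < α) (hK : GaussKernel (kernelTau α) M m K)
    (f : XOneSpace d α hα) (j : Fin d) :
    partialDeriv j (fun x => conv K f (ofRealVec x)) = fun x =>
      conv K (f.partial j) (ofRealVec x) := by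
  have hb : ∀ u, ‖fderiv ℝ (f : RSpace d → ℂ) u‖ ≤ ∑ j, ‖f.partial j‖ := fun u => by
    rw [fderiv_eq_gradForm]
    exact (norm_gradForm_le _).trans
      (Finset.sum_le_sum fun j _ => XSpace.norm_coe_le_norm (f.partial j) u)
  have hKi : Integrable fun u => K (ofRealVec u) := hK.integrable_real (kernelTau_pos hα1).le
    ((kernelTau_lt_half hα1).trans (by norm_num))
  have hKc : Continuous fun u : RSpace d => K (ofRealVec u) :=
    hK.contDiff.continuous.comp continuous_ofRealVec
  have hfi : ∀ x, Integrable fun u => K (ofRealVec u) * f (x - u) := fun x => by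
    have := (hK.integrable_X hα1 f.toX (ofRealVec x)).comp_sub_left x
    simp only [← ofRealVec_sub, sub_sub_cancel] at this
    exact this
  have hmeas : ∀ x, AEStronglyMeasurable
      (fun u => K (ofRealVec u) • fderiv ℝ (f : RSpace d → ℂ) (x - u)) volume := fun x =>
    (hKc.smul ((f.2.2.1.continuous_fderiv one_ne_zero).comp
      (continuous_const.sub continuous_id))).aestronglyMeasurable
  have hle : ∀ u x, ‖K (ofRealVec u) • fderiv ℝ (f : RSpace d → ℂ) (x - u)‖ ≤
      ‖K (ofRealVec u)‖ * ∑ j, ‖f.partial j‖ := fun u x => by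
    rw [norm_smul]; exact mul_le_mul_of_nonneg_left (hb _) (norm_nonneg _)
  have hbi : Integrable fun u => ‖K (ofRealVec u)‖ * ∑ j, ‖f.partial j‖ :=
    hKi.norm.mul_const _
  funext x
  have hder : HasFDerivAt (fun x => ∫ u, K (ofRealVec u) * f (x - u))
      (∫ u, K (ofRealVec u) • fderiv ℝ (f : RSpace d → ℂ) (x - u)) x := by
    refine hasFDerivAt_integral_of_dominated_of_fderiv_le
      (F := fun x u => K (ofRealVec u) * f (x - u))
      (F' := fun x u => K (ofRealVec u) • fderiv ℝ (f : RSpace d → ℂ) (x - u))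
      univ_mem (Eventually.of_forall fun x => (hfi x).aestronglyMeasurable) (hfi x) (hmeas x)
      (ae_of_all _ fun u x _ => hle u x) hbi (ae_of_all _ fun u x _ => ?_)
    exact ((hasFDerivAt_comp_sub u).2
      (f.2.2.1.differentiable one_ne_zero _).hasFDerivAt).const_mul _
  have e : (fun x => conv K f (ofRealVec x)) = fun x => ∫ u, K (ofRealVec u) * f (x - u) :=
    funext fun x => conv_ofRealVec K f x
  rw [partialDeriv, e, hder.fderiv, conv_ofRealVec,
    ContinuousLinearMap.integral_apply (hbi.mono' (hmeas x) (ae_of_all _ fun u => hle u x))]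
  rfl

lemma GaussKernel.memXOne_conv (hα1 : 1 < α) (hK : GaussKernel (kernelTau α) M m K)
    (f : XOneSpace d α hα) : MemXOne α fun x => conv K f (ofRealVec x) := by
  have hp : ∀ j, MemX α (partialDeriv j fun x => conv K f (ofRealVec x)) := fun j => by
    rw [hK.partialDeriv_conv_fun hα1]; exact hK.memX_conv hα1 (f.partial j)
  exact ⟨hK.memX_conv hα1 f.toX, contDiff_one_of_continuous_partialDeriv
    (fun x => (hK.hasFDerivAt_conv_real hα1 f.toX x).differentiableAt)
    (fun j => (hp j).1.1.continuous), hp⟩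

/-- The convolution with a kernel of Gaussian type, as an operator on `X_α^1`. -/
noncomputable def GaussKernel.convXOne (hα1 : 1 < α) (hK : GaussKernel (kernelTau α) M m K) :
    XOneSpace d α hα →L[ℂ] XOneSpace d α hα :=
  LinearMap.mkContinuous
    { toFun := fun f => ⟨fun x => conv K f (ofRealVec x), hK.memXOne_conv hα1 f⟩
      map_add' := fun f g => XOneSpace.toX_injective ((hK.convX hα1).map_add f.toX g.toX)
      map_smul' := fun c f => XOneSpace.toX_injective ((hK.convX hα1).map_smul c f.toX) }
    (convBound d α M m) (fun f => by
      rw [XOneSpace.norm_def, XOneSpace.norm_def, mul_add, Finset.mul_sum]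
      refine add_le_add (hK.norm_convX_le hα1 f.toX) (Finset.sum_le_sum fun j _ => ?_)
      refine le_of_eq_of_le ?_ (hK.norm_convX_le hα1 (f.partial j))
      exact congrArg norm (Subtype.ext (hK.partialDeriv_conv_fun hα1 f j)))

lemma GaussKernel.convXOne_apply (hα1 : 1 < α) (hK : GaussKernel (kernelTau α) M m K)
    (f : XOneSpace d α hα) (x : RSpace d) : hK.convXOne hα1 f x = conv K f (ofRealVec x) := rfl

lemma GaussKernel.toX_convXOne (hα1 : 1 < α) (hK : GaussKernel (kernelTau α) M m K)
    (f : XOneSpace d α hα) : (hK.convXOne hα1 f).toX = hK.convX hα1 f.toX := rfl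

lemma GaussKernel.partial_convXOne (hα1 : 1 < α) (hK : GaussKernel (kernelTau α) M m K)
    (f : XOneSpace d α hα) (j : Fin d) :
    (hK.convXOne hα1 f).partial j = hK.convX hα1 (f.partial j) :=
  Subtype.ext (hK.partialDeriv_conv_fun hα1 f j)

lemma GaussKernel.norm_convXOne_le (hα1 : 1 < α) (hK : GaussKernel (kernelTau α) M m K) :
    ‖hK.convXOne (hα := hα) hα1‖ ≤ convBound d α M m :=
  LinearMap.mkContinuous_norm_le _ (hK.convBound_nonneg hα1) _

/-- The convolution with a kernel of Gaussian type maps `X_α` to `X_α^1` if the derivatives of the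
kernel are of Gaussian type. -/
lemma GaussKernel.memXOne_conv_of_kernel (hα1 : 1 < α) (hK : GaussKernel (kernelTau α) M m K)
    {M' : ℝ} (hK' : ∀ j, GaussKernel (kernelTau α) M' m
      fun w => fderiv ℂ K w (EuclideanSpace.single j 1))
    (f : XSpace d α hα) : MemXOne α fun x => conv K f (ofRealVec x) := by
  have hp : ∀ j, MemX α (partialDeriv j fun x => conv K f (ofRealVec x)) := fun j => by
    rw [hK.partialDeriv_conv_kernel hα1]; exact (hK' j).memX_conv hα1 f
  exact ⟨hK.memX_conv hα1 f, contDiff_one_of_continuous_partialDeriv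
    (fun x => (hK.hasFDerivAt_conv_real hα1 f x).differentiableAt)
    (fun j => (hp j).1.1.continuous), hp⟩

end ConvOperators

/-! ### The heat kernel with complex time and space variables -/

/-- The quadratic form `w₁² + ⋯ + w_d²` on `ℂ^d`. -/
noncomputable def csq {d : ℕ} (w : CSpace d) : ℂ := ∑ j, w j ^ 2

/-- The heat kernel `(4πz)^{-d/2} exp(-(w₁² + ⋯ + w_d²)/(4z))` at the complex time `z`, with the
principal branch of the power. -/
noncomputable def heatC {d : ℕ} (z : ℂ) (w : CSpace d) : ℂ :=
  (4 * Real.pi * z) ^ (((-(d : ℝ) / 2 : ℝ)) : ℂ) * Complex.exp (-csq w / (4 * z))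

section HeatC

variable {d : ℕ}

lemma csq_re (w : CSpace d) : (csq w).re = ‖rePart w‖ ^ 2 - ‖imPart w‖ ^ 2 := by
  rw [csq, Complex.re_sum, EuclideanSpace.real_norm_sq_eq, EuclideanSpace.real_norm_sq_eq,
    ← Finset.sum_sub_distrib]
  refine Finset.sum_congr rfl fun j _ => ?_
  simp [rePart, imPart, sq]

lemma csq_im (w : CSpace d) : (csq w).im = 2 * inner ℝ (rePart w) (imPart w) := by
  rw [csq, Complex.im_sum, PiLp.inner_apply, Finset.mul_sum]
  refine Finset.sum_congr rfl fun j _ => ?_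
  simp [rePart, imPart, sq]
  ring

lemma csq_ofRealVec (x : RSpace d) : csq (ofRealVec x) = (‖x‖ : ℂ) ^ 2 := by
  refine Complex.ext ?_ ?_
  · rw [csq_re, rePart_ofRealVec, imPart_ofRealVec, ← Complex.ofReal_pow, Complex.ofReal_re,
      norm_zero]
    ring
  · rw [csq_im, rePart_ofRealVec, imPart_ofRealVec, ← Complex.ofReal_pow, Complex.ofReal_im,
      inner_zero_right, mul_zero]

lemma contDiff_csq {n : WithTop ℕ∞} : ContDiff ℂ n (csq : CSpace d → ℂ) := by
  unfold csq
  refine ContDiff.sum fun j _ => ?_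
  exact (EuclideanSpace.proj (𝕜 := ℂ) j).contDiff.pow 2

lemma contDiff_heatC {n : WithTop ℕ∞} (z : ℂ) : ContDiff ℂ n (heatC z : CSpace d → ℂ) := by
  unfold heatC
  exact contDiff_const.mul ((contDiff_csq.neg.div_const _).cexp)

/-- The rate of decay in the real directions of the heat kernel at the complex time `z`. -/
noncomputable def heatRate (z : ℂ) : ℝ := z.re / (4 * ‖z‖ ^ 2)

/-- The modulus of the heat kernel at the complex time `z` and at the origin. -/
noncomputable def heatAmp (d : ℕ) (z : ℂ) : ℝ := (4 * Real.pi * ‖z‖) ^ (-(d : ℝ) / 2)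

lemma heatRate_pos {z : ℂ} (hz : 0 < z.re) : 0 < heatRate z := by
  have : 0 < ‖z‖ := norm_pos_iff.2 fun h => by simp [h] at hz
  unfold heatRate; positivity

lemma heatAmp_pos {z : ℂ} (hz : 0 < z.re) : 0 < heatAmp d z := by
  have : 0 < ‖z‖ := norm_pos_iff.2 fun h => by simp [h] at hz
  have := Real.pi_pos
  unfold heatAmp; positivity

lemma norm_heatC_le {z : ℂ} {σ : ℝ} (hz : 0 < z.re) (hσ : |z.im| ≤ σ * z.re) (w : CSpace d) :
    ‖heatC z w‖ ≤ heatAmp d z *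
      Real.exp (-heatRate z * ((1 - σ) * ‖rePart w‖ ^ 2 - (1 + σ) * ‖imPart w‖ ^ 2)) := by
  have hz0 : 0 < ‖z‖ := norm_pos_iff.2 fun h => by simp [h] at hz
  have h1 : ‖(4 * Real.pi * z : ℂ)‖ = 4 * Real.pi * ‖z‖ := by
    simp [abs_of_pos Real.pi_pos]
  rw [heatC, norm_mul, Complex.norm_cpow_real, h1, Complex.norm_exp, heatAmp]
  refine mul_le_mul_of_nonneg_left (Real.exp_le_exp.2 ?_) (by have := Real.pi_pos; positivity)
  have h2 : (-csq w / (4 * z)).re =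
      -(((csq w).re * z.re + (csq w).im * z.im) / (4 * ‖z‖ ^ 2)) := by
    rw [Complex.div_re, Complex.normSq_mul, ← Complex.sq_norm z]
    have : Complex.normSq 4 = 16 := by rw [Complex.normSq_apply]; norm_num
    rw [this]
    simp
    field_simp
    ring
  have h3 : |2 * inner ℝ (rePart w) (imPart w)| ≤ ‖rePart w‖ ^ 2 + ‖imPart w‖ ^ 2 := by
    rw [abs_mul, abs_two]
    have := abs_real_inner_le_norm (rePart w) (imPart w)
    nlinarith [sq_nonneg (‖rePart w‖ - ‖imPart w‖)]
  have h4 : -((csq w).im * z.im) ≤ (‖rePart w‖ ^ 2 + ‖imPart w‖ ^ 2) * (σ * z.re) := by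
    refine (neg_le_abs _).trans ?_
    rw [abs_mul, csq_im]
    exact mul_le_mul h3 hσ (abs_nonneg _) (by positivity)
  rw [h2, heatRate, neg_mul, neg_le_neg_iff, div_mul_eq_mul_div]
  refine div_le_div_of_nonneg_right ?_ (by positivity)
  rw [csq_re]
  linarith

/-- The cone `|im z| < σ re z`. -/
def timeCone (σ : ℝ) : Set ℂ := {z | 0 < z.re ∧ |z.im| < σ * z.re}

lemma isOpen_timeCone (σ : ℝ) : IsOpen (timeCone σ) :=
  (isOpen_lt continuous_const Complex.continuous_re).inter
    (isOpen_lt Complex.continuous_im.abs (continuous_const.mul Complex.continuous_re))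

lemma add_mem_timeCone {σ : ℝ} {z w : ℂ} (hz : z ∈ timeCone σ) (hw : w ∈ timeCone σ) :
    z + w ∈ timeCone σ := by
  refine ⟨add_pos hz.1 hw.1, ?_⟩
  rw [Complex.add_im, Complex.add_re, mul_add]
  exact (abs_add_le _ _).trans_lt (add_lt_add hz.2 hw.2)

lemma ofReal_mem_timeCone {σ t : ℝ} (hσ : 0 < σ) (ht : 0 < t) : (t : ℂ) ∈ timeCone σ :=
  ⟨by simpa using ht, by simpa using mul_pos hσ ht⟩

lemma GaussKernel.mono {τ τ' M m : ℝ} {K : CSpace d → ℂ} (hK : GaussKernel τ M m K)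
    (h : τ ≤ τ') : GaussKernel τ' M m K := by
  refine ⟨hK.pos, hK.contDiff, fun w => (hK.bound w).trans
    (mul_le_mul_of_nonneg_left (Real.exp_le_exp.2 ?_) hK.nonneg)⟩
  rw [neg_mul, neg_mul, neg_le_neg_iff]
  refine mul_le_mul_of_nonneg_left ?_ hK.pos.le
  nlinarith [sq_nonneg ‖rePart w‖, sq_nonneg ‖imPart w‖]

lemma gaussKernel_heatC {σ : ℝ} {z : ℂ} (hz : z ∈ timeCone σ) :
    GaussKernel σ (heatAmp d z) (heatRate z) (heatC z : CSpace d → ℂ) :=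
  ⟨heatRate_pos hz.1, contDiff_heatC z, norm_heatC_le hz.1 hz.2.le⟩

lemma norm_lt_of_mem_timeCone {σ : ℝ} (hσ : σ ≤ 1) {z : ℂ} (hz : z ∈ timeCone σ) :
    ‖z‖ < 2 * z.re := by
  have h1 := Complex.norm_le_abs_re_add_abs_im z
  rw [abs_of_pos hz.1] at h1
  nlinarith [hz.2, hz.1]

lemma inv_heatRate_le {σ : ℝ} (hσ : σ ≤ 1) {z : ℂ} (hz : z ∈ timeCone σ) :
    1 / heatRate z ≤ 8 * ‖z‖ := by
  have h1 := norm_lt_of_mem_timeCone hσ hz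
  have h2 := hz.1
  rw [heatRate, one_div_div, div_le_iff₀ h2]
  nlinarith [norm_nonneg z]

/-- The `L¹` norm on deformed domains of the heat kernel at the times of the cone is bounded. -/
lemma heatAmp_mul_le {σ : ℝ} (hσ : σ ≤ 1) {z : ℂ} (hz : z ∈ timeCone σ) {κ : ℝ} (hκ : 0 < κ) :
    heatAmp d z * (2 * Real.pi / (heatRate z * κ)) ^ ((d : ℝ) / 2) ≤
      (4 / κ) ^ ((d : ℝ) / 2) := by
  have hpi := Real.pi_pos
  have hz0 : 0 < ‖z‖ := norm_pos_iff.2 fun h => by have := hz.1; simp [h] at this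
  have h1 : 0 < 4 * Real.pi * ‖z‖ := by positivity
  have h2 := heatRate_pos hz.1
  rw [heatAmp, neg_div, Real.rpow_neg h1.le, ← Real.inv_rpow h1.le,
    ← Real.mul_rpow (by positivity) (by positivity)]
  refine Real.rpow_le_rpow (by positivity) ?_ (by positivity)
  calc (4 * Real.pi * ‖z‖)⁻¹ * (2 * Real.pi / (heatRate z * κ))
      = (4 * Real.pi * ‖z‖)⁻¹ * (2 * Real.pi / κ) * (1 / heatRate z) := by field_simp
    _ ≤ (4 * Real.pi * ‖z‖)⁻¹ * (2 * Real.pi / κ) * (8 * ‖z‖) := by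
        gcongr
        exact inv_heatRate_le hσ hz
    _ = 4 / κ := by field_simp; ring

lemma convBound_heat_le {σ : ℝ} (hσ : σ ≤ 1) {z : ℂ} (hz : z ∈ timeCone σ) {α : ℝ}
    (hα : 1 < α) :
    convBound d α (heatAmp d z) (heatRate z) ≤ 4 * (4 / coneRate α) ^ ((d : ℝ) / 2) := by
  rw [convBound, mul_assoc]
  exact mul_le_mul_of_nonneg_left (heatAmp_mul_le hσ hz (coneRate_pos hα)) (by norm_num)

/-! ### The gradient of the heat kernel -/

lemma fderiv_heatC (z : ℂ) (w : CSpace d) (j : Fin d) :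
    fderiv ℂ (heatC z) w (EuclideanSpace.single j 1) = -(w j / (2 * z)) * heatC z w := by
  have h0 : HasFDerivAt (csq : CSpace d → ℂ)
      (∑ i, (2 * w i) • (EuclideanSpace.proj (𝕜 := ℂ) i : CSpace d →L[ℂ] ℂ)) w := by
    unfold csq
    refine HasFDerivAt.fun_sum fun i _ => ?_
    have := ((EuclideanSpace.proj i : CSpace d →L[ℂ] ℂ).hasFDerivAt (x := w)).pow 2
    simpa using this
  have h1 : HasFDerivAt (heatC z : CSpace d → ℂ) _ w :=
    (((h0.neg.mul_const ((4 * z)⁻¹)).cexp).const_mul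
      ((4 * Real.pi * z) ^ (((-(d : ℝ) / 2 : ℝ)) : ℂ)))
  rw [h1.fderiv]
  simp only [heatC, div_eq_mul_inv]
  simp [PiLp.single_apply]
  ring

/-- At a real time `t`, the derivatives of the heat kernel are kernels of Gaussian type, larger by
a factor of order `t^{-1/2}` than the heat kernel. The price is a larger `τ`. -/
lemma gaussKernel_fderiv_heatC {σ t : ℝ} (hσ : 0 < σ) (ht : 0 < t) (j : Fin d) :
    GaussKernel (2 * σ) (heatAmp d t / (√σ * √t)) (heatRate t)
      fun w : CSpace d => fderiv ℂ (heatC t) w (EuclideanSpace.single j 1) := by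
  have hz := ofReal_mem_timeCone hσ ht
  have hm := heatRate_pos hz.1
  simp only [fderiv_heatC]
  refine ⟨hm, ?_, fun w => ?_⟩
  · exact ((EuclideanSpace.proj (𝕜 := ℂ) j).contDiff.div_const _).neg.mul (contDiff_heatC _)
  · have hrate : heatRate t = 1 / (4 * t) := by
      rw [heatRate, Complex.ofReal_re, Complex.norm_real, Real.norm_of_nonneg ht.le]
      field_simp
    set E := Real.exp (-heatRate t * ((1 - 2 * σ) * ‖rePart w‖ ^ 2 -
      (1 + 2 * σ) * ‖imPart w‖ ^ 2)) with hE
    have h1 := norm_heatC_le hz.1 hz.2.le w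
    have h2 : Real.exp (-heatRate t * ((1 - σ) * ‖rePart w‖ ^ 2 - (1 + σ) * ‖imPart w‖ ^ 2)) =
        E * Real.exp (-(√(heatRate t * σ) * ‖w‖) ^ 2) := by
      rw [hE, ← Real.exp_add, mul_pow, Real.sq_sqrt (by positivity), norm_sq_eq_rePart_imPart]
      congr 1; ring
    have h3 : (√(heatRate t * σ) * ‖w‖) * Real.exp (-(√(heatRate t * σ) * ‖w‖) ^ 2) ≤ 1 := by
      set y := √(heatRate t * σ) * ‖w‖
      rw [Real.exp_neg, ← div_eq_mul_inv, div_le_one (Real.exp_pos _)]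
      nlinarith [Real.add_one_le_exp (y ^ 2), sq_nonneg (y - 1)]
    have h4 : √(heatRate t * σ) = √σ / (2 * √t) := by
      rw [hrate, one_div_mul_eq_div, Real.sqrt_div hσ.le, Real.sqrt_mul (by norm_num),
        show (4 : ℝ) = 2 ^ 2 by norm_num, Real.sqrt_sq (by norm_num)]
    have hst : 0 < √t := Real.sqrt_pos.2 ht
    have hss : 0 < √σ := Real.sqrt_pos.2 hσ
    have h5 : ‖w j‖ / (2 * t) ≤ (√(heatRate t * σ) * ‖w‖) * (1 / (√σ * √t)) := by
      rw [h4]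
      have e : √σ / (2 * √t) * ‖w‖ * (1 / (√σ * √t)) = ‖w‖ / (2 * t) := by
        rw [← Real.mul_self_sqrt ht.le]
        simp only [Real.sqrt_mul_self hst.le]
        field_simp
      rw [e]
      exact div_le_div_of_nonneg_right (PiLp.norm_apply_le w j) (by positivity)
    rw [h2] at h1
    have h6 : ‖-(w j / (2 * (t : ℂ)))‖ = ‖w j‖ / (2 * t) := by
      rw [norm_neg, norm_div, norm_mul, Complex.norm_real, Real.norm_of_nonneg ht.le]
      simp
    rw [norm_mul, h6]
    have hA := (heatAmp_pos (d := d) hz.1).le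
    calc ‖w j‖ / (2 * t) * ‖heatC (t : ℂ) w‖
        ≤ ((√(heatRate t * σ) * ‖w‖) * (1 / (√σ * √t))) *
          (heatAmp d t * (E * Real.exp (-(√(heatRate t * σ) * ‖w‖) ^ 2))) := by gcongr
      _ = (heatAmp d t / (√σ * √t)) * E * ((√(heatRate t * σ) * ‖w‖) *
          Real.exp (-(√(heatRate t * σ) * ‖w‖) ^ 2)) := by ring
      _ ≤ (heatAmp d t / (√σ * √t)) * E * 1 := by
          refine mul_le_mul_of_nonneg_left h3 ?_
          have := Real.exp_pos (-heatRate t * ((1 - 2 * σ) * ‖rePart w‖ ^ 2 -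
            (1 + 2 * σ) * ‖imPart w‖ ^ 2))
          positivity
      _ = _ := mul_one _

/-! ### The derivative of the heat kernel in time -/

/-- The derivative of the heat kernel with respect to the complex time. -/
noncomputable def heatCDeriv (z : ℂ) (w : CSpace d) : ℂ :=
  (csq w / (4 * z ^ 2) - d / (2 * z)) * heatC z w

lemma hasDerivAt_heatC {z : ℂ} (hz : 0 < z.re) (w : CSpace d) :
    HasDerivAt (fun z => heatC z w) (heatCDeriv z w) z := by
  have hz0 : z ≠ 0 := fun h => by simp [h] at hz
  have hpi : (Real.pi : ℂ) ≠ 0 := by exact_mod_cast Real.pi_ne_zero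
  have hs : (4 * Real.pi * z : ℂ) ∈ Complex.slitPlane := by
    refine Or.inl ?_
    have : (4 * Real.pi * z : ℂ).re = 4 * Real.pi * z.re := by simp
    rw [this]
    have := Real.pi_pos
    positivity
  have h1 : HasDerivAt (fun z : ℂ => 4 * Real.pi * z) (4 * Real.pi) z := by
    simpa using (hasDerivAt_id z).const_mul (4 * Real.pi : ℂ)
  have h2 := h1.cpow_const (c := (((-(d : ℝ) / 2 : ℝ)) : ℂ)) hs
  have h3 : HasDerivAt (fun z : ℂ => -csq w / (4 * z)) (csq w / (4 * z ^ 2)) z := by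
    have h4 : HasDerivAt (fun z : ℂ => 4 * z) 4 z := by
      simpa using (hasDerivAt_id z).const_mul (4 : ℂ)
    have h5 := (hasDerivAt_const z (-csq w)).div h4 (by simpa using hz0)
    refine h5.congr_deriv ?_
    field_simp
    ring
  refine (h2.mul h3.cexp).congr_deriv ?_
  rw [Complex.cpow_sub _ _ (by simp [hz0, hpi]), Complex.cpow_one, heatCDeriv, heatC]
  push_cast
  field_simp
  ring

end HeatC

/-! ### Analyticity in time -/

/-- The first order Taylor expansion of a bounded holomorphic function. -/
lemma norm_sub_sub_deriv_le {g : ℂ → ℂ} {z : ℂ} {r B : ℝ} (hr : 0 < r)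
    (hg : DifferentiableOn ℂ g (Metric.ball z r)) (hB : ∀ ζ ∈ Metric.ball z r, ‖g ζ‖ ≤ B) :
    ‖deriv g z‖ ≤ 2 * B / r ∧ ∀ ζ ∈ Metric.ball z r,
      ‖g ζ - g z - (ζ - z) * deriv g z‖ ≤ 4 * B / r ^ 2 * ‖ζ - z‖ ^ 2 := by
  have hz := Metric.mem_ball_self (x := z) hr
  have hnh : Metric.ball z r ∈ 𝓝 z := Metric.ball_mem_nhds z hr
  have h1 : ∀ ζ ∈ Metric.ball z r, ‖dslope g z ζ‖ ≤ 2 * B / r := fun ζ hζ =>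
    Complex.norm_dslope_le_div_of_mapsTo_ball hg (fun u hu => by
      rw [mem_closedBall_iff_norm]
      linarith [norm_sub_le (g u) (g z), hB u hu, hB z hz]) hζ
  have h2 : ∀ ζ ∈ Metric.ball z r, ‖dslope (dslope g z) z ζ‖ ≤ 2 * (2 * B / r) / r := fun ζ hζ =>
    Complex.norm_dslope_le_div_of_mapsTo_ball ((Complex.differentiableOn_dslope hnh).2 hg)
      (fun u hu => by
        rw [mem_closedBall_iff_norm]
        linarith [norm_sub_le (dslope g z u) (dslope g z z), h1 u hu, h1 z hz]) hζ
  refine ⟨by simpa using h1 z hz, fun ζ hζ => ?_⟩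
  have e1 : g ζ - g z = (ζ - z) * dslope g z ζ := by
    rw [← smul_eq_mul, sub_smul_dslope]
  have e2 : dslope g z ζ - deriv g z = (ζ - z) * dslope (dslope g z) z ζ := by
    rw [← smul_eq_mul, sub_smul_dslope, dslope_same]
  have e3 : g ζ - g z - (ζ - z) * deriv g z = (ζ - z) ^ 2 * dslope (dslope g z) z ζ := by
    rw [e1, ← mul_sub, e2]; ring
  rw [e3, norm_mul, norm_pow]
  calc ‖ζ - z‖ ^ 2 * ‖dslope (dslope g z) z ζ‖ ≤ ‖ζ - z‖ ^ 2 * (2 * (2 * B / r) / r) :=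
        mul_le_mul_of_nonneg_left (h2 ζ hζ) (by positivity)
    _ = _ := by field_simp; ring

section TimeDerivative

variable {d : ℕ}

lemma contDiff_heatCDeriv {n : WithTop ℕ∞} (z : ℂ) :
    ContDiff ℂ n (heatCDeriv z : CSpace d → ℂ) := by
  unfold heatCDeriv
  exact ((contDiff_csq.div_const _).sub contDiff_const).mul (contDiff_heatC z)

/-- The heat kernels at the times near `z` are kernels of Gaussian type with common constants. -/
lemma exists_ball_norm_heatC_le {σ τ : ℝ} (hστ : σ < τ) {z : ℂ} (hσ1 : σ < 1)
    (hσ0 : 0 < σ) (hz : z ∈ timeCone σ) :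
    ∃ r > 0, ∃ M, ∀ ζ ∈ Metric.ball z r, ζ ∈ timeCone σ ∧ ∀ w : CSpace d, ‖heatC ζ w‖ ≤
      M * Real.exp (-heatRate z * ((1 - τ) * ‖rePart w‖ ^ 2 - (1 + τ) * ‖imPart w‖ ^ 2)) := by
  have hm := heatRate_pos hz.1
  have hz0 : ‖z‖ ≠ 0 := fun h => by have := hz.1; simp [norm_eq_zero.1 h] at this
  have hpi := Real.pi_pos
  have hcr : ContinuousAt heatRate z := by
    unfold heatRate
    exact Complex.continuous_re.continuousAt.div (by fun_prop) (by positivity)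
  have hca : ContinuousAt (heatAmp d) z := by
    unfold heatAmp
    exact ContinuousAt.rpow_const (by fun_prop) (Or.inl (by positivity))
  have e1 : ∀ᶠ ζ in 𝓝 z, (1 - τ) * heatRate z < (1 - σ) * heatRate ζ :=
    (continuousAt_const (y := (1 - τ) * heatRate z)).eventually_lt (hcr.const_mul (1 - σ))
      (by nlinarith)
  have e2 : ∀ᶠ ζ in 𝓝 z, (1 + σ) * heatRate ζ < (1 + τ) * heatRate z :=
    (hcr.const_mul (1 + σ)).eventually_lt (continuousAt_const (y := (1 + τ) * heatRate z))
      (by nlinarith)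
  have e3 : ∀ᶠ ζ in 𝓝 z, heatAmp d ζ < heatAmp d z + 1 :=
    hca.eventually_lt continuousAt_const (by linarith)
  obtain ⟨r, hr, h⟩ := Metric.eventually_nhds_iff_ball.1
    (((e1.and e2).and e3).and ((isOpen_timeCone σ).eventually_mem hz))
  refine ⟨r, hr, heatAmp d z + 1, fun ζ hζ => ?_⟩
  obtain ⟨⟨⟨h1, h2⟩, h3⟩, h4⟩ := h ζ hζ
  refine ⟨h4, fun w => (norm_heatC_le h4.1 h4.2.le w).trans ?_⟩
  refine mul_le_mul h3.le (Real.exp_le_exp.2 ?_) (Real.exp_pos _).le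
    (by have := heatAmp_pos (d := d) hz.1; linarith)
  have h5 := mul_le_mul_of_nonneg_right h1.le (sq_nonneg ‖rePart w‖)
  have h6 := mul_le_mul_of_nonneg_right h2.le (sq_nonneg ‖imPart w‖)
  linarith

/-- The heat kernel is differentiable in time as a kernel of Gaussian type. -/
lemma exists_gaussKernel_taylor {σ τ : ℝ} (hστ : σ < τ) {z : ℂ} (hσ1 : σ < 1)
    (hσ0 : 0 < σ) (hz : z ∈ timeCone σ) :
    ∃ r > 0, ∃ M, GaussKernel τ M (heatRate z) (heatCDeriv z : CSpace d → ℂ) ∧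
      ∀ ζ ∈ Metric.ball z r, ζ ∈ timeCone σ ∧
        GaussKernel τ (M * ‖ζ - z‖ ^ 2) (heatRate z)
          fun w : CSpace d => heatC ζ w - heatC z w - (ζ - z) * heatCDeriv z w := by
  obtain ⟨r, hr, M, h⟩ := exists_ball_norm_heatC_le (d := d) hστ hσ1 hσ0 hz
  have hm := heatRate_pos hz.1
  have key := fun w : CSpace d => norm_sub_sub_deriv_le (g := fun ζ => heatC ζ w) hr
    (fun ζ hζ => (hasDerivAt_heatC (h ζ hζ).1.1 w).differentiableAt.differentiableWithinAt)
    (fun ζ hζ => (h ζ hζ).2 w)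
  have hM : 0 ≤ M := by
    have h1 := (h z (Metric.mem_ball_self hr)).2 0
    exact nonneg_of_mul_nonneg_left ((norm_nonneg _).trans h1) (Real.exp_pos _)
  simp only [(hasDerivAt_heatC hz.1 _).deriv] at key
  -- a common constant for the bounds of the derivative and of the remainder
  refine ⟨r, hr, 2 * M / r + 4 * M / r ^ 2, ⟨hm, contDiff_heatCDeriv z, fun w => ?_⟩,
    fun ζ hζ => ⟨(h ζ hζ).1, hm, ?_, fun w => ?_⟩⟩
  · refine (key w).1.trans ?_
    set E := Real.exp (-heatRate z * ((1 - τ) * ‖rePart w‖ ^ 2 - (1 + τ) * ‖imPart w‖ ^ 2)) with hE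
    have hE0 : 0 ≤ E := (Real.exp_pos _).le
    have : 0 ≤ 4 * M / r ^ 2 * E := by positivity
    calc 2 * (M * E) / r = 2 * M / r * E := by ring
      _ ≤ _ := by rw [add_mul]; linarith
  · exact ((contDiff_heatC ζ).sub (contDiff_heatC z)).sub
      (contDiff_const.mul (contDiff_heatCDeriv z))
  · refine ((key w).2 ζ hζ).trans ?_
    set E := Real.exp (-heatRate z * ((1 - τ) * ‖rePart w‖ ^ 2 - (1 + τ) * ‖imPart w‖ ^ 2)) with hE
    have hE0 : 0 ≤ E := (Real.exp_pos _).le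
    have : 0 ≤ 2 * M / r * ‖ζ - z‖ ^ 2 * E := by positivity
    calc 4 * (M * E) / r ^ 2 * ‖ζ - z‖ ^ 2 = 4 * M / r ^ 2 * ‖ζ - z‖ ^ 2 * E := by ring
      _ ≤ _ := by rw [add_mul, add_mul]; linarith

end TimeDerivative

section Semigroup

variable {d : ℕ} {α : ℝ} {hα : 0 < α}

/-- The half-width of the cone of times on which the heat semigroup is considered. -/
noncomputable def timeSlope (α : ℝ) : ℝ := kernelTau α / 2

lemma timeSlope_pos (hα1 : 1 < α) : 0 < timeSlope α := half_pos (kernelTau_pos hα1)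

lemma timeSlope_lt (hα1 : 1 < α) : timeSlope α < kernelTau α := half_lt_self (kernelTau_pos hα1)

lemma timeSlope_lt_quarter (hα1 : 1 < α) : timeSlope α < 1 / 4 := by
  have := kernelTau_lt_half hα1
  unfold timeSlope; linarith

lemma gaussKernel_heatC_X (hα1 : 1 < α) {z : ℂ} (hz : z ∈ timeCone (timeSlope α)) :
    GaussKernel (kernelTau α) (heatAmp d z) (heatRate z) (heatC z : CSpace d → ℂ) :=
  (gaussKernel_heatC hz).mono (timeSlope_lt hα1).le

open Classical in
/-- The heat semigroup on `X_α^1` at the complex times of a cone, and the identity elsewhere. -/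
noncomputable def heatS (hα1 : 1 < α) (z : ℂ) : XOneSpace d α hα →L[ℂ] XOneSpace d α hα :=
  if hz : z ∈ timeCone (timeSlope α) then (gaussKernel_heatC_X hα1 hz).convXOne hα1
  else ContinuousLinearMap.id ℂ _

lemma heatS_of_mem (hα1 : 1 < α) {z : ℂ} (hz : z ∈ timeCone (timeSlope α)) :
    heatS (d := d) (hα := hα) hα1 z = (gaussKernel_heatC_X hα1 hz).convXOne hα1 := dif_pos hz

lemma heatS_apply (hα1 : 1 < α) {z : ℂ} (hz : z ∈ timeCone (timeSlope α))
    (f : XOneSpace d α hα) (x : RSpace d) : heatS hα1 z f x = conv (heatC z) f (ofRealVec x) := by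
  rw [heatS_of_mem hα1 hz]; rfl

lemma heatS_zero (hα1 : 1 < α) :
    heatS (d := d) (hα := hα) hα1 0 = ContinuousLinearMap.id ℂ _ :=
  dif_neg fun h => by simpa using h.1

lemma differentiableAt_heatS (hα1 : 1 < α) {z : ℂ} (hz : z ∈ timeCone (timeSlope α)) :
    DifferentiableAt ℂ (heatS (d := d) (hα := hα) hα1) z := by
  obtain ⟨r, hr, M, hD, h⟩ := exists_gaussKernel_taylor (d := d) (timeSlope_lt hα1)
    ((timeSlope_lt_quarter hα1).trans (by norm_num)) (timeSlope_pos hα1) hz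
  -- The derivative is the convolution with the time derivative of the kernel.
  set D : XOneSpace d α hα →L[ℂ] XOneSpace d α hα := hD.convXOne hα1 with hDdef
  set T : ℂ → XOneSpace d α hα →L[ℂ] XOneSpace d α hα := fun ζ =>
    heatS hα1 ζ - heatS hα1 z - (ζ - z) • D with hT
  have hTe : ∀ ζ (hζ : ζ ∈ Metric.ball z r), T ζ = (h ζ hζ).2.convXOne hα1 := by
    intro ζ hζ
    have hζc := (h ζ hζ).1
    refine ContinuousLinearMap.ext fun f => Subtype.ext (funext fun x => ?_)
    have e1 : (T ζ f).1 x =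
      heatS hα1 ζ f x - heatS hα1 z f x - (ζ - z) * conv (heatCDeriv z) f (ofRealVec x) := rfl
    rw [e1]
    refine Eq.trans ?_ ((h ζ hζ).2.convXOne_apply hα1 f x).symm
    have i1 := (gaussKernel_heatC_X hα1 hζc).integrable_X hα1 f.toX (ofRealVec x)
    have i2 := (gaussKernel_heatC_X hα1 hz).integrable_X hα1 f.toX (ofRealVec x)
    have i3 := (hD.integrable_X hα1 f.toX (ofRealVec x)).const_mul (ζ - z)
    rw [heatS_apply hα1 hζc, heatS_apply hα1 hz, conv, conv, conv, conv, ← integral_const_mul]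
    have e := integral_sub (i1.sub i2) i3
    simp only [Pi.sub_apply] at e
    rw [integral_sub i1 i2] at e
    refine Eq.trans e.symm (integral_congr_ae (ae_of_all _ fun y => ?_))
    simp only [XOneSpace.toX]
    ring
  have hO : T =O[𝓝 z] fun ζ => ‖ζ - z‖ ^ 2 := by
    refine Asymptotics.IsBigO.of_bound (convBound d α M (heatRate z)) ?_
    filter_upwards [Metric.ball_mem_nhds z hr] with ζ hζ
    rw [hTe ζ hζ, norm_pow, norm_norm]
    refine ((h ζ hζ).2.norm_convXOne_le hα1).trans (le_of_eq ?_)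
    rw [convBound, convBound]; ring
  have hTd : DifferentiableAt ℂ T z := (hO.hasFDerivAt one_lt_two).differentiableAt
  have e : heatS (d := d) (hα := hα) hα1 = fun ζ => T ζ + (heatS hα1 z + (ζ - z) • D) := by
    funext ζ; simp only [hT]; abel
  rw [e]
  refine hTd.add ((differentiableAt_const _).add ?_)
  exact (differentiableAt_id.sub_const z).smul_const D

lemma analyticOnNhd_heatS (hα1 : 1 < α) :
    AnalyticOnNhd ℂ (heatS (d := d) (hα := hα) hα1) (timeCone (timeSlope α)) :=
  DifferentiableOn.analyticOnNhd
    (fun _ hz => (differentiableAt_heatS hα1 hz).differentiableWithinAt) (isOpen_timeCone _)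

/-! ### The semigroup law -/

lemma mul_cpow_of_re_pos {a b : ℂ} (ha : 0 < a.re) (hb : 0 < b.re) (s : ℂ) :
    (a * b) ^ s = a ^ s * b ^ s := by
  have ha0 : a ≠ 0 := fun h => by simp [h] at ha
  have hb0 : b ≠ 0 := fun h => by simp [h] at hb
  have h1 := abs_lt.1 (Complex.abs_arg_lt_pi_div_two_iff.2 (Or.inl ha))
  have h2 := abs_lt.1 (Complex.abs_arg_lt_pi_div_two_iff.2 (Or.inl hb))
  rw [Complex.cpow_def_of_ne_zero (mul_ne_zero ha0 hb0), Complex.cpow_def_of_ne_zero ha0,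
    Complex.cpow_def_of_ne_zero hb0, ← Complex.exp_add, ← add_mul,
    Complex.log_mul ha0 hb0 ⟨by linarith [h1.1, h2.1], by linarith [h1.2, h2.2]⟩]

lemma heatC_ofRealVec (z : ℂ) (x : RSpace d) : heatC z (ofRealVec x) =
    (4 * Real.pi * z) ^ (((-(d : ℝ) / 2 : ℝ)) : ℂ) * Complex.exp (-(‖x‖ : ℂ) ^ 2 / (4 * z)) := by
  rw [heatC, csq_ofRealVec]

lemma re_mul_pos {z : ℂ} (hz : 0 < z.re) : 0 < (4 * Real.pi * z : ℂ).re := by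
  have : (4 * Real.pi * z : ℂ).re = 4 * Real.pi * z.re := by simp
  rw [this]
  have := Real.pi_pos
  positivity

lemma re_inv_pos {z : ℂ} (hz : 0 < z.re) : 0 < (z⁻¹).re := by
  have hz0 : z ≠ 0 := fun h => by simp [h] at hz
  rw [Complex.inv_re]
  exact div_pos hz (Complex.normSq_pos.2 hz0)

lemma integral_heatC {z : ℂ} (hz : 0 < z.re) :
    ∫ y : RSpace d, heatC z (ofRealVec y) = 1 := by
  have hz0 : z ≠ 0 := fun h => by simp [h] at hz
  have hpi : (Real.pi : ℂ) ≠ 0 := by exact_mod_cast Real.pi_ne_zero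
  have hb : 0 < ((4 * z)⁻¹).re := re_inv_pos (by simpa using hz)
  have h := GaussianFourier.integral_cexp_neg_mul_sq_norm (V := RSpace d) hb
  have e : ∀ y : RSpace d, heatC z (ofRealVec y) =
      (4 * Real.pi * z) ^ (((-(d : ℝ) / 2 : ℝ)) : ℂ) *
        Complex.exp (-(4 * z)⁻¹ * (‖y‖ : ℂ) ^ 2) := fun y => by
    rw [heatC_ofRealVec]; congr 2; field_simp
  simp only [e]
  rw [integral_const_mul, h, finrank_euclideanSpace_fin,
    show (Real.pi : ℂ) / (4 * z)⁻¹ = 4 * Real.pi * z by field_simp,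
    ← Complex.cpow_add _ _ (by simp [hz0, hpi])]
  rw [show (((-(d : ℝ) / 2 : ℝ)) : ℂ) + (d : ℂ) / 2 = 0 by push_cast; ring, Complex.cpow_zero]

/-- The Chapman–Kolmogorov identity at complex times. -/
lemma integral_heatC_mul {z w : ℂ} (hz : 0 < z.re) (hw : 0 < w.re) (x u : RSpace d) :
    ∫ y : RSpace d, heatC z (ofRealVec (x - y)) * heatC w (ofRealVec (y - u)) =
      heatC (z + w) (ofRealVec (x - u)) := by
  have hz0 : z ≠ 0 := fun h => by simp [h] at hz
  have hw0 : w ≠ 0 := fun h => by simp [h] at hw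
  have hzw : 0 < (z + w).re := add_pos hz hw
  have hzw0 : z + w ≠ 0 := fun h => by simp [h] at hzw
  have hpi : (Real.pi : ℂ) ≠ 0 := by exact_mod_cast Real.pi_ne_zero
  rw [← integral_add_right_eq_self _ u]
  set X := x - u with hX
  set b : ℂ := (4 * z)⁻¹ + (4 * w)⁻¹ with hb
  have hbre : 0 < b.re :=
    add_pos (re_inv_pos (by simpa using hz)) (re_inv_pos (by simpa using hw))
  have hb' : b = (z + w) / (4 * z * w) := by rw [hb]; field_simp; ring
  set s : ℂ := (((-(d : ℝ) / 2 : ℝ)) : ℂ) with hs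
  have e : ∀ y : RSpace d,
      heatC z (ofRealVec (x - (y + u))) * heatC w (ofRealVec (y + u - u)) =
      (4 * Real.pi * z) ^ s * (4 * Real.pi * w) ^ s * Complex.exp (-(‖X‖ : ℂ) ^ 2 / (4 * z)) *
        Complex.exp (-b * (‖y‖ : ℂ) ^ 2 + (1 / (2 * z)) * (inner ℝ X y : ℝ)) := fun y => by
    have h1 : x - (y + u) = X - y := by rw [hX]; abel
    have h2 : (‖X - y‖ : ℂ) ^ 2 = (‖X‖ : ℂ) ^ 2 - 2 * (inner ℝ X y : ℝ) + (‖y‖ : ℂ) ^ 2 := by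
      exact_mod_cast norm_sub_sq_real X y
    rw [h1, add_sub_cancel_right, heatC_ofRealVec, heatC_ofRealVec, h2, mul_mul_mul_comm,
      ← Complex.exp_add, mul_assoc _ (Complex.exp _), ← Complex.exp_add]
    congr 2
    rw [hb]
    field_simp
    ring
  simp only [e]
  rw [integral_const_mul, GaussianFourier.integral_cexp_neg_mul_sq_norm_add hbre,
    finrank_euclideanSpace_fin, heatC_ofRealVec]
  set P : ℂ := Real.pi / b with hP
  have hPre : 0 < P.re := by
    rw [hP, div_eq_mul_inv, Complex.re_ofReal_mul]
    exact mul_pos Real.pi_pos (re_inv_pos hbre)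
  have hP0 : P ≠ 0 := fun h => by simp [h] at hPre
  have hprod : (4 * Real.pi * z) * (4 * Real.pi * w) = P * (4 * Real.pi * (z + w)) := by
    rw [hP, hb']; field_simp
  have hds : (d : ℂ) / 2 = -s := by rw [hs]; push_cast; ring
  have hpow : (4 * Real.pi * z) ^ s * (4 * Real.pi * w) ^ s * P ^ ((d : ℂ) / 2) =
      (4 * Real.pi * (z + w)) ^ s := by
    rw [← mul_cpow_of_re_pos (re_mul_pos hz) (re_mul_pos hw), hprod,
      mul_cpow_of_re_pos hPre (re_mul_pos hzw), hds, Complex.cpow_neg]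
    have : P ^ s ≠ 0 := by simp [Complex.cpow_eq_zero_iff, hP0]
    rw [mul_right_comm, mul_inv_cancel₀ this, one_mul]
  have hexp : -(‖X‖ : ℂ) ^ 2 / (4 * z) + (1 / (2 * z)) ^ 2 * (‖X‖ : ℂ) ^ 2 / (4 * b) =
      -(‖X‖ : ℂ) ^ 2 / (4 * (z + w)) := by
    rw [hb']; field_simp; ring
  rw [← hpow, ← hexp, Complex.exp_add]
  ring

/-- The integrability behind the associativity of convolution. -/
lemma GaussKernel.integrable_prod {τ M m M' m' : ℝ} {K K' : CSpace d → ℂ}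
    (hK : GaussKernel τ M m K) (hK' : GaussKernel τ M' m' K') (hτ0 : 0 ≤ τ) (hτ1 : τ < 1)
    {f : RSpace d → ℂ} (hf : Continuous f) {B : ℝ} (hB : ∀ y, ‖f y‖ ≤ B) (x : RSpace d) :
    Integrable (fun p : RSpace d × RSpace d =>
      K (ofRealVec (x - p.1)) * (K' (ofRealVec (p.1 - p.2)) * f p.2)) (volume.prod volume) := by
  have hc : Continuous fun y : RSpace d => K (ofRealVec y) :=
    hK.contDiff.continuous.comp continuous_ofRealVec
  have hc' : Continuous fun y : RSpace d => K' (ofRealVec y) :=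
    hK'.contDiff.continuous.comp continuous_ofRealVec
  have hmeas : AEStronglyMeasurable (fun p : RSpace d × RSpace d =>
      K (ofRealVec (x - p.1)) * (K' (ofRealVec (p.1 - p.2)) * f p.2)) (volume.prod volume) := by
    refine Continuous.aestronglyMeasurable ?_
    exact (hc.comp (continuous_const.sub continuous_fst)).mul
      ((hc'.comp (continuous_fst.sub continuous_snd)).mul (hf.comp continuous_snd))
  have hi := fun y => hK'.integrable_mul_real hτ0 hτ1 hf hB y
  refine (integrable_prod_iff hmeas).2 ⟨ae_of_all _ fun y =>
    (hi y).const_mul (K (ofRealVec (x - y))), ?_⟩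
  have hiK := hK.integrable_sub_real hτ0 hτ1 x
  have hiK' := hK'.integrable_real hτ0 hτ1
  refine (hiK.norm.mul_const ((∫ u : RSpace d, ‖K' (ofRealVec u)‖) * B)).mono'
    hmeas.norm.integral_prod_right' (ae_of_all _ fun y => ?_)
  rw [Real.norm_of_nonneg (integral_nonneg fun u => norm_nonneg _)]
  simp only [norm_mul]
  rw [integral_const_mul]
  refine mul_le_mul_of_nonneg_left ?_ (norm_nonneg _)
  rw [← integral_sub_left_eq_self (fun u : RSpace d => ‖K' (ofRealVec u)‖) volume y,
    ← integral_mul_const]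
  refine integral_mono_of_nonneg (ae_of_all _ fun u => by positivity)
    ((hiK'.norm.comp_sub_left y).mul_const B) (ae_of_all _ fun u => ?_)
  exact mul_le_mul_of_nonneg_left (hB u) (norm_nonneg _)

/-- The semigroup law for convolutions with the heat kernel. -/
lemma conv_heatC_conv_heatC {z w : ℂ} {σ : ℝ} (hσ1 : σ < 1) (hσ0 : 0 ≤ σ) (hz : z ∈ timeCone σ)
    (hw : w ∈ timeCone σ) {f : RSpace d → ℂ} (hf : Continuous f) {B : ℝ} (hB : ∀ y, ‖f y‖ ≤ B)
    (x : RSpace d) :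
    conv (heatC z) (fun y => conv (heatC w) f (ofRealVec y)) (ofRealVec x) =
      conv (heatC (z + w)) f (ofRealVec x) := by
  simp only [conv, ← ofRealVec_sub, ← integral_const_mul]
  rw [integral_integral_swap ((gaussKernel_heatC hz).integrable_prod
    (gaussKernel_heatC hw) hσ0 hσ1 hf hB x)]
  refine integral_congr_ae (ae_of_all _ fun u => ?_)
  simp only [← mul_assoc]
  rw [integral_mul_const, integral_heatC_mul hz.1 hw.1]

lemma heatS_add (hα1 : 1 < α) {z w : ℂ} (hz : z ∈ timeCone (timeSlope α))
    (hw : w ∈ timeCone (timeSlope α)) :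
    heatS (d := d) (hα := hα) hα1 (z + w) = (heatS hα1 z).comp (heatS hα1 w) := by
  refine ContinuousLinearMap.ext fun f => Subtype.ext (funext fun x => ?_)
  change heatS hα1 (z + w) f x = heatS hα1 z (heatS hα1 w f) x
  rw [heatS_apply hα1 (add_mem_timeCone hz hw), heatS_apply hα1 hz, heatS_of_mem hα1 hw,
    ← conv_heatC_conv_heatC ((timeSlope_lt_quarter hα1).trans (by norm_num))
      (timeSlope_pos hα1).le hz hw f.2.2.1.continuous (XSpace.norm_coe_le_norm f.toX)]
  rfl

end Semigroup

/-! ### Strong continuity at time zero -/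

section StrongContinuity

variable {d : ℕ} {α : ℝ} {hα : 0 < α}

lemma ofRealVec_mem_closure_Omega {x : RSpace d} (hx : ‖x‖ ≤ 1) :
    ofRealVec x ∈ closure (Omega d α) := by
  have h1 : x ∈ closure (Metric.ball (0 : RSpace d) 1) := by
    rw [closure_ball _ one_ne_zero]; simpa using hx
  exact map_mem_closure continuous_ofRealVec h1 fun _ hy => ofRealVec_mem_Omega hy

lemma XSpace.ext_ofRealVec (f : XSpace d α hα) {x : RSpace d} (hx : ‖x‖ ≤ 1) :
    f.ext (ofRealVec x) = f x := by
  have hcl : closure (Metric.ball (0 : RSpace d) 1) = Metric.closedBall 0 1 :=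
    closure_ball _ one_ne_zero
  refine Set.EqOn.of_subset_closure (f := fun x => f.ext (ofRealVec x)) (g := f)
    (s := Metric.ball (0 : RSpace d) 1) (t := Metric.closedBall 0 1)
    (fun y hy => f.holExt.eq_on_ball y hy) ?_ f.2.1.1.continuous.continuousOn
    Metric.ball_subset_closedBall hcl.ge (by simpa using hx)
  exact f.holExt.continuousOn.comp continuous_ofRealVec.continuousOn fun y hy =>
    ofRealVec_mem_closure_Omega (by simpa using hy)

/-- An element of `X_α` and its extension form a uniformly continuous function on
`Ω_α ∪ ℝ^d`. -/
lemma XSpace.exists_norm_glue_sub_le (f : XSpace d α hα) {ε : ℝ} (hε : 0 < ε) :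
    ∃ δ > 0, ∀ ζ ∈ Omega d α ∪ range ofRealVec, ∀ w ∈ Omega d α ∪ range ofRealVec,
      ‖ζ - w‖ < δ → ‖f.glue ζ - f.glue w‖ ≤ ε := by
  obtain ⟨δ₁, hδ₁, h₁⟩ := Metric.uniformContinuousOn_iff.1
    ((isCompact_closure_Omega d hα).uniformContinuousOn_of_continuous f.holExt.continuousOn)
    (ε / 2) (half_pos hε)
  obtain ⟨δ₂, hδ₂, h₂⟩ := Metric.uniformContinuous_iff.1 f.2.1.1 (ε / 2) (half_pos hε)
  -- For `y` off the unit ball, `y / |y|` is an intermediate point between `y` and `Ω_α`.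
  have hmix : ∀ ζ ∈ Omega d α, ∀ y : RSpace d, 1 ≤ ‖y‖ → ‖ζ - ofRealVec y‖ < min (δ₁ / 2) δ₂ →
      ‖f.glue ζ - f.glue (ofRealVec y)‖ ≤ ε := by
    intro ζ hζ y hy hlt
    have hy0 : 0 < ‖y‖ := by linarith
    set y' : RSpace d := ‖y‖⁻¹ • y with hy'
    have hn : ‖y'‖ = 1 := by rw [hy', norm_smul, norm_inv, norm_norm, inv_mul_cancel₀ hy0.ne']
    have hyy : ‖y - y'‖ = ‖y‖ - 1 := by
      have e : y - y' = (1 - ‖y‖⁻¹) • y := by rw [hy', sub_smul, one_smul]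
      have : ‖y‖⁻¹ ≤ 1 := inv_le_one_of_one_le₀ hy
      rw [e, norm_smul, Real.norm_of_nonneg (by linarith), sub_mul, one_mul,
        inv_mul_cancel₀ hy0.ne']
    have hre : ‖rePart ζ‖ ≤ 1 := by
      have h3 : ‖rePart ζ‖ + α * ‖imPart ζ‖ < 1 := hζ
      have := mul_nonneg hα.le (norm_nonneg (imPart ζ))
      linarith
    have hle : ‖y - y'‖ ≤ ‖ζ - ofRealVec y‖ := by
      have h3 := norm_rePart_le (ζ - ofRealVec y)
      rw [rePart_sub, rePart_ofRealVec] at h3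
      have h4 := norm_le_norm_add_norm_sub (rePart ζ) y
      linarith
    have hζy : dist ζ (ofRealVec y') < δ₁ := by
      rw [dist_eq_norm]
      have h3 := norm_sub_le_norm_sub_add_norm_sub ζ (ofRealVec y) (ofRealVec y')
      rw [← ofRealVec_sub y y', norm_ofRealVec] at h3
      linarith [min_le_left (δ₁ / 2) δ₂]
    have e1 := h₁ ζ (subset_closure hζ) (ofRealVec y') (ofRealVec_mem_closure_Omega hn.le) hζy
    have e2 := h₂ (a := y') (b := y) (by
      rw [dist_comm, dist_eq_norm]; exact hle.trans_lt (hlt.trans_le (min_le_right _ _)))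
    rw [f.ext_ofRealVec hn.le] at e1
    rw [f.glue_of_mem hζ, f.glue_ofRealVec, ← dist_eq_norm]
    linarith [dist_triangle (f.ext ζ) (f y') (f y)]
  have hnot : ∀ y : RSpace d, ofRealVec y ∉ Omega d α → 1 ≤ ‖y‖ := fun y hy => by
    by_contra! h
    exact hy (ofRealVec_mem_Omega (by simpa using h))
  refine ⟨min (δ₁ / 2) δ₂, lt_min (half_pos hδ₁) hδ₂, fun ζ hζ w hw hlt => ?_⟩
  by_cases h3 : ζ ∈ Omega d α <;> by_cases h4 : w ∈ Omega d α
  · rw [f.glue_of_mem h3, f.glue_of_mem h4, ← dist_eq_norm]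
    have := h₁ ζ (subset_closure h3) w (subset_closure h4) (by
      rw [dist_eq_norm]; linarith [min_le_left (δ₁ / 2) δ₂])
    linarith
  · obtain ⟨y, rfl⟩ := hw.resolve_left h4
    exact hmix ζ h3 y (hnot y h4) hlt
  · obtain ⟨y, rfl⟩ := hζ.resolve_left h3
    rw [norm_sub_rev] at hlt ⊢
    exact hmix w h4 y (hnot y h3) hlt
  · obtain ⟨y, rfl⟩ := hζ.resolve_left h3
    obtain ⟨y', rfl⟩ := hw.resolve_left h4
    rw [← ofRealVec_sub, norm_ofRealVec, ← dist_eq_norm] at hlt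
    have := h₂ (hlt.trans_le (min_le_right _ _))
    rw [f.glue_ofRealVec, f.glue_ofRealVec, ← dist_eq_norm]
    linarith

lemma conv_heatC_one (hα1 : 1 < α) {z : ℂ} (hz : z ∈ timeCone (timeSlope α)) {ζ : CSpace d}
    (hζ : ζ ∈ Omega d α ∪ range ofRealVec) : conv (heatC z) (fun _ => 1) ζ = 1 := by
  have hα : 0 < α := zero_lt_one.trans hα1
  have hreal : ∀ x : RSpace d, conv (heatC z) (fun _ => 1) (ofRealVec x) = 1 := fun x => by
    rw [conv_ofRealVec]
    simpa using integral_heatC hz.1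
  have hone : IsHolExt α (fun _ : RSpace d => (1 : ℂ)) fun _ => 1 :=
    ⟨continuousOn_const, differentiableOn_const _, fun _ _ => rfl⟩
  let one : XSpace d α hα := ⟨fun _ => 1, ⟨uniformContinuous_const, 1, by simp⟩, _, hone⟩
  rcases hζ with hζ | ⟨x, rfl⟩
  · have h1 := (gaussKernel_heatC_X hα1 hz).isHolExt_conv hα1 one
    have h2 : IsHolExt α (fun x => conv (heatC z) one (ofRealVec x)) fun _ => 1 := by
      rw [show (fun x : RSpace d => conv (heatC z) one (ofRealVec x)) = fun _ => 1 from
        funext hreal]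
      exact hone
    exact h1.unique hα h2 (subset_closure hζ)
  · exact hreal x

lemma exists_norm_convX_heatC_sub_le (hα1 : 1 < α) (f : XSpace d α hα) {ε : ℝ} (hε : 0 < ε) :
    ∃ r > 0, ∀ z (hz : z ∈ timeCone (timeSlope α)), ‖z‖ < r →
      ‖(gaussKernel_heatC_X hα1 hz).convX hα1 f - f‖ ≤ ε := by
  have hκ := coneRate_pos hα1
  set G : ℝ := 2 * (4 / coneRate α) ^ ((d : ℝ) / 2) with hG
  have hG0 : 0 < G := by positivity
  obtain ⟨δ, hδ, h⟩ := f.exists_norm_glue_sub_le (ε := ε / (4 * G)) (by positivity)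
  set D : ℝ := 2 * ‖f‖ / δ ^ 2 with hD
  have hD0 : 0 ≤ D := by positivity
  refine ⟨ε / (4 * G) * coneRate α / (32 * (D + 1)), by positivity, fun z hz hzr => ?_⟩
  have hK := gaussKernel_heatC_X (d := d) hα1 hz
  have hσ1 : timeSlope α ≤ 1 := (timeSlope_lt_quarter hα1).le.trans (by norm_num)
  have hm := hK.pos
  have key : ∀ ζ ∈ Omega d α ∪ range ofRealVec, ‖conv (heatC z) f ζ - f.glue ζ‖ ≤ ε / 2 := by
    intro ζ hζ
    have h1 := f.norm_conv_sub_le hα1 hK hζ (c₀ := f.glue ζ) (A := ε / (4 * G)) (D := D)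
      (by positivity) hD0 (fun w hw => by
        rcases lt_or_ge ‖ζ - w‖ δ with h2 | h2
        · rw [norm_sub_rev]
          have := h ζ hζ w hw h2
          have : 0 ≤ D * ‖ζ - w‖ ^ 2 := by positivity
          linarith
        · have h3 : 2 * ‖f‖ ≤ D * ‖ζ - w‖ ^ 2 := by
            rw [hD, div_mul_eq_mul_div, le_div_iff₀ (by positivity)]
            exact mul_le_mul_of_nonneg_left (pow_le_pow_left₀ hδ.le h2 2) (by positivity)
          have h4 := norm_sub_le (f.glue w) (f.glue ζ)
          have h5 := f.norm_glue_le w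
          have h6 := f.norm_glue_le ζ
          have : 0 ≤ ε / (4 * G) := by positivity
          linarith)
    rw [conv_heatC_one hα1 hz hζ, mul_one] at h1
    refine h1.trans ?_
    have h2 : 4 * D / (heatRate z * coneRate α) ≤ ε / (4 * G) := by
      calc 4 * D / (heatRate z * coneRate α) = 4 * D / coneRate α * (1 / heatRate z) := by
            field_simp
        _ ≤ 4 * (D + 1) / coneRate α * (8 * ‖z‖) := by
            gcongr
            · linarith
            · exact inv_heatRate_le hσ1 hz
        _ ≤ 4 * (D + 1) / coneRate α *
            (8 * (ε / (4 * G) * coneRate α / (32 * (D + 1)))) := by gcongr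
        _ = ε / (4 * G) := by field_simp; ring
    have h3 := heatAmp_mul_le (d := d) hσ1 hz hκ
    calc 2 * heatAmp d z * (ε / (4 * G) + 4 * D / (heatRate z * coneRate α)) *
          (2 * Real.pi / (heatRate z * coneRate α)) ^ ((d : ℝ) / 2)
        = 2 * (heatAmp d z * (2 * Real.pi / (heatRate z * coneRate α)) ^ ((d : ℝ) / 2)) *
          (ε / (4 * G) + 4 * D / (heatRate z * coneRate α)) := by ring
      _ ≤ 2 * (4 / coneRate α) ^ ((d : ℝ) / 2) * (ε / (4 * G) + ε / (4 * G)) := by gcongr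
      _ = ε / 2 := by rw [← hG]; field_simp; ring
  have hext : IsHolExt α (((hK.convX hα1 f - f : XSpace d α hα)) : RSpace d → ℂ)
      (conv (heatC z) f + (-1 : ℂ) • f.ext) := by
    have h1 := (hK.isHolExt_conv hα1 f).add (f.holExt.smul (-1))
    have e : (((hK.convX hα1 f - f : XSpace d α hα)) : RSpace d → ℂ) =
        (fun x => conv (heatC z) f (ofRealVec x)) + (-1 : ℂ) • (f : RSpace d → ℂ) := by
      rw [XSpace.coe_sub, sub_eq_add_neg, neg_one_smul]; rfl
    rw [e]; exact h1
  refine (XSpace.norm_le_of_forall _ hext (half_pos hε).le (fun x => ?_) fun ζ hζ => ?_).trans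
    (add_halves ε).le
  · have := key (ofRealVec x) (Or.inr ⟨x, rfl⟩)
    rw [f.glue_ofRealVec] at this
    exact this
  · have := key ζ (Or.inl hζ)
    rw [f.glue_of_mem hζ] at this
    simpa [sub_eq_add_neg] using this

lemma tendsto_heatS (hα1 : 1 < α) (f : XOneSpace d α hα) :
    Tendsto (fun z => heatS hα1 z f) (𝓝[timeCone (timeSlope α)] 0) (𝓝 f) := by
  have hX : ∀ g : XSpace d α hα, ∀ u : ℂ → XSpace d α hα,
      (∀ z (hz : z ∈ timeCone (timeSlope α)),
        u z = (gaussKernel_heatC_X hα1 hz).convX hα1 g - g) →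
      Tendsto (fun z => ‖u z‖) (𝓝[timeCone (timeSlope α)] 0) (𝓝 0) := by
    intro g u hu
    rw [Metric.tendsto_nhds]
    intro ε hε
    obtain ⟨r, hr, h⟩ := exists_norm_convX_heatC_sub_le hα1 g (half_pos hε)
    filter_upwards [self_mem_nhdsWithin, mem_nhdsWithin_of_mem_nhds (Metric.ball_mem_nhds 0 hr)]
      with z hz hzr
    have h1 := h z hz (by simpa using hzr)
    rw [hu z hz, dist_zero_right, norm_norm]
    linarith
  rw [tendsto_iff_norm_sub_tendsto_zero]
  have h1 := hX f.toX (fun z => (heatS hα1 z f - f).toX) fun z hz => by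
    rw [XOneSpace.toX_sub, heatS_of_mem hα1 hz, GaussKernel.toX_convXOne]
  have h2 := fun j => hX (f.partial j) (fun z => (heatS hα1 z f - f).partial j) fun z hz => by
    rw [XOneSpace.partial_sub, heatS_of_mem hα1 hz, GaussKernel.partial_convXOne]
  have h3 := h1.add (tendsto_finsetSum Finset.univ fun j _ => h2 j)
  simpa [XOneSpace.norm_def] using h3

lemma sector_subset_timeCone {σ δ : ℝ} (hδσ : 2 * δ ≤ σ) (hδ1 : δ ≤ 1) :
    sector δ ⊆ timeCone σ := by
  rintro z ⟨hz0, hz⟩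
  have hn : 0 < ‖z‖ := norm_pos_iff.2 hz0
  have hcos : 1 / 2 < Real.cos z.arg := by
    have h1 := Real.one_sub_sq_div_two_le_cos (x := z.arg)
    have h2 : z.arg ^ 2 < 1 := (sq_lt_one_iff_abs_lt_one _).2 (hz.trans_le hδ1)
    linarith
  have hδ0 : 0 < δ := (abs_nonneg _).trans_lt hz
  have hsin : |Real.sin z.arg| < σ * Real.cos z.arg := by
    have h1 := Real.abs_sin_le_abs (x := z.arg)
    nlinarith
  change 0 < z.re ∧ |z.im| < σ * z.re
  rw [← Complex.norm_mul_cos_arg z, ← Complex.norm_mul_sin_arg z, abs_mul, abs_norm]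
  exact ⟨by positivity, by nlinarith⟩

end StrongContinuity

/-! ### The heat semigroup at real times -/

section RealTimes

variable {d : ℕ} {α : ℝ} {hα : 0 < α}

lemma heatC_ofReal {t : ℝ} (ht : 0 < t) (x : RSpace d) :
    heatC (t : ℂ) (ofRealVec x) = (heatKernel d t x : ℂ) := by
  have := Real.pi_pos
  rw [heatC_ofRealVec, heatKernel, Complex.ofReal_mul, Complex.ofReal_exp,
    Complex.ofReal_cpow (by positivity)]
  push_cast
  ring_nf

lemma conv_heatC_eq_heatOp {t : ℝ} (ht : 0 < t) (f : RSpace d → ℂ) (x : RSpace d) :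
    conv (heatC (t : ℂ)) f (ofRealVec x) = heatOp t f x := by
  simp only [conv, heatOp, ← ofRealVec_sub, heatC_ofReal ht]

/-- The gradient estimate for the heat semigroup. -/
lemma exists_partialDeriv_heatOp (hα1 : 1 < α) {t : ℝ} (ht : 0 < t) (f : XOneSpace d α hα) :
    ∃ v : Fin d → XOneSpace d α hα, (∀ j x, v j x = partialDeriv j (heatOp t f) x) ∧
      √t * ∑ j, ‖v j‖ ≤
        d * ((1 + d) * (4 * (4 / coneRate α) ^ ((d : ℝ) / 2) / √(timeSlope α))) * ‖f‖ := by
  have hσ := timeSlope_pos hα1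
  have htc := ofReal_mem_timeCone hσ ht
  have hK := gaussKernel_heatC_X (d := d) hα1 htc
  have hK' := fun j => (gaussKernel_fderiv_heatC (d := d) hσ ht j).mono
    (τ' := kernelTau α) (by unfold timeSlope; linarith)
  have hop : heatOp t f = fun x => conv (heatC (t : ℂ)) f (ofRealVec x) :=
    funext fun x => (conv_heatC_eq_heatOp ht f x).symm
  set v : Fin d → XOneSpace d α hα := fun j => ⟨fun x => conv (heatC (t : ℂ)) (f.partial j)
    (ofRealVec x), hK.memXOne_conv_of_kernel hα1 hK' (f.partial j)⟩ with hv
  have hst : 0 < √t := Real.sqrt_pos.2 ht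
  have hss : 0 < √(timeSlope α) := Real.sqrt_pos.2 hσ
  set C₀ : ℝ := 4 * (4 / coneRate α) ^ ((d : ℝ) / 2) with hC₀
  have hbound : ∀ (j : Fin d) (g : XSpace d α hα), ‖g‖ ≤ ‖f‖ →
      √t * ‖(hK' j).convX hα1 g‖ ≤ C₀ / √(timeSlope α) * ‖f‖ := by
    intro j g hg
    have h1 := (hK' j).norm_convX_le hα1 g
    have h2 : convBound d α (heatAmp d t / (√(timeSlope α) * √t)) (heatRate t) ≤
        C₀ / (√(timeSlope α) * √t) := by
      have h3 := convBound_heat_le (d := d)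
        ((timeSlope_lt_quarter hα1).le.trans (by norm_num)) htc hα1
      rw [convBound] at h3 ⊢
      rw [← hC₀] at h3
      calc _ = 4 * heatAmp d t * (2 * Real.pi / (heatRate t * coneRate α)) ^ ((d : ℝ) / 2) /
            (√(timeSlope α) * √t) := by ring
        _ ≤ _ := div_le_div_of_nonneg_right h3 (by positivity)
    have hC : 0 ≤ C₀ / (√(timeSlope α) * √t) := by
      have := coneRate_pos hα1
      positivity
    calc √t * ‖(hK' j).convX hα1 g‖ ≤ √t * (C₀ / (√(timeSlope α) * √t) * ‖f‖) := by
          refine mul_le_mul_of_nonneg_left (h1.trans ?_) hst.le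
          exact mul_le_mul h2 hg (norm_nonneg _) hC
      _ = _ := by field_simp
  have hvX : ∀ j, (v j).toX = (hK' j).convX hα1 f.toX := fun j => by
    refine Subtype.ext ?_
    have h1 := hK.partialDeriv_conv_fun hα1 f j
    have h2 := hK.partialDeriv_conv_kernel hα1 f.toX j
    exact h1.symm.trans h2
  have hvD : ∀ j k, (v j).partial k = (hK' k).convX hα1 (f.partial j) := fun j k =>
    Subtype.ext (hK.partialDeriv_conv_kernel hα1 (f.partial j) k)
  refine ⟨v, fun j x => ?_, ?_⟩
  · rw [hop, hK.partialDeriv_conv_fun hα1 f j]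
  · have h1 : ∀ j, √t * ‖v j‖ ≤ (1 + d) * (C₀ / √(timeSlope α)) * ‖f‖ := fun j => by
      rw [XOneSpace.norm_def, mul_add, Finset.mul_sum, hvX]
      simp only [hvD]
      have h2 := hbound j f.toX (XOneSpace.norm_toX_le f)
      have h3 := Finset.sum_le_card_nsmul Finset.univ
        (fun k => √t * ‖(hK' k).convX hα1 (f.partial j)‖) _
        fun k _ => hbound k (f.partial j) (XOneSpace.norm_partial_le j f)
      rw [Finset.card_univ, Fintype.card_fin, nsmul_eq_mul] at h3
      linarith
    rw [Finset.mul_sum]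
    have h2 := Finset.sum_le_card_nsmul Finset.univ (fun j => √t * ‖v j‖) _ fun j _ => h1 j
    rw [Finset.card_univ, Fintype.card_fin, nsmul_eq_mul] at h2
    linarith

end RealTimes

end HeatHol

theorem theorem2p6 (d : ℕ) (hd : 1 ≤ d) (α : ℝ) (hα : 1 < α) :
    ∃ (δ : ℝ) (S : ℂ → HeatHol.XOneSpace d α (zero_lt_one.trans hα) →L[ℂ]
        HeatHol.XOneSpace d α (zero_lt_one.trans hα)),
      HeatHol.IsAnalyticSemigroup δ S ∧
      (∀ t : ℝ, 0 < t → ∀ (y₀ : HeatHol.XOneSpace d α (zero_lt_one.trans hα))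
        (x : HeatHol.RSpace d), S t y₀ x = HeatHol.heatOp t y₀ x) ∧
      ∃ C : ℝ, 0 < C ∧ ∀ t : ℝ, 0 < t →
        ∀ y₀ : HeatHol.XOneSpace d α (zero_lt_one.trans hα),
          ∃ v : Fin d → HeatHol.XOneSpace d α (zero_lt_one.trans hα),
            (∀ (j : Fin d) (x : HeatHol.RSpace d),
              v j x = HeatHol.partialDeriv j (HeatHol.heatOp t y₀) x) ∧
            ‖S t y₀‖ + √t * ∑ j, ‖v j‖ ≤ C * ‖y₀‖ := by
  have hσ := HeatHol.timeSlope_pos hα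
  have hσ1 := HeatHol.timeSlope_lt_quarter hα
  have hκ := HeatHol.coneRate_pos hα
  have hsub : HeatHol.sector (HeatHol.timeSlope α / 2) ⊆
      HeatHol.timeCone (HeatHol.timeSlope α) :=
    HeatHol.sector_subset_timeCone (by linarith) (by linarith)
  refine ⟨HeatHol.timeSlope α / 2, HeatHol.heatS hα, ⟨half_pos hσ, ?_, HeatHol.heatS_zero hα,
    fun z hz w hw => HeatHol.heatS_add hα (hsub hz) (hsub hw),
    (HeatHol.analyticOnNhd_heatS hα).mono hsub, fun δ' hδ' hlt f => ?_⟩, fun t ht f x => ?_,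
    4 * (4 / HeatHol.coneRate α) ^ ((d : ℝ) / 2) + d * ((1 + d) *
      (4 * (4 / HeatHol.coneRate α) ^ ((d : ℝ) / 2) / √(HeatHol.timeSlope α))),
    by positivity, fun t ht f => ?_⟩
  · linarith [Real.pi_gt_three]
  · refine (HeatHol.tendsto_heatS hα f).mono_left (nhdsWithin_mono _ ?_)
    exact HeatHol.sector_subset_timeCone (by linarith) (by linarith)
  · rw [HeatHol.heatS_apply hα (HeatHol.ofReal_mem_timeCone hσ ht),
      HeatHol.conv_heatC_eq_heatOp ht]
  · obtain ⟨v, hv, hle⟩ := HeatHol.exists_partialDeriv_heatOp hα ht f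
    refine ⟨v, hv, ?_⟩
    have htc := HeatHol.ofReal_mem_timeCone hσ ht
    have h1 : ‖HeatHol.heatS hα t f‖ ≤
        4 * (4 / HeatHol.coneRate α) ^ ((d : ℝ) / 2) * ‖f‖ := by
      rw [HeatHol.heatS_of_mem hα htc]
      refine (ContinuousLinearMap.le_opNorm _ _).trans
        (mul_le_mul_of_nonneg_right ?_ (norm_nonneg f))
      exact ((HeatHol.gaussKernel_heatC_X hα htc).norm_convXOne_le hα).trans
        (HeatHol.convBound_heat_le (by linarith) htc hα)
    rw [add_mul]
    linarith
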